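/- **Notation.** Let $d\ge 1$, let $\mathcal D$ be the space of smooth compactly supported functions $\mathbb R^d\to\mathbb R$ and $\mathcal D'$ the space of real distributions on $\mathbb R^d$. Let $B_a$ be the open ball of radius $a$ centred at $0$. For $\eta\in\mathcal D$, $x\in\mathbb R^d$, $\lambda>0$ put $\eta^\lambda_x(y)=\lambda^{-d}\eta((y-x)/\lambda)$. Fix $\varphi\in\mathcal D$ with $\operatorname{supp}\varphi\subset B_1$ and $\int\varphi=1$, and put $\varphi^{(n)}_x=2^{nd}\varphi(2^n(\cdot-x))$. For $\alpha<0$ and $E\subset\mathbb R^d$ let $$\|\zeta\|_{\alpha;E}=\sup_{\eta}\ \sup_{\lambda\in(0,1)}\ \sup_{x\in E}\lambda^{-\alpha}|\langle\zeta,\eta^\lambda_x\rangle|,\qquad \zeta\in\mathcal D',$$ where $\eta$ ranges over all $\eta\in\mathcal D$ with $\operatorname{supp}\eta\subset B_1$ and $\|\eta\|_{C^r}\le 1$, $r=\lceil-\alpha\rceil$. Let $\mathcal C^\alpha$ be the set of $\zeta\in\mathcal D'$ with $\|\zeta\|_{\alpha;E}<\infty$ for every compact $E$, with the translation invariant distance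 $d_\alpha(\zeta,\zeta')=\sum_{m\ge1}2^{-m}\bigl(1\wedge\|\zeta-\zeta'\|_{\alpha;B_m}\bigr)$. For $\gamma,T>0$ let $\mathcal C^\gamma([0,T],\mathcal C^\alpha)$ be the space of functions $f:[0,T]\to\mathcal C^\alpha$ that are $\gamma$-Hölder continuous for $d_\alpha$, with the distance $$\sup_{t}d_\alpha(f_t,g_t)+\sup_{s\ne t}\frac{d_\alpha(f_t-f_s,\,g_t-g_s)}{|t-s|^\gamma}$$ and its Borel $\sigma$-algebra. A random distribution is a map $\zeta:\Omega\to\mathcal D'$ on a probability space such that $\langle\zeta,\eta\rangle$ is a random variable for every $\eta\in\mathcal D$. With $\|\cdot\|_p$ the norm of $L^p(\Omega)$ and $|\cdot|$ the sup norm on $\mathbb R^d$, let $\|\zeta\|_{\mathcal C^{\alpha_0}_p}\in[0,\infty]$ be the smallest $C$ such that for every integer $n\ge1$ $$\|\langle\zeta,\varphi^{(n)}_x\rangle\|_p\le C2^{-n\alpha_0}\quad(x\in\mathbb R^d),$$ $$\|\langle\zeta,\varphi^{(n)}_x-\varphi^{(n)}_y\rangle\|_p\le C2^{-n(\alpha_0-1)}|x-y|\quad(0<|x-y|\le2^{-n}).$$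 For a process $\zeta=(\zeta_t)_{t\ge0}$ of random distributions let $$\|\zeta\|_{\mathcal C^{\gamma_0,\alpha_0}_p}=\sup_{t\ge0}\|\zeta_t\|_{\mathcal C^{\alpha_0}_p}+\sup_{s\ne t}\frac{\|\zeta_t-\zeta_s\|_{\mathcal C^{\alpha_0}_p}}{|t-s|^{\gamma_0}}.$$ **Proposition 4.7 (tightness criterion).** Let $\alpha_0<0$, $d<p<\infty$ and $\gamma_0>1/p$. Let $\{\zeta^k,\ k\in\mathcal I\}$ be a family of distribution-valued stochastic processes indexed by $\mathbb R_+$, each on some probability space, with $\sup_{k}\|\zeta^k\|_{\mathcal C^{\gamma_0,\alpha_0}_p}<\infty$. Then, for every $T>0$, every $\alpha<\alpha_0-\frac dp$ and every $\gamma\in(0,\gamma_0-\frac1p)$, the family is tight in $\mathcal C^\gamma([0,T],\mathcal C^\alpha)$. That is, there are Borel random variables $Z^k$ with values in $\mathcal C^\gamma([0,T],\mathcal C^\alpha)$ such that $Z^k_t=\zeta^k_t$ almost surely for every $k$ and every $t\in[0,T]$, and the laws of the $Z^k$, $k\in\mathcal I$, form a tight family: for every $\varepsilon>0$ there is a compact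 $K\subset\mathcal C^\gamma([0,T],\mathcal C^\alpha)$ with $\mathbb P(Z^k\notin K)\le\varepsilon$ for all $k\in\mathcal I$. -/

import Mathlib

open MeasureTheory
open scoped NNReal ENNReal Distributions

namespace RandomDistribution

noncomputable section

/-- `ℝ^d` with its Euclidean norm. -/
abbrev Space (d : ℕ) : Type := EuclideanSpace ℝ (Fin d)

/-- The space of smooth compactly supported functions on `ℝ^d`. -/
abbrev Test (d : ℕ) : Type := 𝓓((⊤ : TopologicalSpace.Opens (Space d)), ℝ)

/-- The space of all (real) distributions on `ℝ^d`. -/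
abbrev Distr (d : ℕ) : Type := 𝓓'((⊤ : TopologicalSpace.Opens (Space d)), ℝ)

/-- The rescaled and translated test function
`η^l_x (y) = l^{-d} η ((y - x) / l)`, for `l > 0`. -/
def rescale {d : ℕ} (η : Test d) (l : ℝ) (hl : 0 < l) (x : Space d) : Test d where
  toFun y := (l ^ d)⁻¹ * η (l⁻¹ • (y - x))
  contDiff' := by
    have h : ContDiff ℝ ((⊤ : ℕ∞) : WithTop ℕ∞) (fun y : Space d => l⁻¹ • (y - x)) := by
      fun_prop
    exact contDiff_const.mul (η.contDiff.comp h)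
  hasCompactSupport' := by
    have h : HasCompactSupport (fun y : Space d => η (l⁻¹ • (y - x))) :=
      η.hasCompactSupport.comp_homeomorph
        ((Homeomorph.subRight x).trans (Homeomorph.smulOfNeZero l⁻¹ (inv_ne_zero hl.ne')))
    exact h.mul_left
  tsupport_subset' := fun _ _ => trivial

/-- The function `φ^{(n)}_x = 2^{nd} φ (2^n (· - x))`. -/
def dyadic {d : ℕ} (φ : Test d) (n : ℕ) (x : Space d) : Test d :=
  rescale φ ((2 ^ n)⁻¹) (by positivity) x

theorem dyadic_apply {d : ℕ} (φ : Test d) (n : ℕ) (x y : Space d) :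
    dyadic φ n x y = 2 ^ (n * d) * φ ((2 : ℝ) ^ n • (y - x)) := by
  change (((2 ^ n)⁻¹ : ℝ) ^ d)⁻¹ * φ (((2 ^ n)⁻¹ : ℝ)⁻¹ • (y - x)) = _
  rw [inv_pow, inv_inv, inv_inv, pow_mul]

/-- The set of test functions supported in the open unit ball and
with `C^r` norm (maximum of the sup norms of the derivatives of order at most `r`)
bounded by `1`. -/
def unitTests (d r : ℕ) : Set (Test d) :=
  {η | tsupport η ⊆ Metric.ball 0 1 ∧
    ∀ j ≤ r, ∀ y, ‖iteratedFDeriv ℝ j η y‖ ≤ 1}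

/-! ### The Fréchet space `C^α`, `α < 0` -/

/-- The seminorm `‖ζ‖_{α;E} = sup_η sup_{0<l<1} sup_{x ∈ E} l^{-α} |⟨ζ, η^l_x⟩|`, where `η` ranges
over `unitTests d r` with `r = ⌈-α⌉`. -/
def holderSeminorm {d : ℕ} (α : ℝ) (E : Set (Space d)) (ζ : Distr d) : ℝ≥0∞ :=
  ⨆ η ∈ unitTests d ⌈-α⌉₊, ⨆ l : Set.Ioo (0 : ℝ) 1, ⨆ x ∈ E,
    ENNReal.ofReal ((l : ℝ) ^ (-α) * |ζ (rescale η l l.2.1 x)|)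

/-- The distance `d_α(ζ, 0) = ∑_{m ≥ 1} 2^{-m} (1 ∧ ‖ζ‖_{α;B_m})` to the origin. -/
def holderGauge {d : ℕ} (α : ℝ) (ζ : Distr d) : ℝ≥0∞ :=
  ∑' m : ℕ, (2⁻¹ : ℝ≥0∞) ^ (m + 1) *
    min 1 (holderSeminorm α (Metric.ball 0 ((m : ℝ) + 1)) ζ)

/-- The space `C^α` of locally Hölder continuous distributions. -/
structure HolderDistr (d : ℕ) (α : ℝ) where
  /-- The underlying distribution. -/
  toDistr : Distr d
  finite' : ∀ E : Set (Space d), IsCompact E → holderSeminorm α E toDistr < ⊤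

theorem holderSeminorm_zero {d : ℕ} (α : ℝ) (E : Set (Space d)) :
    holderSeminorm α E (0 : Distr d) = 0 := by
  simp [holderSeminorm]

theorem holderSeminorm_neg {d : ℕ} (α : ℝ) (E : Set (Space d)) (ζ : Distr d) :
    holderSeminorm α E (-ζ) = holderSeminorm α E ζ := by
  simp [holderSeminorm]

theorem holderSeminorm_add_le {d : ℕ} (α : ℝ) (E : Set (Space d)) (ζ ζ' : Distr d) :
    holderSeminorm α E (ζ + ζ') ≤ holderSeminorm α E ζ + holderSeminorm α E ζ' := by
  refine iSup₂_le fun η hη => iSup_le fun l => iSup₂_le fun x hx => ?_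
  have key : ∀ ξ : Distr d, ENNReal.ofReal ((l : ℝ) ^ (-α) * |ξ (rescale η l l.2.1 x)|) ≤
      holderSeminorm α E ξ := fun ξ =>
    le_iSup₂_of_le η hη (le_iSup_of_le l (le_iSup₂_of_le x hx le_rfl))
  refine le_trans ?_ (add_le_add (key ζ) (key ζ'))
  have hl : 0 ≤ (l : ℝ) ^ (-α) := Real.rpow_nonneg l.2.1.le _
  rw [← ENNReal.ofReal_add (by positivity) (by positivity), ← mul_add]
  refine ENNReal.ofReal_le_ofReal (mul_le_mul_of_nonneg_left ?_ hl)
  exact abs_add_le _ _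

theorem holderGauge_zero {d : ℕ} (α : ℝ) : holderGauge α (0 : Distr d) = 0 := by
  simp [holderGauge, holderSeminorm_zero]

theorem holderGauge_neg {d : ℕ} (α : ℝ) (ζ : Distr d) :
    holderGauge α (-ζ) = holderGauge α ζ := by
  simp [holderGauge, holderSeminorm_neg]

theorem holderGauge_add_le {d : ℕ} (α : ℝ) (ζ ζ' : Distr d) :
    holderGauge α (ζ + ζ') ≤ holderGauge α ζ + holderGauge α ζ' := by
  unfold holderGauge
  rw [← ENNReal.tsum_add]
  refine ENNReal.tsum_le_tsum fun m => ?_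
  rw [← mul_add]
  gcongr
  refine (min_le_min_left 1 (holderSeminorm_add_le α _ ζ ζ')).trans ?_
  rcases le_total 1 (holderSeminorm α (Metric.ball 0 ((m : ℝ) + 1)) ζ) with h | h
  · rw [min_eq_left h]
    exact (min_le_left _ _).trans le_self_add
  rcases le_total 1 (holderSeminorm α (Metric.ball 0 ((m : ℝ) + 1)) ζ') with h' | h'
  · rw [min_eq_left h']
    exact (min_le_left _ _).trans le_add_self
  · rw [min_eq_right h, min_eq_right h']
    exact min_le_right _ _

/-- `C^α` with the distance `d_α(ζ, ζ') = ∑_{m ≥ 1} 2^{-m} (1 ∧ ‖ζ - ζ'‖_{α;B_m})`. -/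
instance {d : ℕ} {α : ℝ} : PseudoEMetricSpace (HolderDistr d α) where
  edist ζ ζ' := holderGauge α (ζ.toDistr - ζ'.toDistr)
  edist_self ζ := by simp [holderGauge_zero]
  edist_comm ζ ζ' := by rw [← neg_sub, holderGauge_neg]
  edist_triangle ζ₁ ζ₂ ζ₃ := by
    rw [← sub_add_sub_cancel ζ₁.toDistr ζ₂.toDistr ζ₃.toDistr]
    exact holderGauge_add_le α _ _

/-! ### The path space `C^γ([0,T], C^α)` -/

/-- The space `C^γ([0,T], C^α)` of functions that are `γ`-Hölder continuous for the
distance `d_α`. -/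
structure HolderPath (d : ℕ) (α : ℝ) (γ T : ℝ≥0) where
  /-- The underlying function. -/
  toFun : Set.Icc (0 : ℝ≥0) T → HolderDistr d α
  memHolder' : MemHolder γ toFun

/-- The increment `f_t - f_s`, a distribution. -/
def HolderPath.incr {d : ℕ} {α : ℝ} {γ T : ℝ≥0} (f : HolderPath d α γ T)
    (s t : Set.Icc (0 : ℝ≥0) T) : Distr d :=
  (f.toFun t).toDistr - (f.toFun s).toDistr

/-- The quotient `d_α(f_t - f_s, g_t - g_s) / |t - s|^γ`. -/
def HolderPath.quot {d : ℕ} {α : ℝ} {γ T : ℝ≥0} (f g : HolderPath d α γ T)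
    (s t : Set.Icc (0 : ℝ≥0) T) : ℝ≥0∞ :=
  holderGauge α (f.incr s t - g.incr s t) / edist s t ^ (γ : ℝ)

theorem HolderPath.quot_triangle {d : ℕ} {α : ℝ} {γ T : ℝ≥0} (f g h : HolderPath d α γ T)
    (s t : Set.Icc (0 : ℝ≥0) T) : f.quot h s t ≤ f.quot g s t + g.quot h s t := by
  unfold HolderPath.quot
  rw [← ENNReal.add_div, ← sub_add_sub_cancel (f.incr s t) (g.incr s t) (h.incr s t)]
  exact ENNReal.div_le_div_right (holderGauge_add_le α _ _) _

theorem HolderPath.quot_comm {d : ℕ} {α : ℝ} {γ T : ℝ≥0} (f g : HolderPath d α γ T)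
    (s t : Set.Icc (0 : ℝ≥0) T) : f.quot g s t = g.quot f s t := by
  unfold HolderPath.quot
  rw [← neg_sub, holderGauge_neg]

/-- The Hölder distance
`sup_t d_α(f_t, g_t) + sup_{s ≠ t} d_α(f_t - f_s, g_t - g_s) / |t - s|^γ`
on `C^γ([0,T], C^α)`. -/
def HolderPath.pathDist {d : ℕ} {α : ℝ} {γ T : ℝ≥0} (f g : HolderPath d α γ T) : ℝ≥0∞ :=
  (⨆ t, edist (f.toFun t) (g.toFun t)) + ⨆ s, ⨆ t, ⨆ _ : s ≠ t, f.quot g s t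

theorem HolderPath.pathDist_self {d : ℕ} {α : ℝ} {γ T : ℝ≥0} (f : HolderPath d α γ T) :
    f.pathDist f = 0 := by
  simp [HolderPath.pathDist, HolderPath.quot, holderGauge_zero]

theorem HolderPath.pathDist_comm {d : ℕ} {α : ℝ} {γ T : ℝ≥0} (f g : HolderPath d α γ T) :
    f.pathDist g = g.pathDist f := by
  simp only [HolderPath.pathDist, edist_comm (f.toFun _), HolderPath.quot_comm f g]

theorem HolderPath.pathDist_triangle {d : ℕ} {α : ℝ} {γ T : ℝ≥0}
    (f g h : HolderPath d α γ T) : f.pathDist h ≤ f.pathDist g + g.pathDist h := by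
  unfold HolderPath.pathDist
  rw [add_add_add_comm]
  refine add_le_add (iSup_le fun t => ?_)
    (iSup_le fun s => iSup_le fun t => iSup_le fun hst => ?_)
  · exact (edist_triangle _ (g.toFun t) _).trans (add_le_add
      (le_iSup (fun t => edist (f.toFun t) (g.toFun t)) t)
      (le_iSup (fun t => edist (g.toFun t) (h.toFun t)) t))
  · have key : ∀ u v : HolderPath d α γ T,
        u.quot v s t ≤ ⨆ s, ⨆ t, ⨆ _ : s ≠ t, u.quot v s t := fun u v =>
      le_iSup_of_le s (le_iSup_of_le t (le_iSup_of_le hst le_rfl))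
    exact (HolderPath.quot_triangle f g h s t).trans (add_le_add (key f g) (key g h))

instance {d : ℕ} {α : ℝ} {γ T : ℝ≥0} : PseudoEMetricSpace (HolderPath d α γ T) where
  edist := HolderPath.pathDist
  edist_self := HolderPath.pathDist_self
  edist_comm := HolderPath.pathDist_comm
  edist_triangle := HolderPath.pathDist_triangle

/-- The path space carries its Borel σ-algebra. -/
instance {d : ℕ} {α : ℝ} {γ T : ℝ≥0} : MeasurableSpace (HolderPath d α γ T) := borel _

instance {d : ℕ} {α : ℝ} {γ T : ℝ≥0} : BorelSpace (HolderPath d α γ T) := ⟨rfl⟩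

/-! ### Random distributions and the spaces `C^{α₀}_p`, `C^{γ₀,α₀}_p` -/

/-- A map `ζ : Ω → 𝓓'` is a random distribution if its pairing with each test function is a
random variable. -/
def IsRandomDistr {d : ℕ} {Ω : Type*} [MeasurableSpace Ω] (ζ : Ω → Distr d) : Prop :=
  ∀ η : Test d, Measurable fun ω => ζ ω η

/-- The norm of a random distribution in `C^{α₀}_p`: the smallest `C` such that for all `n ≥ 1`,
`‖⟨ζ, φ^{(n)}_x⟩‖_p ≤ C 2^{-n α₀}` for all `x`, and
`‖⟨ζ, φ^{(n)}_x - φ^{(n)}_y⟩‖_p ≤ C 2^{-n (α₀ - 1)} |x - y|` whenever `0 < |x - y| ≤ 2^{-n}`.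
Here `|·|` is the sup norm on `ℝ^d`. -/
def momentNorm {d : ℕ} {Ω : Type*} [MeasurableSpace Ω] (P : Measure Ω) (φ : Test d)
    (p α₀ : ℝ) (ζ : Ω → Distr d) : ℝ≥0∞ :=
  sInf {C : ℝ≥0∞ | ∀ n : ℕ, 1 ≤ n →
    (∀ x : Space d, eLpNorm (fun ω => ζ ω (dyadic φ n x)) (ENNReal.ofReal p) P ≤
      C * ENNReal.ofReal ((2 : ℝ) ^ (-(n : ℝ) * α₀))) ∧
    (∀ x y : Space d, 0 < ‖(x - y).ofLp‖ → ‖(x - y).ofLp‖ ≤ ((2 : ℝ) ^ n)⁻¹ →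
      eLpNorm (fun ω => ζ ω (dyadic φ n x - dyadic φ n y)) (ENNReal.ofReal p) P ≤
        C * ENNReal.ofReal ((2 : ℝ) ^ (-(n : ℝ) * (α₀ - 1)) * ‖(x - y).ofLp‖))}

/-- The norm of a distribution-valued process in `C^{γ₀,α₀}_p = C^{γ₀}(ℝ₊, C^{α₀}_p)`:
`sup_t ‖ζ_t‖ + sup_{s ≠ t} ‖ζ_t - ζ_s‖ / |t - s|^{γ₀}` with the norm of `C^{α₀}_p`. -/
def processNorm {d : ℕ} {Ω : Type*} [MeasurableSpace Ω] (P : Measure Ω) (φ : Test d)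
    (p γ₀ α₀ : ℝ) (ζ : ℝ≥0 → Ω → Distr d) : ℝ≥0∞ :=
  (⨆ t, momentNorm P φ p α₀ (ζ t)) +
    ⨆ s, ⨆ t, ⨆ _ : s ≠ t,
      momentNorm P φ p α₀ (fun ω => ζ t ω - ζ s ω) / edist s t ^ γ₀

end

end RandomDistribution

/-!
Kolmogorov's criterion and an Arzelà–Ascoli theorem, both for paths with values in distributions,
give the tightness. Everything is read off from the pairings `⟨ξ, φ^{(n)}_y⟩` with the rescalings
of the one function `φ`.

The analytic input is a reconstruction theorem, `exists_pairing_bound`. If local averages over `y`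
of `|⟨ξ, φ^{(n)}_y⟩|` are of order `2^{-nβ}`, then every test function smooth of order `r > -β` at
scale `2^{-N}` is paired with `ξ` to order `2^{-Nβ}`. The function `φ` need not be a wavelet nor
satisfy a refinement equation: fixed linear combinations `kern` of `φ^{(n)}, …, φ^{(n+r-1)}` have
integral one and vanishing moments up to order `r - 1`, and `ξ * kern_n * kern_{n+1}` telescopes to
`ξ` with increments that decay geometrically. Two consequences carry the proof: pointwise growth
bounds on the pairings control the Hölder seminorms (`exists_holderSeminorm_le`), and bounds in
`L^p` of the variable `y` become pointwise bounds at the cost of `d / p` in the exponent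
(`exists_pairing_dyadic_le`).

The moment assumption is integrated over `y`, against a finite measure with a polynomially decaying
density, and summed over the scales and over the edges of the dyadic subdivisions of `[0, T]`. This
gives one random variable, the `processEnergy`, with expectation bounded uniformly over the family
(`exists_lintegral_processEnergy_le`); the losses `d / p` in space and `1 / p` in time leave room
for the sums to converge. Where this energy is finite, chaining along the dyadic times yields a path
with bounds that grow polynomially in space (`exists_holderPath_of_processEnergy`), and this path is
a modification of the process because the process is continuous in `L^p`
(`ae_eq_of_tendsto_gridFloor`).

Paths with a given such bound, with exponents strictly better than those of the path space, form a
compact set (`isCompact_setOf_pathBound`): limits along an ultrafilter exist pointwise, and they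
are uniform by equicontinuity, first at each scale, then over all scales by the gain in the
exponents. The weights `2^{-m}` in the distance are summable against the polynomial growth. Markov's
inequality for the energy then gives tightness. Since the path space need not be separable, the
Borel measurability of the modification is not automatic; it holds because the modification takes
values in a countable union of compact sets, on which countably many pairings generate the topology
(`measurable_of_compact_cover`).
-/

namespace RandomDistribution

noncomputable section

open Filter Topology

variable {d : ℕ}

section

open scoped ContDiff

/-! ### Translation and convolution of test functions -/

/-- The translate `y ↦ ψ (y - w)` of a test function. -/
def shift (ψ : Test d) (w : Space d) : Test d where
  toFun y := ψ (y - w)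
  contDiff' := ψ.contDiff.comp (contDiff_id.sub contDiff_const)
  hasCompactSupport' := ψ.hasCompactSupport.comp_homeomorph (Homeomorph.subRight w)
  tsupport_subset' := fun _ _ => trivial

@[simp]
theorem shift_apply (ψ : Test d) (w y : Space d) : shift ψ w y = ψ (y - w) := rfl

theorem shift_zero (ψ : Test d) : shift ψ 0 = ψ := by ext y; simp

theorem shift_shift (ψ : Test d) (v w : Space d) : shift (shift ψ v) w = shift ψ (w + v) := by
  ext y; simp [sub_sub]

theorem iteratedFDeriv_shift (ψ : Test d) (w y : Space d) (j : ℕ) :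
    iteratedFDeriv ℝ j (shift ψ w) y = iteratedFDeriv ℝ j ψ (y - w) :=
  congrFun (iteratedFDeriv_comp_sub' (𝕜 := ℝ) (f := ψ) j w) y

theorem Test.contDiff_infty (ψ : Test d) : ContDiff ℝ ∞ ψ := ψ.contDiff

theorem Test.integrable (ψ : Test d) : Integrable (ψ : Space d → ℝ) :=
  ψ.continuous.integrable_of_hasCompactSupport ψ.hasCompactSupport

theorem Test.exists_support_bound (ψ : Test d) : ∃ R : ℝ, 0 ≤ R ∧ ∀ y, R < ‖y‖ → ψ y = 0 := by
  obtain ⟨R, hR⟩ := ψ.hasCompactSupport.isCompact.isBounded.exists_norm_le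
  refine ⟨max R 0, le_max_right _ _, fun y hy => ?_⟩
  by_contra h
  exact absurd (hR y (subset_tsupport _ h)) (not_le.2 ((le_max_left _ _).trans_lt hy))

theorem Test.exists_iteratedFDeriv_bound (ψ : Test d) (j : ℕ) :
    ∃ C : ℝ, 0 ≤ C ∧ ∀ y, ‖iteratedFDeriv ℝ j ψ y‖ ≤ C := by
  obtain ⟨C, hC⟩ := (ψ.contDiff_infty.continuous_iteratedFDeriv
    (m := j) (by exact_mod_cast le_top)).bounded_above_of_compact_support
      (ψ.hasCompactSupport.iteratedFDeriv j)
  exact ⟨C, (norm_nonneg _).trans (hC 0), hC⟩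

theorem Test.exists_bound_of_le (ψ : Test d) (N : ℕ) :
    ∃ C : ℝ, 0 ≤ C ∧ ∀ j ≤ N, ∀ y, ‖iteratedFDeriv ℝ j ψ y‖ ≤ C := by
  choose C h0 hC using ψ.exists_iteratedFDeriv_bound
  refine ⟨∑ j ∈ Finset.range (N + 1), C j, Finset.sum_nonneg fun j _ => h0 j, fun j hj y => ?_⟩
  exact (hC j y).trans (Finset.single_le_sum (f := C) (fun j _ => h0 j)
    (Finset.mem_range.2 (Nat.lt_succ_of_le hj)))

theorem uniformContinuous_iteratedFDeriv (ψ : Test d) (j : ℕ) :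
    UniformContinuous (iteratedFDeriv ℝ j ψ) :=
  (ψ.hasCompactSupport.iteratedFDeriv j).uniformContinuous_of_continuous
    (ψ.contDiff_infty.continuous_iteratedFDeriv (m := j) (by exact_mod_cast le_top))

/-- Differentiation of a convolution falls on the second factor. The vector-valued statement is
what makes the induction on the order of differentiation work. -/
theorem iteratedFDeriv_convolution {G : Type*} [NormedAddCommGroup G] [NormedSpace ℝ G]
    [CompleteSpace G] (f : Test d) (ψ : Space d → G) (hψ : ContDiff ℝ ∞ ψ)
    (hs : HasCompactSupport ψ) (j : ℕ) (z : Space d) :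
    iteratedFDeriv ℝ j (fun z => ∫ w, f w • ψ (z - w)) z =
      ∫ w, f w • iteratedFDeriv ℝ j ψ (z - w) := by
  have hint : ∀ {G' : Type _} [NormedAddCommGroup G'] [NormedSpace ℝ G'] (g : Space d → G')
      (_ : Continuous g) (z : Space d), Integrable (fun w => f w • g (z - w)) := fun g hg z =>
    (f.continuous.smul (hg.comp (continuous_const.sub continuous_id))
      ).integrable_of_hasCompactSupport f.hasCompactSupport.smul_right
  induction j generalizing z with
  | zero =>
    ext m
    rw [ContinuousMultilinearMap.integral_apply (hint _ (hψ.continuous_iteratedFDeriv (m := 0)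
      (by exact_mod_cast le_top)) z)]
    simp
  | succ j ih =>
    have hg : ContDiff ℝ ∞ (iteratedFDeriv ℝ j ψ) := by
      apply hψ.iteratedFDeriv_right (m := ∞)
      exact_mod_cast le_top
    have key := (hs.iteratedFDeriv (𝕜 := ℝ) j).hasFDerivAt_convolution_right
      (ContinuousLinearMap.lsmul ℝ ℝ) (μ := volume) f.integrable.locallyIntegrable
      (hg.of_le (by exact_mod_cast le_top)) z
    have h1 : (fun z => ∫ w, f w • iteratedFDeriv ℝ j ψ (z - w)) =
      convolution f (iteratedFDeriv ℝ j ψ) (ContinuousLinearMap.lsmul ℝ ℝ) volume := rfl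
    have h2 : iteratedFDeriv ℝ j (fun z => ∫ w, f w • ψ (z - w)) =
      fun z => ∫ w, f w • iteratedFDeriv ℝ j ψ (z - w) := funext ih
    ext m
    have h3 : ∀ w, (ContinuousLinearMap.precompR (Space d) (ContinuousLinearMap.lsmul ℝ ℝ)) (f w)
        (fderiv ℝ (iteratedFDeriv ℝ j ψ) (z - w)) =
          f w • fderiv ℝ (iteratedFDeriv ℝ j ψ) (z - w) := fun w => by
      ext v : 1
      simp [ContinuousLinearMap.precompR_apply]
    have h4 := hint (fderiv ℝ (iteratedFDeriv ℝ j ψ)) (hg.continuous_fderiv (by simp)) z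
    have h5 := hint (fun y => fderiv ℝ (iteratedFDeriv ℝ j ψ) y (m 0))
      ((hg.continuous_fderiv (by simp)).clm_apply continuous_const) z
    rw [iteratedFDeriv_succ_apply_left, h2, h1, key.fderiv, convolution]
    simp_rw [h3]
    rw [ContinuousLinearMap.integral_apply h4]
    simp only [smul_apply]
    rw [ContinuousMultilinearMap.integral_apply h5, ContinuousMultilinearMap.integral_apply
      (hint _ (hψ.continuous_iteratedFDeriv (by exact_mod_cast le_top)) z)]
    simp [iteratedFDeriv_succ_apply_left]

/-- The convolution of two test functions. -/
def conv (f ψ : Test d) : Test d where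
  toFun z := ∫ w, f w • ψ (z - w)
  contDiff' := HasCompactSupport.contDiff_convolution_right (n := ⊤) (μ := volume)
    (f := (f : Space d → ℝ)) (g := (ψ : Space d → ℝ)) (ContinuousLinearMap.lsmul ℝ ℝ)
    ψ.hasCompactSupport f.integrable.locallyIntegrable ψ.contDiff
  hasCompactSupport' := HasCompactSupport.convolution (μ := volume)
    (f := (f : Space d → ℝ)) (g := (ψ : Space d → ℝ)) (ContinuousLinearMap.lsmul ℝ ℝ)
    f.hasCompactSupport ψ.hasCompactSupport
  tsupport_subset' := fun _ _ => trivial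

theorem conv_apply (f ψ : Test d) (z : Space d) : conv f ψ z = ∫ w, f w * ψ (z - w) := rfl

theorem iteratedFDeriv_conv (f ψ : Test d) (j : ℕ) (z : Space d) :
    iteratedFDeriv ℝ j (conv f ψ) z = ∫ w, f w • iteratedFDeriv ℝ j ψ (z - w) :=
  iteratedFDeriv_convolution f ψ ψ.contDiff_infty ψ.hasCompactSupport j z

theorem conv_comm (f g : Test d) : conv f g = conv g f := by
  ext z
  rw [conv_apply, conv_apply, ← integral_sub_left_eq_self _ volume z]
  simp [mul_comm]

theorem shift_conv (f ψ : Test d) (v : Space d) : shift (conv f ψ) v = conv f (shift ψ v) := by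
  ext z
  simp only [shift_apply, conv_apply]
  congr 1; ext w
  rw [sub_right_comm]

theorem conv_left_comm (f g ψ : Test d) : conv f (conv g ψ) = conv g (conv f ψ) := by
  ext z
  simp only [conv_apply, ← integral_const_mul]
  rw [integral_integral_swap_of_hasCompactSupport]
  · congr 1; ext w; congr 1; ext s
    rw [sub_right_comm]; ring
  · have := f.continuous
    have := g.continuous
    have := ψ.continuous
    simp only [Function.uncurry_def]
    fun_prop
  · refine HasCompactSupport.intro
      (f.hasCompactSupport.isCompact.prod g.hasCompactSupport.isCompact) fun x hx => ?_
    simp only [Set.mem_prod, not_and_or] at hx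
    rcases hx with hx | hx
    · simp [Function.uncurry_def, image_eq_zero_of_notMem_tsupport hx]
    · simp [Function.uncurry_def, image_eq_zero_of_notMem_tsupport hx]

/-! ### Distributions as functionals of finite order on compact sets -/

/-- A distribution has finite order on every ball. -/
theorem exists_order_bound (ξ : Distr d) (R : ℝ) :
    ∃ N : ℕ, ∃ C : ℝ, 0 ≤ C ∧ ∀ η : Test d, (∀ y, R < ‖y‖ → η y = 0) → ∀ A : ℝ,
      (∀ j ≤ N, ∀ y, ‖iteratedFDeriv ℝ j η y‖ ≤ A) → |ξ η| ≤ C * A := by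
  set K : TopologicalSpace.Compacts (Space d) :=
    ⟨Metric.closedBall 0 R, isCompact_closedBall 0 R⟩
  have hK : (K : Set (Space d)) ⊆ (⊤ : TopologicalSpace.Opens (Space d)) := fun _ _ => trivial
  set L : 𝓓_{K}(Space d, ℝ) →ₗ[ℝ] ℝ :=
    { toFun := fun f => ξ (TestFunction.ofSupportedIn hK f)
      map_add' := fun f g =>
        map_add ξ (TestFunction.ofSupportedIn hK f) (TestFunction.ofSupportedIn hK g)
      map_smul' := fun c f => map_smul ξ c (TestFunction.ofSupportedIn hK f) }
  have hL : Continuous L := ξ.continuous.comp (TestFunction.continuous_ofSupportedIn hK)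
  obtain ⟨s, C, -, hC⟩ := Seminorm.bound_of_continuous
    (ContDiffMapSupportedIn.withSeminorms ℝ (Space d) ℝ ⊤ K)
    ((normSeminorm ℝ ℝ).comp L) (continuous_norm.comp hL)
  refine ⟨s.sup id, C, C.2, fun η hη A hA => ?_⟩
  set ηK : 𝓓_{K}(Space d, ℝ) := .of_support_subset η.contDiff (fun y hy => by
    by_contra h
    exact hy (hη y (by simpa [K] using h)))
  have h1 : |ξ η| ≤ C * (s.sup (ContDiffMapSupportedIn.seminorm ℝ (Space d) ℝ ⊤ K)) ηK := hC ηK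
  refine h1.trans (mul_le_mul_of_nonneg_left ?_ C.2)
  have hA0 : 0 ≤ A := (norm_nonneg _).trans (hA 0 (Nat.zero_le _) 0)
  refine Seminorm.finset_sup_apply_le hA0 fun i hi => ?_
  rw [ContDiffMapSupportedIn.seminorm_top_le_iff ℝ hA0]
  exact fun x _ => hA i (Finset.le_sup (f := id) hi) x

/-- A linear functional on test functions which is bounded, on test functions supported in a
given ball, by finitely many derivatives is a distribution. -/
theorem exists_distr_of_bound (L : Test d → ℝ) (hadd : ∀ f g, L (f + g) = L f + L g)
    (hsmul : ∀ (c : ℝ) f, L (c • f) = c * L f)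
    (hb : ∀ R : ℝ, ∃ N : ℕ, ∃ C : ℝ, 0 ≤ C ∧ ∀ η : Test d, (∀ y, R < ‖y‖ → η y = 0) → ∀ A : ℝ,
      (∀ j ≤ N, ∀ y, ‖iteratedFDeriv ℝ j η y‖ ≤ A) → |L η| ≤ C * A) :
    ∃ ξ : Distr d, ∀ η, ξ η = L η := by
  refine ⟨TestFunction.mkCLM ℝ L hadd hsmul fun K hK => ?_, fun η => rfl⟩
  obtain ⟨R, hR⟩ := K.isCompact.isBounded.exists_norm_le
  obtain ⟨N, C, hC0, hC⟩ := hb R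
  refine (ContDiffMapSupportedIn.mkCLMtoNormedSpace ℝ
    (L ∘ TestFunction.ofSupportedIn hK : 𝓓_{K}(Space d, ℝ) → ℝ)
    (fun f g => hadd (TestFunction.ofSupportedIn hK f) (TestFunction.ofSupportedIn hK g))
    (fun c f => hsmul c (TestFunction.ofSupportedIn hK f))
    ⟨Finset.Iic N, C, hC0, fun f => ?_⟩).continuous
  refine hC _ (fun y hy => ?_) _ fun j hj y => ?_
  · exact f.zero_on_compl fun h => absurd (hR y h) (not_le.2 hy)
  · refine (ContDiffMapSupportedIn.norm_iteratedFDeriv_apply_le_seminorm_top ℝ).trans ?_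
    exact Seminorm.le_finset_sup_apply (Finset.mem_Iic.2 hj)

/-- The pairing of a distribution with the translates of a test function is continuous. -/
theorem continuous_pairing_shift (ξ : Distr d) (ψ : Test d) :
    Continuous fun w => ξ (shift ψ w) := by
  rw [continuous_iff_continuousAt]
  intro w
  obtain ⟨R, hR0, hR⟩ := ψ.exists_support_bound
  obtain ⟨N, C, hC0, hC⟩ := exists_order_bound ξ (R + ‖w‖ + 1)
  rw [ContinuousAt, Metric.tendsto_nhds]
  intro ε hε
  have h1 : ∀ᶠ v in 𝓝 w, ∀ j ∈ Finset.range (N + 1), ∀ y,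
      ‖iteratedFDeriv ℝ j ψ (y - v) - iteratedFDeriv ℝ j ψ (y - w)‖ ≤ ε / (2 * (C + 1)) := by
    rw [Filter.eventually_all_finset]
    intro j _
    obtain ⟨δ, hδ, h⟩ := Metric.uniformContinuous_iff.1 (uniformContinuous_iteratedFDeriv ψ j)
      (ε / (2 * (C + 1))) (by positivity)
    filter_upwards [Metric.ball_mem_nhds w hδ] with v hv y
    rw [← dist_eq_norm]
    refine (h ?_).le
    rw [dist_sub_left]
    exact hv
  filter_upwards [h1, Metric.ball_mem_nhds w one_pos] with v hv hv1
  have hvn : ‖v‖ ≤ ‖w‖ + 1 := by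
    have : ‖v - w‖ < 1 := by simpa [dist_eq_norm] using hv1
    linarith [norm_le_norm_add_norm_sub' v w, norm_sub_rev v w]
  rw [Real.dist_eq, ← map_sub]
  have h2 := hC (shift ψ v - shift ψ w) (fun y hy => ?_) (ε / (2 * (C + 1))) fun j hj y => ?_
  · refine h2.trans_lt ?_
    rw [← mul_div_assoc, div_lt_iff₀ (by positivity)]
    nlinarith
  · have h3 := norm_sub_norm_le y v
    have h4 := norm_sub_norm_le y w
    simp [hR (y - v) (by linarith), hR (y - w) (by linarith)]
  · have : ⇑(shift ψ v - shift ψ w) = ⇑(shift ψ v) - ⇑(shift ψ w) := rfl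
    rw [this, iteratedFDeriv_sub_apply
      ((shift ψ v).contDiff_infty.of_le (by exact_mod_cast le_top)).contDiffAt
      ((shift ψ w).contDiff_infty.of_le (by exact_mod_cast le_top)).contDiffAt,
      iteratedFDeriv_shift, iteratedFDeriv_shift]
    exact hv j (Finset.mem_range.2 (Nat.lt_succ_of_le hj)) y

/-! ### Pairing a distribution with a convolution -/

theorem integral_smul_comp_simpleFunc {G : Type*} [NormedAddCommGroup G] [NormedSpace ℝ G]
    [CompleteSpace G] (f : Test d) (s : SimpleFunc (Space d) (Space d)) (g : Space d → G) :
    ∫ w, f w • g (s w) = ∑ u ∈ s.range, (∫ w in s ⁻¹' {u}, f w) • g u := by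
  have h : ∀ w, f w • g (s w) = ∑ u ∈ s.range, (s ⁻¹' {u}).indicator f w • g u := fun w => by
    rw [Finset.sum_eq_single (s w)]
    · simp
    · intro u _ hu
      rw [Set.indicator_of_notMem, zero_smul]
      simpa using hu.symm
    · intro h
      exact absurd (s.mem_range_self w) h
  simp_rw [h]
  rw [integral_finsetSum]
  · refine Finset.sum_congr rfl fun u _ => ?_
    rw [integral_smul_const, integral_indicator (s.measurableSet_fiber u)]
  · intro u _
    exact (f.integrable.indicator (s.measurableSet_fiber u)).smul_const _

/-- A distribution commutes with the integral that defines a convolution. The translates are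
discretised by simple functions, so that the convolution becomes the limit, with all its
derivatives, of finite combinations of translates. -/
theorem pairing_conv (ξ : Distr d) (f ψ : Test d) :
    ξ (conv f ψ) = ∫ w, f w * ξ (shift ψ w) := by
  obtain ⟨Rf, hRf0, hRf⟩ := f.exists_support_bound
  obtain ⟨Rψ, hRψ0, hRψ⟩ := ψ.exists_support_bound
  obtain ⟨N, C, hC0, hC⟩ := exists_order_bound ξ (2 * Rf + Rψ)
  have hlip : ∀ j : ℕ, ∃ L : ℝ≥0, LipschitzWith L (iteratedFDeriv ℝ j ψ) := fun j =>
    ContDiff.lipschitzWith_of_hasCompactSupport (n := 1) (ψ.hasCompactSupport.iteratedFDeriv j)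
      (ψ.contDiff_infty.iteratedFDeriv_right (m := 1) (by exact_mod_cast le_top)) (by simp)
  choose L hL using hlip
  set M : ℝ := ∑ j ∈ Finset.range (N + 1), (L j : ℝ)
  have hLM : ∀ j ≤ N, (L j : ℝ) ≤ M := fun j hj =>
    Finset.single_le_sum (f := fun j => (L j : ℝ)) (fun j _ => (L j).2)
      (Finset.mem_range.2 (Nat.lt_succ_of_le hj))
  set s : ℕ → SimpleFunc (Space d) (Space d) :=
    SimpleFunc.approxOn id measurable_id Set.univ 0 (Set.mem_univ 0)
  have hs_lim : ∀ w, Tendsto (fun k => s k w) atTop (𝓝 w) := fun w =>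
    SimpleFunc.tendsto_approxOn measurable_id (Set.mem_univ 0) (by simp)
  have hs_norm : ∀ k w, ‖s k w‖ ≤ 2 * ‖w‖ := fun k w => by
    have h := SimpleFunc.edist_approxOn_y0_le measurable_id (Set.mem_univ (0 : Space d)) w k
    rw [edist_dist, edist_dist, ← ENNReal.ofReal_add dist_nonneg dist_nonneg,
      ENNReal.ofReal_le_ofReal_iff (by positivity)] at h
    simp only [dist_zero_left, id] at h
    linarith
  have hs_meas : ∀ k, Measurable (s k) := fun k => (s k).measurable
  set η : ℕ → Test d := fun k => ∑ u ∈ (s k).range, (∫ w in s k ⁻¹' {u}, f w) • shift ψ u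
  have hη : ∀ k z, η k z = ∫ w, f w • ψ (z - s k w) := fun k z => by
    rw [integral_smul_comp_simpleFunc f (s k) fun u => ψ (z - u)]
    simp [η]
  have hηj : ∀ k j z, iteratedFDeriv ℝ j (η k) z =
      ∫ w, f w • iteratedFDeriv ℝ j ψ (z - s k w) := fun k j z => by
    rw [integral_smul_comp_simpleFunc f (s k) fun u => iteratedFDeriv ℝ j ψ (z - u)]
    have h1 : ⇑(η k) = fun z => ∑ u ∈ (s k).range,
        ((∫ w in s k ⁻¹' {u}, f w) • ⇑(shift ψ u)) z := by
      ext z; simp [η]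
    have h2 : ∀ u, ContDiff ℝ j (shift ψ u) := fun u =>
      (shift ψ u).contDiff_infty.of_le (by exact_mod_cast le_top)
    rw [h1, iteratedFDeriv_fun_sum_apply
      (f := fun u => (∫ w in s k ⁻¹' {u}, f w) • (shift ψ u : Space d → ℝ))
      fun u _ => (ContDiff.const_smul (∫ w in s k ⁻¹' {u}, f w) (h2 u)).contDiffAt]
    refine Finset.sum_congr rfl fun u _ => ?_
    rw [iteratedFDeriv_const_smul_apply (h2 u).contDiffAt, iteratedFDeriv_shift]
  -- the discretisation error, in the sense of the weighted mean displacement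
  set e : ℕ → ℝ := fun k => ∫ w, |f w| * ‖s k w - w‖
  have hdisp : ∀ k w, ‖s k w - w‖ ≤ 3 * ‖w‖ := fun k w => by
    linarith [norm_sub_le (s k w) w, hs_norm k w]
  have hfw : Integrable fun w => |f w| * (3 * ‖w‖) := by
    refine (f.continuous.abs.mul (continuous_const.mul continuous_norm)
      ).integrable_of_hasCompactSupport ?_
    exact (f.hasCompactSupport.norm).mul_right
  have he_int : ∀ k, Integrable fun w => |f w| * ‖s k w - w‖ := fun k => by
    refine hfw.mono' ?_ (Eventually.of_forall fun w => ?_)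
    · exact (f.continuous.measurable.abs.mul ((hs_meas k).sub measurable_id).norm
        ).aestronglyMeasurable
    · rw [Real.norm_of_nonneg (by positivity)]
      exact mul_le_mul_of_nonneg_left (hdisp k w) (abs_nonneg _)
  have he : Tendsto e atTop (𝓝 0) := by
    have : Tendsto e atTop (𝓝 (∫ w, |f w| * ‖w - w‖)) := by
      refine tendsto_integral_of_dominated_convergence _
        (fun k => (he_int k).aestronglyMeasurable) hfw (fun k => ?_) ?_
      · refine Eventually.of_forall fun w => ?_
        rw [Real.norm_of_nonneg (by positivity)]
        exact mul_le_mul_of_nonneg_left (hdisp k w) (abs_nonneg _)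
      · exact Eventually.of_forall fun w => (((hs_lim w).sub_const w).norm).const_mul _
    simpa using this
  have hcint : ∀ j z, Integrable fun w => f w • iteratedFDeriv ℝ j ψ (z - w) := fun j z =>
    (f.continuous.smul ((ψ.contDiff_infty.continuous_iteratedFDeriv (m := j)
      (by exact_mod_cast le_top)).comp (continuous_const.sub continuous_id))
      ).integrable_of_hasCompactSupport f.hasCompactSupport.smul_right
  have hdiff : ∀ k, ∀ j ≤ N, ∀ z,
      ‖iteratedFDeriv ℝ j (η k - conv f ψ) z‖ ≤ M * e k := fun k j hj z => by
    have hd : ⇑(η k - conv f ψ) = ⇑(η k) - ⇑(conv f ψ) := rfl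
    rw [hd, iteratedFDeriv_sub_apply
      ((η k).contDiff_infty.of_le (by exact_mod_cast le_top)).contDiffAt
      ((conv f ψ).contDiff_infty.of_le (by exact_mod_cast le_top)).contDiffAt,
      hηj, iteratedFDeriv_conv]
    have hbd : ∀ w, ‖f w • iteratedFDeriv ℝ j ψ (z - s k w) - f w • iteratedFDeriv ℝ j ψ (z - w)‖
        ≤ M * (|f w| * ‖s k w - w‖) := fun w => by
      rw [← smul_sub, norm_smul, Real.norm_eq_abs]
      have h := (hL j).dist_le_mul (z - s k w) (z - w)
      rw [dist_sub_left, dist_eq_norm, dist_eq_norm] at h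
      calc |f w| * _ ≤ |f w| * (L j * ‖s k w - w‖) := by gcongr
        _ ≤ |f w| * (M * ‖s k w - w‖) := by gcongr; exact hLM j hj
        _ = _ := by ring
    have hi2 : Integrable fun w => f w • iteratedFDeriv ℝ j ψ (z - s k w) := by
      have hm : AEStronglyMeasurable (fun w => f w • iteratedFDeriv ℝ j ψ (z - s k w))
          (volume : Measure (Space d)) := by
        refine f.continuous.aestronglyMeasurable.smul ?_
        exact ((s k).map fun u => iteratedFDeriv ℝ j ψ (z - u)).aestronglyMeasurable
      have h3 : Integrable fun w =>
          f w • iteratedFDeriv ℝ j ψ (z - s k w) - f w • iteratedFDeriv ℝ j ψ (z - w) :=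
        ((he_int k).const_mul M).mono' (hm.sub (hcint j z).aestronglyMeasurable)
          (Eventually.of_forall hbd)
      exact (h3.add (hcint j z)).congr (Eventually.of_forall fun w => sub_add_cancel _ _)
    rw [← integral_sub hi2 (hcint j z)]
    refine (norm_integral_le_of_norm_le ((he_int k).const_mul M)
      (Eventually.of_forall hbd)).trans_eq ?_
    rw [integral_const_mul]
  have hsupp : ∀ k y, 2 * Rf + Rψ < ‖y‖ → (η k - conv f ψ) y = 0 := fun k y hy => by
    have h1 : ∀ v w, ‖v‖ ≤ 2 * ‖w‖ → f w • ψ (y - v) = 0 := fun v w hv => by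
      rcases lt_or_ge Rf ‖w‖ with hw | hw
      · simp [hRf w hw]
      · have := norm_sub_norm_le y v
        simp [hRψ (y - v) (by linarith)]
    have h2 : η k y = 0 := by
      rw [hη, integral_congr_ae (Eventually.of_forall fun w => h1 (s k w) w (hs_norm k w))]
      simp
    have h3 : conv f ψ y = 0 := by
      change ∫ w, f w • ψ (y - w) = 0
      rw [integral_congr_ae (Eventually.of_forall fun w =>
        h1 w w (by linarith [norm_nonneg w]))]
      simp
    simp [h2, h3]
  have hlim1 : Tendsto (fun k => ξ (η k)) atTop (𝓝 (ξ (conv f ψ))) := by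
    rw [tendsto_iff_dist_tendsto_zero]
    refine squeeze_zero (fun _ => dist_nonneg) (fun k => ?_)
      (g := fun k => C * (M * e k)) (by simpa using (he.const_mul M).const_mul C)
    rw [Real.dist_eq, ← map_sub]
    exact hC _ (hsupp k) _ (hdiff k)
  have hv := continuous_pairing_shift ξ ψ
  have hξη : ∀ k, ξ (η k) = ∫ w, f w * ξ (shift ψ (s k w)) := fun k => by
    have := integral_smul_comp_simpleFunc f (s k) fun u => ξ (shift ψ u)
    simp only [smul_eq_mul] at this
    rw [this]
    simp [η, map_sum]
  obtain ⟨B, hB⟩ := (isCompact_closedBall (0 : Space d) (2 * Rf)).exists_bound_of_continuousOn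
    hv.continuousOn
  have hlim2 : Tendsto (fun k => ξ (η k)) atTop (𝓝 (∫ w, f w * ξ (shift ψ w))) := by
    simp_rw [hξη]
    refine tendsto_integral_of_dominated_convergence (fun w => |f w| * B) (fun k => ?_)
      (f.integrable.abs.mul_const B) (fun k => ?_) ?_
    · exact (f.continuous.measurable.mul (hv.measurable.comp (hs_meas k))).aestronglyMeasurable
    · refine Eventually.of_forall fun w => ?_
      rw [norm_mul, Real.norm_eq_abs]
      rcases lt_or_ge Rf ‖w‖ with hw | hw
      · simp [hRf w hw]
      · refine mul_le_mul_of_nonneg_left (hB _ ?_) (abs_nonneg _)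
        have := hs_norm k w
        simp only [Metric.mem_closedBall, dist_zero_right]
        linarith
    · exact Eventually.of_forall fun w => ((hv.tendsto w).comp (hs_lim w)).const_mul _
  exact tendsto_nhds_unique hlim1 hlim2

theorem pairing_conv' (ξ : Distr d) (f ψ : Test d) :
    ξ (conv f ψ) = ∫ y, ψ y * ξ (shift f y) := by
  rw [conv_comm, pairing_conv]

/-! ### A finite difference that reproduces the value at the origin -/

/-- Interpolation weights: extrapolation to `0` from the nodes `2⁻ⁱ`, `i < r`, is exact on
polynomials of degree less than `r`. -/
theorem exists_extrapolation_weights (r : ℕ) :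
    ∃ c : ℕ → ℝ, ∀ k < r, ∑ i ∈ Finset.range r, c i * ((2 ^ i : ℝ)⁻¹) ^ k = 0 ^ k := by
  refine ⟨fun i => (Lagrange.basis (Finset.range r) (fun i : ℕ => ((2 : ℝ) ^ i)⁻¹) i).eval 0,
    fun k hk => ?_⟩
  have hinj : Set.InjOn (fun i : ℕ => ((2 : ℝ) ^ i)⁻¹) (Finset.range r) := fun i _ j _ hij =>
    pow_right_injective₀ (by norm_num : (0 : ℝ) < 2) (by norm_num) (inv_injective hij)
  have h := Lagrange.eq_interpolate hinj (f := (Polynomial.X : Polynomial ℝ) ^ k)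
    (by rw [Polynomial.degree_X_pow, Finset.card_range]; exact_mod_cast hk)
  have h2 := congrArg (Polynomial.eval 0) h
  rw [Lagrange.interpolate_apply, Polynomial.eval_finsetSum] at h2
  simp only [Polynomial.eval_mul, Polynomial.eval_C, Polynomial.eval_pow, Polynomial.eval_X] at h2
  rw [h2]
  exact Finset.sum_congr rfl fun i _ => mul_comm _ _

/-- Extrapolation to `0` is exact on the Taylor polynomial, so it errs by the remainder. -/
theorem abs_extrapolation_sub_le {r : ℕ} (hr : 1 ≤ r) {c : ℕ → ℝ}
    (hc : ∀ k < r, ∑ i ∈ Finset.range r, c i * ((2 ^ i : ℝ)⁻¹) ^ k = 0 ^ k)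
    {h : ℝ → ℝ} (hh : ContDiff ℝ ∞ h) {M : ℝ} (hM : ∀ s, ‖iteratedDeriv r h s‖ ≤ M) :
    |∑ i ∈ Finset.range r, c i * h ((2 ^ i)⁻¹) - h 0| ≤ (∑ i ∈ Finset.range r, |c i|) * M := by
  obtain ⟨n, rfl⟩ : ∃ n, r = n + 1 := ⟨r - 1, by omega⟩
  have hM0 : 0 ≤ M := (norm_nonneg _).trans (hM 0)
  set t : ℝ → ℝ := fun x => taylorWithinEval h n (Set.Icc 0 1) 0 x
  have ht : ∑ i ∈ Finset.range (n + 1), c i * t ((2 ^ i)⁻¹) = h 0 := by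
    have : ∀ x, t x = ∑ k ∈ Finset.range (n + 1),
        ((k.factorial : ℝ)⁻¹ * iteratedDerivWithin k h (Set.Icc 0 1) 0) * x ^ k := fun x => by
      simp only [t, taylor_within_apply, sub_zero, smul_eq_mul]
      exact Finset.sum_congr rfl fun k _ => by ring
    simp_rw [this, Finset.mul_sum]
    rw [Finset.sum_comm]
    calc _ = ∑ k ∈ Finset.range (n + 1),
          ((k.factorial : ℝ)⁻¹ * iteratedDerivWithin k h (Set.Icc 0 1) 0) * 0 ^ k := by
          refine Finset.sum_congr rfl fun k hk => ?_
          rw [← hc k (Finset.mem_range.1 hk), Finset.mul_sum]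
          exact Finset.sum_congr rfl fun i _ => by ring
      _ = h 0 := by
          rw [Finset.sum_eq_single 0]
          · simp
          · intro k _ hk
            simp [hk]
          · simp
  have hrem : ∀ i, |h ((2 ^ i)⁻¹) - t ((2 ^ i)⁻¹)| ≤ M := fun i => by
    have hx : ((2 : ℝ) ^ i)⁻¹ ∈ Set.Icc (0 : ℝ) 1 :=
      ⟨by positivity, inv_le_one_of_one_le₀ (one_le_pow₀ (by norm_num))⟩
    have h1 := taylor_mean_remainder_bound (f := h) (a := 0) (b := 1) (C := M) (n := n)
      zero_le_one (hh.of_le (by exact_mod_cast le_top)).contDiffOn hx (fun y hy => by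
        rw [iteratedDerivWithin_eq_iteratedDeriv (uniqueDiffOn_Icc zero_lt_one)
          (hh.of_le (by exact_mod_cast le_top)).contDiffAt hy]
        exact hM y)
    refine h1.trans ?_
    rw [sub_zero]
    have h2 : (((2 : ℝ) ^ i)⁻¹) ^ (n + 1) ≤ 1 := pow_le_one₀ hx.1 hx.2
    have h3 : (1 : ℝ) ≤ n.factorial := by exact_mod_cast n.factorial_pos
    rw [div_le_iff₀ (by positivity)]
    exact mul_le_mul_of_nonneg_left (h2.trans h3) hM0
  calc |∑ i ∈ Finset.range (n + 1), c i * h ((2 ^ i)⁻¹) - h 0|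
      = |∑ i ∈ Finset.range (n + 1), c i * (h ((2 ^ i)⁻¹) - t ((2 ^ i)⁻¹))| := by
        rw [← ht, ← Finset.sum_sub_distrib]
        simp only [mul_sub]
    _ ≤ ∑ i ∈ Finset.range (n + 1), |c i * (h ((2 ^ i)⁻¹) - t ((2 ^ i)⁻¹))| :=
        Finset.abs_sum_le_sum_abs _ _
    _ ≤ ∑ i ∈ Finset.range (n + 1), |c i| * M := by
        refine Finset.sum_le_sum fun i _ => ?_
        rw [abs_mul]
        exact mul_le_mul_of_nonneg_left (hrem i) (abs_nonneg _)
    _ = _ := by rw [Finset.sum_mul]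

theorem norm_iteratedDeriv_line_le (ψ : Test d) (r : ℕ) {A : ℝ}
    (hA : ∀ y, ‖iteratedFDeriv ℝ r ψ y‖ ≤ A) (z v : Space d) (s : ℝ) :
    ‖iteratedDeriv r (fun s : ℝ => ψ (z - s • v)) s‖ ≤ A * ‖v‖ ^ r := by
  have hA0 : 0 ≤ A := (norm_nonneg _).trans (hA 0)
  set L : ℝ →L[ℝ] Space d := ContinuousLinearMap.toSpanSingleton ℝ (-v)
  have h1 : (fun s : ℝ => ψ (z - s • v)) = (shift ψ (-z)) ∘ L := by
    ext s; simp [L, sub_eq_add_neg, add_comm]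
  rw [← norm_iteratedFDeriv_eq_norm_iteratedDeriv, h1,
    L.iteratedFDeriv_comp_right (shift ψ (-z)).contDiff_infty s (i := r)
      (by exact_mod_cast le_top), iteratedFDeriv_shift]
  refine (ContinuousMultilinearMap.norm_compContinuousLinearMap_le _ _).trans ?_
  have hL : ‖L‖ = ‖v‖ := by simp [L]
  simp only [Finset.prod_const, Finset.card_univ, Fintype.card_fin, hL]
  exact mul_le_mul_of_nonneg_right (hA _) (by positivity)

/-! ### Decomposition of a distribution along the scales of one test function -/

theorem shift_dyadic (φ : Test d) (n : ℕ) (x : Space d) :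
    shift (dyadic φ n 0) x = dyadic φ n x := by
  ext y; simp [dyadic_apply]

theorem integral_dyadic_mul (φ : Test d) (m : ℕ) (g : Space d → ℝ) :
    ∫ w, dyadic φ m 0 w * g w = ∫ w, φ w * g (((2 : ℝ) ^ m)⁻¹ • w) := by
  have h := Measure.integral_comp_smul (volume : Measure (Space d))
    (fun w => φ w * g (((2 : ℝ) ^ m)⁻¹ • w)) ((2 : ℝ) ^ m)
  have h2 : ((2 : ℝ) ^ m) ≠ 0 := by positivity
  simp only [smul_smul, inv_mul_cancel₀ h2, one_smul, finrank_euclideanSpace, Fintype.card_fin,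
    smul_eq_mul] at h
  rw [abs_of_pos (by positivity), ← pow_mul, inv_mul_eq_div, eq_div_iff (by positivity)] at h
  rw [← h, mul_comm, ← integral_const_mul]
  congr 1; ext w
  rw [dyadic_apply, sub_zero]; ring

/-- The combination `∑ i < r, c i • φ^{(n + i)}` of rescalings of `φ`; for extrapolation weights
`c` it has integral one and vanishing moments of orders between `1` and `r - 1`. -/
def kern (φ : Test d) (c : ℕ → ℝ) (r n : ℕ) : Test d :=
  ∑ i ∈ Finset.range r, c i • dyadic φ (n + i) 0

theorem kern_apply (φ : Test d) (c : ℕ → ℝ) (r n : ℕ) (y : Space d) :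
    kern φ c r n y = ∑ i ∈ Finset.range r, c i * dyadic φ (n + i) 0 y := by
  simp [kern]

theorem shift_kern (φ : Test d) (c : ℕ → ℝ) (r n : ℕ) (x : Space d) :
    shift (kern φ c r n) x = ∑ i ∈ Finset.range r, c i • dyadic φ (n + i) x := by
  ext y
  simp [kern_apply, ← shift_dyadic φ _ x]

theorem integral_kern_mul (φ : Test d) (c : ℕ → ℝ) (r n : ℕ) {g : Space d → ℝ}
    (hg : Continuous g) :
    ∫ w, kern φ c r n w * g w =
      ∫ w, φ w * ∑ i ∈ Finset.range r, c i * g (((2 : ℝ) ^ (n + i))⁻¹ • w) := by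
  have hi : ∀ (f : Test d) {g : Space d → ℝ}, Continuous g → Integrable fun w => f w * g w :=
    fun f g hg =>
      (f.continuous.mul hg).integrable_of_hasCompactSupport f.hasCompactSupport.mul_right
  calc ∫ w, kern φ c r n w * g w
      = ∫ w, ∑ i ∈ Finset.range r, c i * (dyadic φ (n + i) 0 w * g w) := by
        congr 1; ext w
        rw [kern_apply, Finset.sum_mul]
        exact Finset.sum_congr rfl fun i _ => by ring
    _ = ∑ i ∈ Finset.range r, c i * ∫ w, φ w * g (((2 : ℝ) ^ (n + i))⁻¹ • w) := by
        rw [integral_finsetSum _ fun i _ => (hi _ hg).const_mul _]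
        refine Finset.sum_congr rfl fun i _ => ?_
        rw [integral_const_mul, integral_dyadic_mul]
    _ = ∫ w, ∑ i ∈ Finset.range r, c i * (φ w * g (((2 : ℝ) ^ (n + i))⁻¹ • w)) := by
        rw [integral_finsetSum _ fun i _ => (hi φ (g := fun w => g (((2 : ℝ) ^ (n + i))⁻¹ • w))
          (hg.comp (continuous_const_smul _))).const_mul _]
        simp only [integral_const_mul]
    _ = _ := by
        congr 1; ext w
        rw [Finset.mul_sum]
        exact Finset.sum_congr rfl fun i _ => by ring

theorem conv_kern_apply (φ : Test d) (c : ℕ → ℝ) (r n : ℕ) (ψ : Test d) (z : Space d) :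
    conv (kern φ c r n) ψ z =
      ∫ w, φ w * ∑ i ∈ Finset.range r, c i * ψ (z - ((2 : ℝ) ^ (n + i))⁻¹ • w) :=
  integral_kern_mul φ c r n (g := fun w => ψ (z - w))
    (ψ.continuous.comp (continuous_const.sub continuous_id))

theorem abs_integral_mul_le (φ : Test d) (hφ : ∀ w, 1 ≤ ‖w‖ → φ w = 0) {F : Space d → ℝ}
    {B : ℝ} (hF : ∀ w, ‖w‖ < 1 → |F w| ≤ B) :
    |∫ w, φ w * F w| ≤ (∫ w, |φ w|) * B := by
  rw [← integral_mul_const, ← Real.norm_eq_abs]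
  refine norm_integral_le_of_norm_le (φ.integrable.abs.mul_const _)
    (Eventually.of_forall fun w => ?_)
  rw [norm_mul, Real.norm_eq_abs, Real.norm_eq_abs]
  rcases lt_or_ge ‖w‖ 1 with h | h
  · exact mul_le_mul_of_nonneg_left (hF w h) (abs_nonneg _)
  · simp [hφ w h]

theorem abs_integral_mul_sub_le (φ : Test d) (hφ : ∀ w, 1 ≤ ‖w‖ → φ w = 0)
    (hφ1 : ∫ w, φ w = 1) {F : Space d → ℝ} (hFc : Continuous F) {a B : ℝ}
    (hF : ∀ w, ‖w‖ < 1 → |F w - a| ≤ B) :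
    |(∫ w, φ w * F w) - a| ≤ (∫ w, |φ w|) * B := by
  have h1 : (∫ w, φ w * F w) - a = ∫ w, φ w * (F w - a) := by
    simp only [mul_sub]
    rw [integral_sub _ (φ.integrable.mul_const _), integral_mul_const, hφ1, one_mul]
    exact (φ.continuous.mul hFc).integrable_of_hasCompactSupport φ.hasCompactSupport.mul_right
  rw [h1]
  exact abs_integral_mul_le φ hφ hF

theorem norm_inv_two_pow_smul_lt (n i : ℕ) {w : Space d} (hw : ‖w‖ < 1) :
    ‖((2 : ℝ) ^ (n + i))⁻¹ • w‖ < ((2 : ℝ) ^ n)⁻¹ := by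
  have h1 : (0 : ℝ) < ((2 : ℝ) ^ (n + i))⁻¹ := by positivity
  rw [norm_smul, Real.norm_of_nonneg h1.le]
  have h2 : ((2 : ℝ) ^ (n + i))⁻¹ ≤ ((2 : ℝ) ^ n)⁻¹ :=
    inv_anti₀ (by positivity) (pow_le_pow_right₀ (by norm_num) (Nat.le_add_right _ _))
  nlinarith [norm_nonneg w]

section Kern

variable {φ : Test d} {c : ℕ → ℝ} {r : ℕ}

theorem abs_conv_kern_le (hφ : ∀ w, 1 ≤ ‖w‖ → φ w = 0) (n : ℕ) {ψ : Test d} {A : ℝ}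
    (hA : ∀ y, |ψ y| ≤ A) (z : Space d) :
    |conv (kern φ c r n) ψ z| ≤ (∫ w, |φ w|) * ((∑ i ∈ Finset.range r, |c i|) * A) := by
  rw [conv_kern_apply]
  refine abs_integral_mul_le φ hφ fun w _ => (Finset.abs_sum_le_sum_abs _ _).trans ?_
  rw [Finset.sum_mul]
  refine Finset.sum_le_sum fun i _ => ?_
  rw [abs_mul]
  exact mul_le_mul_of_nonneg_left (hA _) (abs_nonneg _)

theorem conv_kern_eq_zero (hφ : ∀ w, 1 ≤ ‖w‖ → φ w = 0) (n : ℕ) {ψ : Test d} {x : Space d}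
    {ρ : ℝ} (hψ : ∀ y, ρ < dist y x → ψ y = 0) {z : Space d}
    (hz : ρ + ((2 : ℝ) ^ n)⁻¹ < dist z x) : conv (kern φ c r n) ψ z = 0 := by
  rw [conv_kern_apply]
  have h := abs_integral_mul_le φ hφ (B := 0)
    (F := fun w => ∑ i ∈ Finset.range r, c i * ψ (z - ((2 : ℝ) ^ (n + i))⁻¹ • w)) fun w hw => by
      rw [Finset.sum_eq_zero, abs_zero]
      intro i _
      rw [hψ, mul_zero]
      have h1 := norm_inv_two_pow_smul_lt n i hw
      have h2 := dist_triangle z (z - ((2 : ℝ) ^ (n + i))⁻¹ • w) x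
      rw [dist_self_sub_right] at h2
      linarith
  rw [mul_zero] at h
  exact abs_eq_zero.1 (le_antisymm h (abs_nonneg _))

/-- Since the kernel has vanishing moments below order `r`, convolution with it at scale `2⁻ⁿ`
reproduces a smooth function up to `2^{-nr}` times its `r`-th derivative. -/
theorem abs_conv_kern_sub_le (hφ : ∀ w, 1 ≤ ‖w‖ → φ w = 0) (hφ1 : ∫ w, φ w = 1) (hr : 1 ≤ r)
    (hc : ∀ k < r, ∑ i ∈ Finset.range r, c i * ((2 ^ i : ℝ)⁻¹) ^ k = 0 ^ k) (n : ℕ) {ψ : Test d}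
    {A : ℝ} (hA : ∀ y, ‖iteratedFDeriv ℝ r ψ y‖ ≤ A) (z : Space d) :
    |conv (kern φ c r n) ψ z - ψ z| ≤
      (∫ w, |φ w|) * ((∑ i ∈ Finset.range r, |c i|) * (A * (((2 : ℝ) ^ n)⁻¹) ^ r)) := by
  have hA0 : 0 ≤ A := (norm_nonneg _).trans (hA 0)
  rw [conv_kern_apply]
  have hψ := ψ.continuous
  refine abs_integral_mul_sub_le φ hφ hφ1 (by fun_prop) fun w hw => ?_
  have hcd : ContDiff ℝ ∞ fun s : ℝ => ψ (z - s • (((2 : ℝ) ^ n)⁻¹ • w)) :=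
    ψ.contDiff_infty.comp (by fun_prop)
  have h := abs_extrapolation_sub_le hr hc hcd
    (M := A * (((2 : ℝ) ^ n)⁻¹) ^ r) fun s => by
      refine (norm_iteratedDeriv_line_le ψ r hA _ _ _).trans ?_
      gcongr
      simpa using (norm_inv_two_pow_smul_lt n 0 hw).le
  simpa [smul_smul, pow_add, mul_comm, mul_assoc] using h

theorem abs_integral_kern_mul_sub_le (hφ : ∀ w, 1 ≤ ‖w‖ → φ w = 0) (hφ1 : ∫ w, φ w = 1)
    (hr : 1 ≤ r) (hc : ∀ k < r, ∑ i ∈ Finset.range r, c i * ((2 ^ i : ℝ)⁻¹) ^ k = 0 ^ k) (n : ℕ)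
    {g : Space d → ℝ} (hg : Continuous g) {a ε : ℝ}
    (h : ∀ w, ‖w‖ < ((2 : ℝ) ^ n)⁻¹ → |g w - a| ≤ ε) :
    |(∫ w, kern φ c r n w * g w) - a| ≤
      (∫ w, |φ w|) * ((∑ i ∈ Finset.range r, |c i|) * ε) := by
  rw [integral_kern_mul φ c r n hg]
  refine abs_integral_mul_sub_le φ hφ hφ1 (by fun_prop) fun w hw => ?_
  have h1 : ∑ i ∈ Finset.range r, c i = 1 := by simpa using hc 0 hr
  calc |∑ i ∈ Finset.range r, c i * g (((2 : ℝ) ^ (n + i))⁻¹ • w) - a|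
      = |∑ i ∈ Finset.range r, c i * (g (((2 : ℝ) ^ (n + i))⁻¹ • w) - a)| := by
        simp only [mul_sub, Finset.sum_sub_distrib, ← Finset.sum_mul, h1, one_mul]
    _ ≤ ∑ i ∈ Finset.range r, |c i| * ε := by
        refine (Finset.abs_sum_le_sum_abs _ _).trans (Finset.sum_le_sum fun i _ => ?_)
        rw [abs_mul]
        exact mul_le_mul_of_nonneg_left (h _ (norm_inv_two_pow_smul_lt n i hw)) (abs_nonneg _)
    _ = _ := by rw [Finset.sum_mul]

/-- Two successive kernels form an approximate identity for the pairing. A product of two of them,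
rather than one, leaves a second factor to absorb the increments over `n`. -/
theorem tendsto_pairing_conv_kern (hφ : ∀ w, 1 ≤ ‖w‖ → φ w = 0) (hφ1 : ∫ w, φ w = 1)
    (hr : 1 ≤ r) (hc : ∀ k < r, ∑ i ∈ Finset.range r, c i * ((2 ^ i : ℝ)⁻¹) ^ k = 0 ^ k)
    (ξ : Distr d) (ψ : Test d) :
    Tendsto (fun n => ξ (conv (kern φ c r n) (conv (kern φ c r (n + 1)) ψ))) atTop
      (𝓝 (ξ ψ)) := by
  set Q : ℝ := (∫ w, |φ w|) * ∑ i ∈ Finset.range r, |c i|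
  have hQ : 0 ≤ Q := mul_nonneg (integral_nonneg fun _ => abs_nonneg _)
    (Finset.sum_nonneg fun _ _ => abs_nonneg _)
  rw [Metric.tendsto_nhds]
  intro ε hε
  have hv := continuous_pairing_shift ξ ψ
  obtain ⟨δ, hδ, h⟩ := Metric.continuousAt_iff.1 (hv.continuousAt (x := 0))
    (ε / (Q * Q + 1)) (by positivity)
  have hlim : Tendsto (fun n : ℕ => ((2 : ℝ) ^ n)⁻¹) atTop (𝓝 0) :=
    tendsto_inv_atTop_zero.comp (tendsto_pow_atTop_atTop_of_one_lt (by norm_num))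
  filter_upwards [hlim.eventually (gt_mem_nhds (half_pos hδ))] with n hn
  have hn1 : ((2 : ℝ) ^ (n + 1))⁻¹ ≤ ((2 : ℝ) ^ n)⁻¹ :=
    inv_anti₀ (by positivity) (pow_le_pow_right₀ (by norm_num) (Nat.le_succ n))
  have hinner : ∀ w, ‖w‖ < ((2 : ℝ) ^ n)⁻¹ →
      |ξ (shift (conv (kern φ c r (n + 1)) ψ) w) - ξ ψ| ≤ Q * (ε / (Q * Q + 1)) := fun w hw => by
    rw [shift_conv, pairing_conv]
    simp only [shift_shift]
    refine (abs_integral_kern_mul_sub_le hφ hφ1 hr hc (n + 1) (g := fun v => ξ (shift ψ (v + w)))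
      (hv.comp (continuous_add_const w)) (a := ξ ψ) (ε := ε / (Q * Q + 1))
      fun v hv' => ?_).trans_eq (by rw [← mul_assoc])
    have h1 : dist (v + w) 0 < δ := by
      rw [dist_zero_right]
      linarith [norm_add_le v w]
    have h2 := h h1
    rw [shift_zero, Real.dist_eq] at h2
    exact h2.le
  have houter := abs_integral_kern_mul_sub_le hφ hφ1 hr hc n
    (continuous_pairing_shift ξ (conv (kern φ c r (n + 1)) ψ)) hinner
  rw [← pairing_conv, ← mul_assoc] at houter
  rw [Real.dist_eq]
  refine houter.trans_lt ?_
  change Q * _ < ε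
  rw [← mul_assoc, ← mul_div_assoc, div_lt_iff₀ (by positivity)]
  nlinarith

theorem abs_pairing_shift_kern_le (ξ : Distr d) (n : ℕ) (y : Space d) :
    |ξ (shift (kern φ c r n) y)| ≤
      ∑ i ∈ Finset.range r, |c i| * |ξ (dyadic φ (n + i) y)| := by
  rw [shift_kern, map_sum]
  refine (Finset.abs_sum_le_sum_abs _ _).trans_eq (Finset.sum_congr rfl fun i _ => ?_)
  rw [map_smul, smul_eq_mul, abs_mul]

theorem continuous_pairing_dyadic (φ : Test d) (ξ : Distr d) (n : ℕ) :
    Continuous fun y => ξ (dyadic φ n y) := by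
  refine (continuous_pairing_shift ξ (dyadic φ n 0)).congr fun y => ?_
  rw [shift_dyadic]

theorem rpow_neg_mul_add_le (n i : ℕ) {r : ℕ} (hi : i ≤ r) (β : ℝ) :
    (2 : ℝ) ^ (-((n + i : ℕ) : ℝ) * β) ≤ 2 ^ (r * |β|) * 2 ^ (-(n : ℝ) * β) := by
  rw [← Real.rpow_add (by norm_num)]
  refine Real.rpow_le_rpow_of_exponent_le (by norm_num) ?_
  have h1 : (i : ℝ) ≤ r := by exact_mod_cast hi
  push_cast
  nlinarith [neg_abs_le β, abs_nonneg β, (Nat.cast_nonneg i : (0 : ℝ) ≤ i)]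

/-- Local averages of the pairings with the kernels are controlled by those with `φ`. -/
theorem setIntegral_abs_pairing_kern_le (ξ : Distr d) {N n : ℕ} (hn : N ≤ n) {x : Space d}
    {ρ G β : ℝ}
    (hG : ∀ m ≥ N, ∫ y in Metric.closedBall x ρ, |ξ (dyadic φ m y)| ≤
      G * (2 : ℝ) ^ (-(m : ℝ) * β)) (hG0 : 0 ≤ G) :
    ∫ y in Metric.closedBall x ρ, |ξ (shift (kern φ c r n) y)| ≤
      (∑ i ∈ Finset.range r, |c i|) * (2 ^ (r * |β|) * G * (2 : ℝ) ^ (-(n : ℝ) * β)) := by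
  have hint : ∀ m, IntegrableOn (fun y => |ξ (dyadic φ m y)|) (Metric.closedBall x ρ) := fun m =>
    (continuous_pairing_dyadic φ ξ m).abs.continuousOn.integrableOn_compact
      (isCompact_closedBall _ _)
  calc ∫ y in Metric.closedBall x ρ, |ξ (shift (kern φ c r n) y)|
      ≤ ∫ y in Metric.closedBall x ρ, ∑ i ∈ Finset.range r, |c i| * |ξ (dyadic φ (n + i) y)| := by
        refine integral_mono ?_ ?_ fun y => abs_pairing_shift_kern_le ξ n y
        · exact (continuous_pairing_shift ξ _).abs.continuousOn.integrableOn_compact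
            (isCompact_closedBall _ _)
        · exact integrable_finsetSum _ fun i _ => (hint _).const_mul _
    _ = ∑ i ∈ Finset.range r, |c i| * ∫ y in Metric.closedBall x ρ, |ξ (dyadic φ (n + i) y)| := by
        rw [integral_finsetSum _ fun i _ => (hint _).const_mul _]
        simp only [integral_const_mul]
    _ ≤ ∑ i ∈ Finset.range r, |c i| * (2 ^ (r * |β|) * G * (2 : ℝ) ^ (-(n : ℝ) * β)) := by
        refine Finset.sum_le_sum fun i hi => mul_le_mul_of_nonneg_left ?_ (abs_nonneg _)
        refine (hG (n + i) (hn.trans (Nat.le_add_right _ _))).trans ?_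
        rw [mul_comm _ G, mul_assoc]
        exact mul_le_mul_of_nonneg_left
          (rpow_neg_mul_add_le n i (Finset.mem_range.1 hi).le β) hG0
    _ = _ := by rw [Finset.sum_mul]

theorem abs_integral_mul_le_of_support {f g : Space d → ℝ} (hg : Continuous g) {x : Space d}
    {ρ B : ℝ} (hf : ∀ y, |f y| ≤ B) (hf0 : ∀ y, ρ < dist y x → f y = 0) :
    |∫ y, f y * g y| ≤ B * ∫ y in Metric.closedBall x ρ, |g y| := by
  have h1 : ∫ y, f y * g y = ∫ y in Metric.closedBall x ρ, f y * g y := by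
    refine (setIntegral_eq_integral_of_forall_compl_eq_zero fun y hy => ?_).symm
    rw [hf0 y (by simpa using hy), zero_mul]
  rw [h1, ← integral_const_mul, ← Real.norm_eq_abs]
  refine norm_integral_le_of_norm_le
    ((hg.abs.continuousOn.integrableOn_compact (isCompact_closedBall _ _)).const_mul _)
    (Eventually.of_forall fun y => ?_)
  rw [norm_mul, Real.norm_eq_abs, Real.norm_eq_abs]
  exact mul_le_mul_of_nonneg_right (hf y) (abs_nonneg _)

end Kern

/-- **Reconstruction from one test function.** If the local averages of the pairings of `ξ` with
`φ^{(n)}` grow at most like `2^{-nβ}` with `-β < r`, then `ξ` pairs with any function which is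
smooth of order `r` at scale `2^{-N}` at most like `2^{-Nβ}`. The pairing is telescoped over the
scales `n ≥ N`; the `n`-th increment is an average of the pairings with `φ^{(n+1)}, …, φ^{(n+r)}`
against a function of size `2^{-(n-N)r}`. -/
theorem exists_pairing_bound (φ : Test d) (hφ : ∀ w, 1 ≤ ‖w‖ → φ w = 0) (hφ1 : ∫ w, φ w = 1)
    {r : ℕ} (hr : 1 ≤ r) {β : ℝ} (hβ : 0 < r + β) :
    ∃ C : ℝ, 0 ≤ C ∧ ∀ (ξ : Distr d) (ψ : Test d) (N : ℕ) (x : Space d) (ρ A G : ℝ),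
      (∀ y, ρ < dist y x → ψ y = 0) → (∀ y, |ψ y| ≤ A) →
      (∀ y, ‖iteratedFDeriv ℝ r ψ y‖ ≤ A * (2 ^ N) ^ r) →
      (∀ n ≥ N, ∫ y in Metric.closedBall x (ρ + ((2 : ℝ) ^ N)⁻¹), |ξ (dyadic φ n y)| ≤
        G * (2 : ℝ) ^ (-(n : ℝ) * β)) →
      |ξ ψ| ≤ C * A * G * (2 : ℝ) ^ (-(N : ℝ) * β) := by
  obtain ⟨c, hc⟩ := exists_extrapolation_weights r
  set I : ℝ := ∫ w, |φ w|
  have hI : 0 ≤ I := integral_nonneg fun _ => abs_nonneg _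
  set Λ : ℝ := ∑ i ∈ Finset.range r, |c i|
  have hΛ : 0 ≤ Λ := Finset.sum_nonneg fun _ _ => abs_nonneg _
  set κ : ℝ := 2 ^ (r * |β|)
  have hκ : 0 < κ := Real.rpow_pos_of_pos (by norm_num) _
  set q : ℝ := 2 ^ (-(r + β))
  have hq0 : 0 < q := Real.rpow_pos_of_pos (by norm_num) _
  have hq1 : q < 1 := Real.rpow_lt_one_of_one_lt_of_neg (by norm_num) (by linarith)
  set D : ℝ := 2 * I * Λ * Λ * κ * 2 ^ (-β)
  refine ⟨D / (1 - q) + I * Λ * Λ * κ, ?_, ?_⟩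
  · have : 0 < 1 - q := by linarith
    positivity
  intro ξ ψ N x ρ A G hψ hA hAr hG
  have hA0 : 0 ≤ A := (abs_nonneg _).trans (hA 0)
  have hG0 : 0 ≤ G := by
    have h1 := (integral_nonneg (fun y => abs_nonneg _)).trans (hG N le_rfl)
    exact nonneg_of_mul_nonneg_left h1 (Real.rpow_pos_of_pos (by norm_num) _)
  set a : ℕ → Test d := kern φ c r
  set X : ℕ → ℝ := fun n => ξ (conv (a n) (conv (a (n + 1)) ψ))
  have hsupp : ∀ n ≥ N, ∀ z, ρ + ((2 : ℝ) ^ N)⁻¹ < dist z x → conv (a n) ψ z = 0 :=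
    fun n hn z hz => conv_kern_eq_zero hφ n hψ (lt_of_le_of_lt (by gcongr; norm_num) hz)
  have hX0 : |X N| ≤ I * Λ * Λ * κ * A * G * (2 : ℝ) ^ (-(N : ℝ) * β) := by
    simp only [X]
    rw [pairing_conv']
    refine (abs_integral_mul_le_of_support (continuous_pairing_shift ξ (a N))
      (abs_conv_kern_le hφ (N + 1) hA) (hsupp (N + 1) (Nat.le_succ N))).trans ?_
    refine (mul_le_mul_of_nonneg_left (setIntegral_abs_pairing_kern_le ξ le_rfl hG hG0)
      (by positivity)).trans_eq ?_
    ring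
  have hstep : ∀ k, dist (X (N + k)) (X (N + (k + 1))) ≤
      (D * A * G * (2 : ℝ) ^ (-(N : ℝ) * β)) * q ^ k := fun k => by
    set n := N + k
    -- both terms contain the kernel of scale `n + 1`; moving it to the distribution leaves the
    -- difference of the convolutions with the kernels of scales `n` and `n + 2`
    have e1 : X n = ∫ y, conv (a n) ψ y * ξ (shift (a (n + 1)) y) := by
      simp only [X]
      rw [conv_left_comm, pairing_conv']
    have e2 : X (n + 1) = ∫ y, conv (a (n + 2)) ψ y * ξ (shift (a (n + 1)) y) := by
      simp only [X]
      rw [pairing_conv']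
    have hint : ∀ f : Test d, Integrable fun y => f y * ξ (shift (a (n + 1)) y) := fun f =>
      (f.continuous.mul (continuous_pairing_shift ξ _)).integrable_of_hasCompactSupport
        f.hasCompactSupport.mul_right
    have hdiff : ∀ y, |conv (a n) ψ y - conv (a (n + 2)) ψ y| ≤
        2 * I * Λ * A * ((2 : ℝ) ^ k)⁻¹ ^ r := fun y => by
      have h1 := abs_conv_kern_sub_le hφ hφ1 hr hc n hAr y
      have h2 := abs_conv_kern_sub_le hφ hφ1 hr hc (n + 2) hAr y
      have h3 : A * (2 ^ N) ^ r * ((2 : ℝ) ^ (n + 2))⁻¹ ^ r ≤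
          A * (2 ^ N) ^ r * ((2 : ℝ) ^ n)⁻¹ ^ r := by
        gcongr
        · norm_num
        · omega
      have h4 : A * (2 ^ N) ^ r * ((2 : ℝ) ^ n)⁻¹ ^ r = A * ((2 : ℝ) ^ k)⁻¹ ^ r := by
        rw [mul_assoc, ← mul_pow, pow_add, mul_inv, mul_inv_cancel_left₀ (by positivity)]
      rw [h4] at h1 h3
      have h5 := h2.trans (mul_le_mul_of_nonneg_left (mul_le_mul_of_nonneg_left h3 hΛ) hI)
      have h6 := abs_sub_le (conv (a n) ψ y) (ψ y) (conv (a (n + 2)) ψ y)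
      rw [abs_sub_comm (ψ y)] at h6
      calc _ ≤ _ := h6
        _ ≤ _ := add_le_add h1 h5
        _ = _ := by ring
    have hval : ((2 : ℝ) ^ k)⁻¹ ^ r * (2 : ℝ) ^ (-((n + 1 : ℕ) : ℝ) * β) =
        2 ^ (-β) * 2 ^ (-(N : ℝ) * β) * q ^ k := by
      simp only [q]
      rw [← Real.rpow_natCast, ← Real.rpow_natCast, ← Real.rpow_natCast, ← Real.rpow_neg_one,
        ← Real.rpow_mul (by norm_num), ← Real.rpow_mul (by norm_num),
        ← Real.rpow_mul (by norm_num), ← Real.rpow_add (by norm_num),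
        ← Real.rpow_add (by norm_num), ← Real.rpow_add (by norm_num)]
      congr 1
      simp only [n]
      push_cast
      ring
    change dist (X n) (X (n + 1)) ≤ _
    rw [Real.dist_eq, e1, e2, ← integral_sub (hint _) (hint _)]
    simp only [← sub_mul]
    refine (abs_integral_mul_le_of_support (continuous_pairing_shift ξ (a (n + 1))) hdiff
      (x := x) (ρ := ρ + ((2 : ℝ) ^ N)⁻¹) fun y hy => ?_).trans ?_
    · rw [hsupp n (Nat.le_add_right _ _) y hy, hsupp (n + 2) (by omega) y hy, sub_zero]
    · refine (mul_le_mul_of_nonneg_left (setIntegral_abs_pairing_kern_le ξ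
        (by omega : N ≤ n + 1) hG hG0) (by positivity)).trans_eq ?_
      calc _ = 2 * I * Λ * Λ * κ * A * G *
            (((2 : ℝ) ^ k)⁻¹ ^ r * (2 : ℝ) ^ (-((n + 1 : ℕ) : ℝ) * β)) := by ring
        _ = _ := by rw [hval]; ring
  have hlim : Tendsto (fun k => X (N + k)) atTop (𝓝 (ξ ψ)) := by
    have := (tendsto_pairing_conv_kern hφ hφ1 hr hc ξ ψ).comp (tendsto_add_atTop_nat N)
    refine this.congr fun k => ?_
    simp only [X, Function.comp_apply, add_comm k N]
    rfl
  have hfin := dist_le_of_le_geometric_of_tendsto₀ q _ hq1 hstep hlim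
  rw [add_zero, Real.dist_eq, abs_sub_comm] at hfin
  have h7 : |ξ ψ| ≤ |ξ ψ - X N| + |X N| := by
    simpa using abs_add_le (ξ ψ - X N) (X N)
  calc |ξ ψ| ≤ _ := h7
    _ ≤ _ := add_le_add hfin hX0
    _ = _ := by ring

/-! ### Growth of the pairings and Hölder seminorms -/

/-- The pairings of `ξ` with `φ^{(n)}_y`, `‖y‖ ≤ ρ`, are bounded by `R 2^{-nβ}`. -/
def GrowthBound (φ : Test d) (β ρ R : ℝ) (ξ : Distr d) : Prop :=
  ∀ n : ℕ, 1 ≤ n → ∀ y : Space d, ‖y‖ ≤ ρ → |ξ (dyadic φ n y)| ≤ R * (2 : ℝ) ^ (-(n : ℝ) * β)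

theorem norm_iteratedFDeriv_rescale_le (η : Test d) {l : ℝ} (hl : 0 < l) (x : Space d) (j : ℕ)
    {A : ℝ} (hA : ∀ y, ‖iteratedFDeriv ℝ j η y‖ ≤ A) (y : Space d) :
    ‖iteratedFDeriv ℝ j (rescale η l hl x) y‖ ≤ (l ^ d)⁻¹ * (l⁻¹ ^ j * A) := by
  set L : Space d →L[ℝ] Space d := l⁻¹ • ContinuousLinearMap.id ℝ (Space d)
  have h0 : ContDiff ℝ ∞ (η ∘ L) := η.contDiff_infty.comp L.contDiff
  have h1 : ⇑(rescale η l hl x) = fun y => ((l ^ d)⁻¹ • (η ∘ L)) (y - x) := by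
    ext y
    change (l ^ d)⁻¹ * η (l⁻¹ • (y - x)) = _
    simp [L]
  have hL : ‖L‖ ≤ l⁻¹ := by
    rw [norm_smul l⁻¹ (ContinuousLinearMap.id ℝ (Space d)), Real.norm_of_nonneg (by positivity)]
    exact mul_le_of_le_one_right (by positivity) ContinuousLinearMap.norm_id_le
  rw [h1, iteratedFDeriv_comp_sub']
  dsimp only
  rw [iteratedFDeriv_const_smul_apply (h0.of_le (by exact_mod_cast le_top)).contDiffAt, norm_smul,
    Real.norm_of_nonneg (by positivity)]
  refine mul_le_mul_of_nonneg_left ?_ (by positivity)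
  rw [L.iteratedFDeriv_comp_right η.contDiff_infty _ (i := j) (by exact_mod_cast le_top)]
  refine (ContinuousMultilinearMap.norm_compContinuousLinearMap_le _ _).trans ?_
  simp only [Finset.prod_const, Finset.card_univ, Fintype.card_fin]
  rw [mul_comm]
  exact mul_le_mul (pow_le_pow_left₀ (norm_nonneg _) hL _) (hA _) (norm_nonneg _) (by positivity)

theorem rescale_eq_zero {η : Test d} (hη : ∀ w, 1 ≤ ‖w‖ → η w = 0) {l : ℝ} (hl : 0 < l)
    (x : Space d) {y : Space d} (hy : l < dist y x) : rescale η l hl x y = 0 := by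
  change (l ^ d)⁻¹ * η (l⁻¹ • (y - x)) = 0
  rw [hη, mul_zero]
  rw [norm_smul, Real.norm_of_nonneg (by positivity), ← dist_eq_norm, inv_mul_eq_div,
    le_div_iff₀ hl]
  linarith

theorem apply_eq_zero_of_tsupport_subset {η : Test d} (h : tsupport η ⊆ Metric.ball 0 1) :
    ∀ w, 1 ≤ ‖w‖ → η w = 0 := fun w hw =>
  image_eq_zero_of_notMem_tsupport fun hm => by
    have := h hm
    rw [mem_ball_zero_iff] at this
    linarith

theorem volume_real_closedBall (x : Space d) {ρ : ℝ} (hρ : 0 ≤ ρ) :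
    volume.real (Metric.closedBall x ρ) = ρ ^ d * volume.real (Metric.ball (0 : Space d) 1) := by
  rw [measureReal_def, Measure.addHaar_closedBall _ _ hρ, ENNReal.toReal_mul,
    ENNReal.toReal_ofReal (by positivity), finrank_euclideanSpace, Fintype.card_fin,
    measureReal_def]

theorem setIntegral_abs_pairing_le {φ : Test d} {ξ : Distr d} {x : Space d} {ρ B : ℝ}
    (hρ : 0 ≤ ρ) {n : ℕ}
    (h : ∀ y ∈ Metric.closedBall x ρ, |ξ (dyadic φ n y)| ≤ B) :
    ∫ y in Metric.closedBall x ρ, |ξ (dyadic φ n y)| ≤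
      ρ ^ d * volume.real (Metric.ball (0 : Space d) 1) * B := by
  have h1 := norm_setIntegral_le_of_norm_le_const (μ := volume)
    (f := fun y => |ξ (dyadic φ n y)|) (s := Metric.closedBall x ρ) (C := B)
    measure_closedBall_lt_top (fun y hy => by simpa using h y hy)
  rw [volume_real_closedBall x hρ] at h1
  rw [mul_comm]
  exact (le_abs_self _).trans h1

/-- A growth bound on the ball of radius `ρ + 1` controls the pairing with the test functions
supported in the ball of radius `ρ` by their sup norm and their derivatives of order `r`. -/
theorem exists_pairing_le_of_growthBound {φ : Test d} (hφ : ∀ w, 1 ≤ ‖w‖ → φ w = 0)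
    (hφ1 : ∫ w, φ w = 1) {r : ℕ} (hr : 1 ≤ r) {β : ℝ} (hβ : 0 < r + β) {ρ : ℝ} (hρ : 0 ≤ ρ) :
    ∃ C : ℝ, 0 ≤ C ∧ ∀ (ξ : Distr d) (ψ : Test d) (A R : ℝ), GrowthBound φ β (ρ + 1) R ξ →
      (∀ y, ρ < ‖y‖ → ψ y = 0) → (∀ y, |ψ y| ≤ A) → (∀ y, ‖iteratedFDeriv ℝ r ψ y‖ ≤ A) →
      |ξ ψ| ≤ C * A * R := by
  obtain ⟨C, hC0, hC⟩ := exists_pairing_bound φ hφ hφ1 hr hβ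
  refine ⟨C * ((ρ + 1) ^ d * volume.real (Metric.ball (0 : Space d) 1)) *
    (2 : ℝ) ^ (-((1 : ℕ) : ℝ) * β), by positivity, fun ξ ψ A R hξ hψ hA hAr => ?_⟩
  have hA0 : 0 ≤ A := (abs_nonneg _).trans (hA 0)
  have h := hC ξ ψ 1 0 ρ A ((ρ + 1) ^ d * volume.real (Metric.ball (0 : Space d) 1) * R)
    (by simpa using hψ) hA (fun y => (hAr y).trans ?_) fun n hn => ?_
  · refine h.trans_eq ?_
    ring
  · exact le_mul_of_one_le_right hA0 (one_le_pow₀ (by norm_num))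
  · have hsub : Metric.closedBall (0 : Space d) (ρ + ((2 : ℝ) ^ 1)⁻¹) ⊆
        Metric.closedBall 0 (ρ + 1) := Metric.closedBall_subset_closedBall (by norm_num)
    refine (setIntegral_mono_set ?_ (Eventually.of_forall fun y => abs_nonneg _)
      hsub.eventuallyLE).trans ?_
    · exact (continuous_pairing_dyadic φ ξ n).abs.continuousOn.integrableOn_compact
        (isCompact_closedBall _ _)
    · rw [mul_assoc (_ * _)]
      exact setIntegral_abs_pairing_le (by linarith) fun y hy => hξ n hn y (by simpa using hy)

/-- A distribution is determined by its pairings with the functions `φ^{(n)}_x`, `n ≥ 1`. -/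
theorem eq_of_pairing_dyadic_eq {φ : Test d} (hφ : ∀ w, 1 ≤ ‖w‖ → φ w = 0)
    (hφ1 : ∫ w, φ w = 1) {ξ ξ' : Distr d}
    (h : ∀ n, 1 ≤ n → ∀ y, ξ (dyadic φ n y) = ξ' (dyadic φ n y)) : ξ = ξ' := by
  refine DFunLike.ext _ _ fun (ψ : Test d) => ?_
  obtain ⟨ρ, hρ0, hρ⟩ := ψ.exists_support_bound
  obtain ⟨A, hA0, hA⟩ := ψ.exists_bound_of_le 1
  obtain ⟨C, hC0, hC⟩ := exists_pairing_le_of_growthBound hφ hφ1 le_rfl (β := 0) (by simp) hρ0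
  have h1 := hC (ξ - ξ') ψ A 0 (fun n hn y _ => by
    change |ξ (dyadic φ n y) - ξ' (dyadic φ n y)| ≤ _
    rw [h n hn y]; simp) hρ
    (fun y => by simpa using hA 0 (by simp) y) (hA 1 le_rfl)
  rw [mul_zero] at h1
  exact sub_eq_zero.1 (abs_eq_zero.1 (le_antisymm h1 (abs_nonneg _)))

/-- The growth of the pairings with `φ^{(n)}` at a rate better than `α` controls the Hölder
seminorm of order `α`. -/
theorem exists_holderSeminorm_le {φ : Test d} (hφ : ∀ w, 1 ≤ ‖w‖ → φ w = 0)
    (hφ1 : ∫ w, φ w = 1) {α β : ℝ} (hα : α < 0) (hαβ : α < β) (hβ0 : β ≤ 0) :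
    ∃ C : ℝ, 0 ≤ C ∧ ∀ (ξ : Distr d) (ρ R : ℝ) (E : Set (Space d)), (∀ x ∈ E, ‖x‖ ≤ ρ) →
      GrowthBound φ β (ρ + 2) R ξ → holderSeminorm α E ξ ≤ ENNReal.ofReal (C * R) := by
  have hr : 1 ≤ ⌈-α⌉₊ := Nat.one_le_ceil_iff.2 (by linarith)
  have hrβ : 0 < (⌈-α⌉₊ : ℝ) + β := by linarith [Nat.le_ceil (-α)]
  obtain ⟨C, hC0, hC⟩ := exists_pairing_bound φ hφ hφ1 hr hrβ
  set v := volume.real (Metric.ball (0 : Space d) 1)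
  refine ⟨C * (2 ^ d * v) * 2 ^ (-β), by positivity, fun ξ ρ R E hE hξ => ?_⟩
  refine iSup₂_le fun η hη => iSup_le fun l => iSup₂_le fun x hx => ENNReal.ofReal_le_ofReal ?_
  obtain ⟨l, hl0, hl1⟩ := l
  change l ^ (-α) * |ξ (rescale η l hl0 x)| ≤ _
  obtain ⟨m, hm1, hm2⟩ := exists_nat_pow_near_of_lt_one hl0 hl1.le
    (by norm_num : (0 : ℝ) < 2⁻¹) (by norm_num)
  set N := m + 1
  have hN : ((2 : ℝ) ^ N)⁻¹ < l := by rw [← inv_pow]; exact hm1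
  have hN2 : l / 2 ≤ ((2 : ℝ) ^ N)⁻¹ := by
    rw [← inv_pow, pow_succ]; linarith
  have hη1 := apply_eq_zero_of_tsupport_subset hη.1
  have hρ2 : ∀ y ∈ Metric.closedBall x (l + ((2 : ℝ) ^ N)⁻¹), ‖y‖ ≤ ρ + 2 := fun y hy => by
    rw [Metric.mem_closedBall, dist_eq_norm] at hy
    linarith [norm_le_norm_add_norm_sub' y x, hE x hx]
  have hR : 0 ≤ R := by
    have h1 := (abs_nonneg _).trans (hξ 1 le_rfl x (by linarith [hE x hx]))
    exact nonneg_of_mul_nonneg_left h1 (Real.rpow_pos_of_pos (by norm_num) _)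
  have h := hC ξ (rescale η l hl0 x) N x l ((l ^ d)⁻¹) ((2 * l) ^ d * v * R)
    (fun y hy => rescale_eq_zero hη1 hl0 x hy) (fun y => ?_) (fun y => ?_) fun n hn => ?_
  · have e1 : C * (l ^ d)⁻¹ * ((2 * l) ^ d * v * R) * 2 ^ (-(N : ℝ) * β) =
        C * (2 ^ d * v) * R * 2 ^ (-(N : ℝ) * β) := by
      rw [mul_pow]
      field_simp
    rw [e1] at h
    have e2 : (2 : ℝ) ^ (-(N : ℝ) * β) ≤ 2 ^ (-β) * l ^ β := by
      have e3 : (2 : ℝ) ^ (-(N : ℝ) * β) = (((2 : ℝ) ^ N)⁻¹) ^ β := by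
        rw [Real.rpow_mul (by norm_num), Real.rpow_neg (by norm_num), Real.rpow_natCast]
      have e4 : (2 : ℝ) ^ (-β) * l ^ β = (l / 2) ^ β := by
        rw [Real.div_rpow hl0.le (by norm_num), Real.rpow_neg (by norm_num), div_eq_inv_mul]
      rw [e3, e4]
      exact Real.rpow_le_rpow_of_nonpos (by positivity) hN2 hβ0
    have e5 : l ^ (-α) * l ^ β ≤ 1 := by
      rw [← Real.rpow_add hl0]
      exact Real.rpow_le_one hl0.le hl1.le (by linarith)
    calc l ^ (-α) * |ξ (rescale η l hl0 x)|
        ≤ l ^ (-α) * (C * (2 ^ d * v) * R * (2 ^ (-β) * l ^ β)) := by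
          refine mul_le_mul_of_nonneg_left (h.trans ?_) (by positivity)
          exact mul_le_mul_of_nonneg_left e2 (by positivity)
      _ = C * (2 ^ d * v) * 2 ^ (-β) * R * (l ^ (-α) * l ^ β) := by ring
      _ ≤ C * (2 ^ d * v) * 2 ^ (-β) * R * 1 := by gcongr
      _ = _ := by ring
  · have := norm_iteratedFDeriv_rescale_le η hl0 x 0 (hη.2 0 (Nat.zero_le _)) y
    simpa using this
  · refine (norm_iteratedFDeriv_rescale_le η hl0 x _ (hη.2 _ le_rfl) y).trans ?_
    rw [mul_one]
    gcongr
    exact inv_le_of_inv_le₀ (by positivity) hN.le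
  · have hsub : Metric.closedBall x (l + ((2 : ℝ) ^ N)⁻¹) ⊆ Metric.closedBall x (2 * l) :=
      Metric.closedBall_subset_closedBall (by linarith)
    refine (setIntegral_abs_pairing_le (B := R * (2 : ℝ) ^ (-(n : ℝ) * β)) (by positivity)
      fun y hy => hξ n (le_trans (by omega) hn) y (hρ2 y hy)).trans ?_
    rw [← mul_assoc]
    gcongr
    linarith

/-- An embedding of Besov type: bounds in `L^p` of the space variable improve to a pointwise bound
at the cost of `d / p` in the exponent. -/
theorem exists_pairing_dyadic_le {φ : Test d} (hφ : ∀ w, 1 ≤ ‖w‖ → φ w = 0)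
    (hφ1 : ∫ w, φ w = 1) {r : ℕ} (hr : 1 ≤ r) {a p : ℝ} (hra : 0 < r + a) (hp : 1 ≤ p) :
    ∃ C : ℝ, 0 ≤ C ∧ ∀ (ξ : Distr d) (N : ℕ) (x : Space d) (e : ℝ≥0),
      (∀ n ≥ N, ∫⁻ y in Metric.closedBall x (2 * ((2 : ℝ) ^ N)⁻¹), ‖ξ (dyadic φ n y)‖ₑ ^ p ≤
        ENNReal.ofReal (e ^ p * (2 : ℝ) ^ (-(n : ℝ) * a * p))) →
      |ξ (dyadic φ N x)| ≤ C * e * (2 : ℝ) ^ (-(N : ℝ) * (a - d / p)) := by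
  obtain ⟨C, hC0, hC⟩ := exists_pairing_bound φ hφ hφ1 hr hra
  obtain ⟨B, hB0, hB⟩ := φ.exists_bound_of_le r
  set v := volume.real (Metric.ball (0 : Space d) 1)
  have hp0 : 0 < p := by linarith
  refine ⟨C * B * (2 ^ d * v) ^ (1 - 1 / p), by positivity, fun ξ N x e h => ?_⟩
  set δ : ℝ := ((2 : ℝ) ^ N)⁻¹
  have hδ : 0 < δ := by positivity
  set V : ℝ := (2 * δ) ^ d * v
  have hbound : ∀ j ≤ r, ∀ y, ‖iteratedFDeriv ℝ j (dyadic φ N x) y‖ ≤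
      (2 ^ N) ^ d * B * (2 ^ N) ^ j := fun j hj y => by
    refine (norm_iteratedFDeriv_rescale_le φ hδ x j (hB j hj) y).trans_eq ?_
    simp only [δ, inv_inv, inv_pow]
    ring
  have key := hC ξ (dyadic φ N x) N x δ ((2 ^ N) ^ d * B) (V ^ (1 - 1 / p) * e)
    (fun y hy => rescale_eq_zero hφ hδ x hy) (fun y => by simpa using hbound 0 (by simp) y)
    (fun y => hbound r le_rfl y) fun n hn => ?_
  · refine key.trans_eq ?_
    have hv : 0 ≤ v := measureReal_nonneg
    have e1 : V ^ (1 - 1 / p) = (2 ^ d * v) ^ (1 - 1 / p) * (2 : ℝ) ^ (-(N : ℝ) * (d - d / p)) := by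
      have : V = (2 ^ d * v) * (2 : ℝ) ^ (-(N : ℝ) * d) := by
        simp only [V, δ]
        rw [mul_pow, inv_pow, ← pow_mul, neg_mul, Real.rpow_neg (by norm_num)]
        rw [← Nat.cast_mul, Real.rpow_natCast]
        ring
      rw [this, Real.mul_rpow (by positivity) (by positivity), ← Real.rpow_mul (by norm_num)]
      congr 2
      ring
    have e2 : ((2 : ℝ) ^ N) ^ d = (2 : ℝ) ^ ((N : ℝ) * d) := by
      rw [← pow_mul, ← Nat.cast_mul, Real.rpow_natCast]
    have e3 : (2 : ℝ) ^ (-(N : ℝ) * (a - d / p)) =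
        (2 : ℝ) ^ ((N : ℝ) * d) * (2 : ℝ) ^ (-(N : ℝ) * (d - d / p)) *
          (2 : ℝ) ^ (-(N : ℝ) * a) := by
      rw [← Real.rpow_add (by norm_num), ← Real.rpow_add (by norm_num)]
      congr 1; ring
    rw [e1, e2, e3]
    ring
  · have hcont := continuous_pairing_dyadic φ ξ n
    set U := Metric.closedBall x (δ + δ)
    have hU : U = Metric.closedBall x (2 * δ) := by simp only [U]; rw [two_mul]
    have h1 := eLpNorm_le_eLpNorm_mul_rpow_measure_univ (μ := volume.restrict U)
      (f := fun y => ξ (dyadic φ n y)) (p := 1) (q := ENNReal.ofReal p)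
      (by simpa using hp) hcont.aestronglyMeasurable
    rw [eLpNorm_one_eq_lintegral_enorm, eLpNorm_eq_lintegral_rpow_enorm_toReal (by simpa using hp0)
      ENNReal.ofReal_ne_top, ENNReal.toReal_ofReal hp0.le, Measure.restrict_apply_univ,
      ENNReal.toReal_one, hU] at h1
    have h2 : ∫⁻ y in Metric.closedBall x (2 * δ), ‖ξ (dyadic φ n y)‖ₑ ≤
        ENNReal.ofReal (V ^ (1 - 1 / p) * e * (2 : ℝ) ^ (-(n : ℝ) * a)) := by
      refine h1.trans ?_
      have hvol : volume (Metric.closedBall x (2 * δ)) = ENNReal.ofReal V := by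
        rw [show V = _ from (volume_real_closedBall x (by positivity : 0 ≤ 2 * δ)).symm,
          ofReal_measureReal measure_closedBall_lt_top.ne]
      have hV : 0 ≤ V := by positivity
      rw [hvol, ENNReal.ofReal_rpow_of_nonneg hV (by
        have : 1 / p ≤ 1 := (div_le_one hp0).2 hp
        simpa using this)]
      refine (mul_le_mul_left (ENNReal.rpow_le_rpow (h n hn) (by positivity)) _).trans_eq ?_
      rw [ENNReal.ofReal_rpow_of_nonneg (by positivity) (by positivity),
        ← ENNReal.ofReal_mul (by positivity)]
      congr 1
      rw [Real.mul_rpow (by positivity) (by positivity), ← Real.rpow_mul (by positivity),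
        ← Real.rpow_mul (by norm_num), mul_one_div_cancel hp0.ne', Real.rpow_one,
        mul_assoc (-(n : ℝ) * a), mul_one_div_cancel hp0.ne', mul_one, div_one]
      ring
    have h3 : ∫ y in U, |ξ (dyadic φ n y)| =
        (∫⁻ y in Metric.closedBall x (2 * δ), ‖ξ (dyadic φ n y)‖ₑ).toReal := by
      rw [hU, ← integral_norm_eq_lintegral_enorm hcont.aestronglyMeasurable]
      rfl
    change ∫ y in U, |ξ (dyadic φ n y)| ≤ _
    rw [h3]
    refine ENNReal.toReal_le_of_le_ofReal (by positivity) h2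

end

/-! ### Limits of distributions with controlled growth -/

theorem exists_one_le_nat_add_pos (β : ℝ) : ∃ r : ℕ, 1 ≤ r ∧ 0 < (r : ℝ) + β := by
  obtain ⟨r, hr⟩ := exists_nat_gt (max 1 (-β))
  refine ⟨r, ?_, by linarith [(le_max_right 1 (-β)).trans_lt hr]⟩
  exact_mod_cast ((le_max_left _ _).trans_lt hr).le

theorem GrowthBound.mono {φ : Test d} {β β' ρ ρ' R R' : ℝ} {ξ : Distr d}
    (h : GrowthBound φ β ρ R ξ) (hβ : β' ≤ β) (hρ : ρ' ≤ ρ) (hR : R ≤ R') (hR' : 0 ≤ R') :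
    GrowthBound φ β' ρ' R' ξ := fun n hn y hy => by
  refine (h n hn y (hy.trans hρ)).trans ?_
  refine mul_le_mul hR (Real.rpow_le_rpow_of_exponent_le (by norm_num) ?_) (by positivity) hR'
  nlinarith [(Nat.cast_nonneg n : (0 : ℝ) ≤ n)]

theorem GrowthBound.sub {φ : Test d} {β ρ R R' : ℝ} {ξ ξ' : Distr d}
    (h : GrowthBound φ β ρ R ξ) (h' : GrowthBound φ β ρ R' ξ') :
    GrowthBound φ β ρ (R + R') (ξ - ξ') := fun n hn y hy => by
  rw [add_mul]
  exact (abs_sub _ _).trans (add_le_add (h n hn y hy) (h' n hn y hy))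

theorem growthBound_zero (φ : Test d) (β ρ : ℝ) {R : ℝ} (hR : 0 ≤ R) :
    GrowthBound φ β ρ R (0 : Distr d) := fun n hn y hy => by
  change |(0 : ℝ)| ≤ _
  rw [abs_zero]
  positivity

/-- A pointwise limit of distributions whose pairings with the `φ^{(n)}` are uniformly controlled
on every ball is a distribution. -/
theorem exists_distr_of_tendsto {φ : Test d} (hφ : ∀ w, 1 ≤ ‖w‖ → φ w = 0)
    (hφ1 : ∫ w, φ w = 1) {ι : Type*} {F : Filter ι} [F.NeBot] {ζ : ι → Distr d} {β : ℝ}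
    (hζ : ∀ M : ℕ, ∃ R : ℝ, ∀ᶠ i in F, GrowthBound φ β M R (ζ i)) {L : Test d → ℝ}
    (hL : ∀ η, Tendsto (fun i => ζ i η) F (𝓝 (L η))) : ∃ ξ : Distr d, ∀ η, ξ η = L η := by
  obtain ⟨r, hr1, hrβ⟩ := exists_one_le_nat_add_pos β
  refine exists_distr_of_bound L (fun f g => ?_) (fun c f => ?_) fun ρ => ?_
  · refine tendsto_nhds_unique (hL (f + g)) (((hL f).add (hL g)).congr fun i => ?_)
    rw [map_add]
  · refine tendsto_nhds_unique (hL (c • f)) (((hL f).const_mul c).congr fun i => ?_)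
    rw [map_smul, smul_eq_mul]
  · obtain ⟨M, hM⟩ := exists_nat_gt (max ρ 0 + 1)
    obtain ⟨R, hR⟩ := hζ M
    obtain ⟨C, hC0, hC⟩ := exists_pairing_le_of_growthBound hφ hφ1 hr1 hrβ (le_max_right ρ 0)
    refine ⟨r, C * |R|, by positivity, fun η hη A hA => ?_⟩
    refine le_of_tendsto (hL η).abs ?_
    filter_upwards [hR] with i hi
    refine (hC (ζ i) η A |R| (hi.mono le_rfl hM.le (le_abs_self R) (abs_nonneg R))
      (fun y hy => hη y ((le_max_left _ _).trans_lt hy))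
      (fun y => by simpa using hA 0 (Nat.zero_le _) y) (hA r le_rfl)).trans_eq ?_
    ring

theorem GrowthBound.of_tendsto {φ : Test d} {ι : Type*} {F : Filter ι} [F.NeBot]
    {ζ : ι → Distr d} {ξ : Distr d} {β ρ R : ℝ} (hζ : ∀ᶠ i in F, GrowthBound φ β ρ R (ζ i))
    (hξ : ∀ η : Test d, Tendsto (fun i => ζ i η) F (𝓝 (ξ η))) : GrowthBound φ β ρ R ξ :=
  fun n hn y hy => le_of_tendsto (hξ _).abs (hζ.mono fun _ hi => hi n hn y hy)

/-- Growth bounds make the pairings with `φ^{(n)}_y` equicontinuous in `y`. -/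
theorem eventually_abs_pairing_dyadic_sub_le {φ : Test d} (hφ : ∀ w, 1 ≤ ‖w‖ → φ w = 0)
    (hφ1 : ∫ w, φ w = 1) (β R : ℝ) (n : ℕ) (y₀ : Space d) {ε : ℝ} (hε : 0 < ε) :
    ∀ᶠ y in 𝓝 y₀, ∀ ξ : Distr d, GrowthBound φ β (‖y₀‖ + 3) R ξ →
      |ξ (dyadic φ n y) - ξ (dyadic φ n y₀)| ≤ ε := by
  obtain ⟨r, hr1, hrβ⟩ := exists_one_le_nat_add_pos β
  obtain ⟨C, hC0, hC⟩ := exists_pairing_le_of_growthBound hφ hφ1 hr1 hrβ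
    (ρ := ‖y₀‖ + 2) (by positivity)
  set ε' : ℝ := ε / (C * |R| + 1)
  have hε' : 0 < ε' := by positivity
  have hu : ∀ j : ℕ, ∀ᶠ y in 𝓝 y₀, ∀ z, ‖iteratedFDeriv ℝ j (dyadic φ n 0) (z - y) -
      iteratedFDeriv ℝ j (dyadic φ n 0) (z - y₀)‖ ≤ ε' := fun j => by
    obtain ⟨δ, hδ, h⟩ := Metric.uniformContinuous_iff.1
      (uniformContinuous_iteratedFDeriv (dyadic φ n 0) j) ε' hε'
    filter_upwards [Metric.ball_mem_nhds y₀ hδ] with y hy z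
    rw [← dist_eq_norm]
    refine (h ?_).le
    rw [dist_sub_left]
    exact hy
  have hsub : ∀ (j : ℕ) y z, iteratedFDeriv ℝ j (dyadic φ n y - dyadic φ n y₀) z =
      iteratedFDeriv ℝ j (dyadic φ n 0) (z - y) - iteratedFDeriv ℝ j (dyadic φ n 0) (z - y₀) :=
    fun j y z => by
      have hd : ⇑(dyadic φ n y - dyadic φ n y₀) = ⇑(dyadic φ n y) - ⇑(dyadic φ n y₀) := rfl
      rw [hd, iteratedFDeriv_sub_apply
        ((dyadic φ n y).contDiff_infty.of_le (by exact_mod_cast le_top)).contDiffAt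
        ((dyadic φ n y₀).contDiff_infty.of_le (by exact_mod_cast le_top)).contDiffAt,
        ← shift_dyadic φ n y, ← shift_dyadic φ n y₀, iteratedFDeriv_shift, iteratedFDeriv_shift]
  have hn1 : ((2 : ℝ) ^ n)⁻¹ ≤ 1 := inv_le_one_of_one_le₀ (one_le_pow₀ (by norm_num))
  filter_upwards [hu 0, hu r, Metric.ball_mem_nhds y₀ one_pos] with y h0 h1 hy ξ hξ
  have hyn : ‖y‖ ≤ ‖y₀‖ + 1 := by
    rw [mem_ball_iff_norm] at hy
    linarith [norm_le_norm_add_norm_sub' y y₀]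
  rw [← map_sub]
  have hzero : ∀ x z : Space d, ‖x‖ ≤ ‖y₀‖ + 1 → ‖y₀‖ + 2 < ‖z‖ → dyadic φ n x z = 0 :=
    fun x z hx hz => rescale_eq_zero hφ _ x (by
      rw [dist_eq_norm]
      linarith [norm_le_norm_add_norm_sub' z x])
  have h2 := hC ξ (dyadic φ n y - dyadic φ n y₀) ε' |R|
    (hξ.mono le_rfl (by linarith) (le_abs_self R) (abs_nonneg R)) (fun z hz => ?_) (fun z => ?_)
    (fun z => by rw [hsub]; exact h1 z)
  · refine h2.trans ?_
    simp only [ε']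
    rw [mul_right_comm, ← mul_div_assoc, div_le_iff₀ (by positivity)]
    nlinarith
  · rw [sub_apply, hzero y z hyn hz, hzero y₀ z (by linarith) hz, sub_zero]
  · have h3 := hsub 0 y z
    have h4 := h0 z
    rw [← h3] at h4
    simpa using h4

/-! ### Paths of distributions with controlled growth -/

theorem tsum_two_inv_pow_succ : ∑' m : ℕ, (2⁻¹ : ℝ≥0∞) ^ (m + 1) = 1 := by
  simp_rw [pow_succ]
  rw [ENNReal.tsum_mul_right, ENNReal.tsum_geometric_two]
  exact ENNReal.mul_inv_cancel (by norm_num) (by norm_num)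

/-- Growth bounds control the distance to the origin in the Fréchet space of order `α`. The first
`m₀` terms of the series are small, the others are dominated by those of a convergent series. Both
parts keep the factor `u`, a power of `|t - s|` for the increments of paths; the truncation of the
seminorms at `1` serves when `u ≥ 1` and a higher power `u'` of `|t - s|` exceeds `u`. -/
theorem exists_holderGauge_le {φ : Test d} (hφ : ∀ w, 1 ≤ ‖w‖ → φ w = 0)
    (hφ1 : ∫ w, φ w = 1) {α β : ℝ} (hα : α < 0) (hαβ : α < β) (hβ0 : β ≤ 0) :
    ∃ C : ℝ, 0 ≤ C ∧ ∀ (ξ : Distr d) (S : ℕ → ℝ) (m₀ : ℕ) (δ u u' : ℝ), (∀ m, 0 ≤ S m) →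
      0 ≤ δ → 0 ≤ u → (u' ≤ u ∨ 1 ≤ u) →
      (∀ m < m₀, GrowthBound φ β (m + 3 : ℕ) (δ * u) ξ) →
      (∀ m, GrowthBound φ β (m + 3 : ℕ) (S m * u') ξ) →
      holderGauge α ξ ≤ (ENNReal.ofReal (C * δ) +
        ∑' m, (2⁻¹ : ℝ≥0∞) ^ (m + m₀ + 1) * ENNReal.ofReal (max 1 (C * S (m + m₀)))) *
          ENNReal.ofReal u := by
  obtain ⟨C, hC0, hC⟩ := exists_holderSeminorm_le hφ hφ1 hα hαβ hβ0
  refine ⟨C, hC0, fun ξ S m₀ δ u u' hS hδ hu huu' hlow hall => ?_⟩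
  have hsemi : ∀ (m : ℕ) (R : ℝ), GrowthBound φ β (m + 3 : ℕ) R ξ →
      holderSeminorm α (Metric.ball 0 ((m : ℝ) + 1)) ξ ≤ ENNReal.ofReal (C * R) := fun m R hR =>
    hC ξ (m + 1) R _ (fun x hx => (mem_ball_zero_iff.1 hx).le) (by
      convert hR using 1; push_cast; ring)
  unfold holderGauge
  rw [← Summable.sum_add_tsum_nat_add' (k := m₀) ENNReal.summable, add_mul]
  refine add_le_add ?_ ?_
  · calc _ ≤ ∑ m ∈ Finset.range m₀, (2⁻¹ : ℝ≥0∞) ^ (m + 1) *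
          (ENNReal.ofReal (C * δ) * ENNReal.ofReal u) := by
          refine Finset.sum_le_sum fun m hm => mul_le_mul_right ?_ _
          refine (min_le_right _ _).trans ((hsemi m _ (hlow m (Finset.mem_range.1 hm))).trans_eq ?_)
          rw [← ENNReal.ofReal_mul (by positivity), mul_assoc]
      _ ≤ 1 * (ENNReal.ofReal (C * δ) * ENNReal.ofReal u) := by
          rw [← Finset.sum_mul]
          refine mul_le_mul_left ?_ _
          rw [← tsum_two_inv_pow_succ]
          exact ENNReal.sum_le_tsum _
      _ = _ := one_mul _
  · rw [← ENNReal.tsum_mul_right]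
    refine ENNReal.tsum_le_tsum fun m => ?_
    rw [mul_assoc]
    refine mul_le_mul_right ?_ _
    rw [← ENNReal.ofReal_mul (by positivity)]
    rcases huu' with h | h
    · refine (min_le_right _ _).trans ((hsemi (m + m₀) _ (hall (m + m₀))).trans ?_)
      refine ENNReal.ofReal_le_ofReal ?_
      rw [← mul_assoc]
      have h1 : 0 ≤ C * S (m + m₀) := mul_nonneg hC0 (hS _)
      exact (mul_le_mul_of_nonneg_left h h1).trans
        (mul_le_mul_of_nonneg_right (le_max_right _ _) hu)
    · refine (min_le_left _ _).trans ?_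
      rw [← ENNReal.ofReal_one]
      refine ENNReal.ofReal_le_ofReal ?_
      nlinarith [le_max_left 1 (C * S (m + m₀))]

theorem tsum_weight_ne_top (C K : ℝ) (hC : 0 ≤ C) (hK : 0 ≤ K) (k : ℕ) :
    ∑' m : ℕ, (2⁻¹ : ℝ≥0∞) ^ (m + 1) *
      ENNReal.ofReal (max 1 (C * (K * ((m + 3 : ℕ) + 1 : ℝ) ^ k))) ≠ ⊤ := by
  have h1 : Summable fun m : ℕ => (2⁻¹ : ℝ) ^ (m + 1) *
      (1 + C * K * ((m + 4 : ℕ) : ℝ) ^ k) := by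
    have h2 : Summable fun m : ℕ => ((m + 4 : ℕ) : ℝ) ^ k * (2⁻¹ : ℝ) ^ (m + 4) :=
      (summable_nat_add_iff (f := fun m : ℕ => (m : ℝ) ^ k * (2⁻¹ : ℝ) ^ m) 4).2
        (summable_pow_mul_geometric_of_norm_lt_one k (by norm_num))
    have h3 : Summable fun m : ℕ => (2⁻¹ : ℝ) ^ (m + 1) :=
      (summable_nat_add_iff (f := fun m : ℕ => (2⁻¹ : ℝ) ^ m) 1).2
        (summable_geometric_of_lt_one (by norm_num) (by norm_num))
    refine (h3.add (h2.mul_left (8 * (C * K)))).congr fun m => ?_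
    rw [pow_add _ m 4, pow_add _ m 1]
    ring
  refine ne_top_of_le_ne_top h1.tsum_ofReal_ne_top (ENNReal.tsum_le_tsum fun m => ?_)
  rw [ENNReal.ofReal_mul (by positivity), ENNReal.ofReal_pow (by norm_num),
    ENNReal.ofReal_inv_of_pos (by norm_num), ENNReal.ofReal_ofNat]
  gcongr
  have h4 : ((m + 3 : ℕ) + 1 : ℝ) = ((m + 4 : ℕ) : ℝ) := by push_cast; ring
  rw [h4, mul_assoc]
  exact max_le (le_add_of_nonneg_right (by positivity)) (le_add_of_nonneg_left zero_le_one)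

/-- The pairings of the path `ζ` with `φ^{(n)}_y` are bounded by `2^{-nβ}` and their increments in
time by `2^{-nβ} |t - s|^{γ}`, with a constant which grows polynomially in `y`. The polynomial
growth in space ensures that the weights `2^{-m}` in the distance are summable against it. -/
def PathBound (φ : Test d) (β γ K : ℝ) (k : ℕ) {T : ℝ≥0} (ζ : Set.Icc (0 : ℝ≥0) T → Distr d) :
    Prop :=
  ∀ M : ℕ, (∀ t, GrowthBound φ β M (K * ((M : ℝ) + 1) ^ k) (ζ t)) ∧
    ∀ s t, GrowthBound φ β M (K * ((M : ℝ) + 1) ^ k * dist s t ^ γ) (ζ t - ζ s)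

theorem rpow_le_rpow_or_one_le {x γ γ' : ℝ} (hx : 0 ≤ x) (hγ : 0 ≤ γ) (hγγ' : γ ≤ γ') :
    x ^ γ' ≤ x ^ γ ∨ 1 ≤ x ^ γ := by
  rcases le_total x 1 with h | h
  · exact Or.inl (Real.rpow_le_rpow_of_exponent_ge' hx h hγ hγγ')
  · exact Or.inr (Real.one_le_rpow h hγ)

theorem edist_rpow_eq {T : ℝ≥0} (s t : Set.Icc (0 : ℝ≥0) T) {γ : ℝ} (hγ : 0 ≤ γ) :
    edist s t ^ γ = ENNReal.ofReal (dist s t ^ γ) := by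
  have h : edist s t = ENNReal.ofReal (dist s t) := edist_dist (s : ℝ≥0) t
  rw [h, ENNReal.ofReal_rpow_of_nonneg dist_nonneg hγ]

/-- A path with polynomially growing bounds is a Hölder path. -/
theorem exists_holderPath {φ : Test d} (hφ : ∀ w, 1 ≤ ‖w‖ → φ w = 0)
    (hφ1 : ∫ w, φ w = 1) {α β : ℝ} (hα : α < 0) (hαβ : α < β) (hβ0 : β ≤ 0) {γ T : ℝ≥0}
    {γ' K : ℝ} (hγ : (γ : ℝ) ≤ γ') (hK : 0 ≤ K) {k : ℕ} {ζ : Set.Icc (0 : ℝ≥0) T → Distr d}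
    (hζ : PathBound φ β γ' K k ζ) :
    ∃ f : HolderPath d α γ T, ∀ t, (f.toFun t).toDistr = ζ t := by
  obtain ⟨C, hC0, hC⟩ := exists_holderSeminorm_le hφ hφ1 hα hαβ hβ0
  have hfin : ∀ t, ∀ E : Set (Space d), IsCompact E → holderSeminorm α E (ζ t) < ⊤ :=
    fun t E hE => by
      obtain ⟨ρ, hρ⟩ := hE.isBounded.exists_norm_le
      obtain ⟨M, hM⟩ := exists_nat_gt (ρ + 2)
      exact (hC (ζ t) ρ _ E hρ (((hζ M).1 t).mono le_rfl hM.le le_rfl (by positivity))).trans_lt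
        ENNReal.ofReal_lt_top
  obtain ⟨D, hD0, hD⟩ := exists_holderGauge_le hφ hφ1 hα hαβ hβ0
  set W := ∑' m : ℕ, (2⁻¹ : ℝ≥0∞) ^ (m + 1) *
      ENNReal.ofReal (max 1 (D * (K * ((m + 3 : ℕ) + 1 : ℝ) ^ k)))
  have hW : W ≠ ⊤ := tsum_weight_ne_top D K hD0 hK k
  refine ⟨⟨fun t => ⟨ζ t, hfin t⟩, W.toNNReal, fun s t => ?_⟩, fun t => rfl⟩
  change holderGauge α (ζ s - ζ t) ≤ W.toNNReal * edist s t ^ (γ : ℝ)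
  rw [ENNReal.coe_toNNReal hW, edist_rpow_eq s t γ.coe_nonneg, dist_comm]
  have := hD (ζ s - ζ t) (fun m => K * ((m + 3 : ℕ) + 1 : ℝ) ^ k) 0 0 (dist t s ^ (γ : ℝ))
    (dist t s ^ γ') (fun m => by positivity) le_rfl (by positivity)
    (rpow_le_rpow_or_one_le dist_nonneg γ.coe_nonneg hγ) (fun m hm => absurd hm (Nat.not_lt_zero m))
    (fun m => (hζ (m + 3)).2 t s)
  rwa [mul_zero, ENNReal.ofReal_zero, zero_add] at this

/-! ### Compact sets of paths -/

theorem PathBound.sub {φ : Test d} {β γ K K' : ℝ} {k : ℕ} {T : ℝ≥0}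
    {ζ ζ' : Set.Icc (0 : ℝ≥0) T → Distr d} (h : PathBound φ β γ K k ζ)
    (h' : PathBound φ β γ K' k ζ') : PathBound φ β γ (K + K') k (fun t => ζ t - ζ' t) :=
  fun M => by
  refine ⟨fun t => ?_, fun s t => ?_⟩
  · rw [add_mul]
    exact ((h M).1 t).sub ((h' M).1 t)
  · rw [add_mul, add_mul, sub_sub_sub_comm]
    exact ((h M).2 s t).sub ((h' M).2 s t)

/-- Pointwise convergence to zero of paths with a common bound is uniform over the times and over
bounded sets of base points, for each scale `n`. -/
theorem eventually_forall_abs_pairing_le {φ : Test d} (hφ : ∀ w, 1 ≤ ‖w‖ → φ w = 0)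
    (hφ1 : ∫ w, φ w = 1) {β γ K : ℝ} (hγ : 0 < γ) (hK : 0 ≤ K) {k : ℕ} {T : ℝ≥0} {ι : Type*}
    {F : Filter ι} {ξ : ι → Set.Icc (0 : ℝ≥0) T → Distr d}
    (hξ : ∀ᶠ i in F, PathBound φ β γ K k (ξ i))
    (hlim : ∀ t (η : Test d), Tendsto (fun i => ξ i t η) F (𝓝 0))
    {n : ℕ} (hn : 1 ≤ n) (ρ : ℝ) {δ : ℝ} (hδ : 0 < δ) :
    ∀ᶠ i in F, ∀ t, ∀ y : Space d, ‖y‖ ≤ ρ → |ξ i t (dyadic φ n y)| ≤ δ := by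
  have hcomp : IsCompact ((Set.univ : Set (Set.Icc (0 : ℝ≥0) T)) ×ˢ
      Metric.closedBall (0 : Space d) ρ) := isCompact_univ.prod (isCompact_closedBall _ _)
  suffices key : ∀ᶠ q : ι × (Set.Icc (0 : ℝ≥0) T × Space d) in F ×ˢ 𝓝ˢ (Set.univ ×ˢ
      Metric.closedBall (0 : Space d) ρ), |ξ q.1 q.2.1 (dyadic φ n q.2.2)| ≤ δ by
    filter_upwards [key.curry] with i hi t y hy
    exact hi.self_of_nhdsSet (t, y) ⟨trivial, mem_closedBall_zero_iff.2 hy⟩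
  refine hcomp.mem_prod_nhdsSet_of_forall ?_
  rintro ⟨t₀, y₀⟩ -
  obtain ⟨M, hM⟩ := exists_nat_gt (‖y₀‖ + 3)
  set R := K * ((M : ℝ) + 1) ^ k
  have hR : 0 ≤ R := by positivity
  have htime : ∀ᶠ q : Set.Icc (0 : ℝ≥0) T × Space d in 𝓝 (t₀, y₀),
      R * dist t₀ q.1 ^ γ * (2 : ℝ) ^ (-(n : ℝ) * β) < δ / 3 := by
    have hc : ContinuousAt (fun q : Set.Icc (0 : ℝ≥0) T × Space d =>
        R * dist t₀ q.1 ^ γ * (2 : ℝ) ^ (-(n : ℝ) * β)) (t₀, y₀) := by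
      refine ContinuousAt.mul (ContinuousAt.mul continuousAt_const ?_) continuousAt_const
      exact (by fun_prop : ContinuousAt (fun q : Set.Icc (0 : ℝ≥0) T × Space d => dist t₀ q.1)
        (t₀, y₀)).rpow_const (Or.inr hγ.le)
    refine hc.eventually_lt continuousAt_const ?_
    simp only [dist_self, Real.zero_rpow hγ.ne', mul_zero, zero_mul]
    positivity
  have hspace := (eventually_abs_pairing_dyadic_sub_le hφ hφ1 β R n y₀
    (show 0 < δ / 3 by positivity))
  have hspace' : ∀ᶠ q : Set.Icc (0 : ℝ≥0) T × Space d in 𝓝 (t₀, y₀), ‖q.2‖ ≤ M ∧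
      ∀ ξ : Distr d, GrowthBound φ β (‖y₀‖ + 3) R ξ →
      |ξ (dyadic φ n q.2) - ξ (dyadic φ n y₀)| ≤ δ / 3 := by
    have h1 : ∀ᶠ y in 𝓝 y₀, ‖y‖ < (M : ℝ) :=
      continuous_norm.continuousAt.eventually_lt continuousAt_const (by linarith)
    exact (continuousAt_snd (p := (t₀, y₀))).eventually ((h1.mono fun _ h => h.le).and hspace)
  have hpt : ∀ᶠ i in F, |ξ i t₀ (dyadic φ n y₀)| ≤ δ / 3 := by
    have h := (hlim t₀ (dyadic φ n y₀)).abs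
    rw [abs_zero] at h
    exact (h.eventually_lt_const (by positivity : (0 : ℝ) < δ / 3)).mono fun _ h => h.le
  filter_upwards [(hξ.and hpt).prod_mk (htime.and hspace')] with ⟨i, t, y⟩ ⟨⟨h1, h2⟩, h3, h4, h5⟩
  have ht := (h1 M).2 t₀ t n hn y h4
  have hs := h5 (ξ i t₀) (((h1 M).1 t₀).mono le_rfl hM.le le_rfl hR)
  change |ξ i t (dyadic φ n y) - ξ i t₀ (dyadic φ n y)| ≤ _ at ht
  change |ξ i t (dyadic φ n y)| ≤ δ
  simp only [abs_le] at *
  constructor <;> linarith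

/-- At the price of a smaller exponent, the convergence is also uniform over the scales. -/
theorem eventually_forall_growthBound {φ : Test d} (hφ : ∀ w, 1 ≤ ‖w‖ → φ w = 0)
    (hφ1 : ∫ w, φ w = 1) {β β' γ K : ℝ} (hβ : β' < β) (hγ : 0 < γ) (hK : 0 ≤ K) {k : ℕ} {T : ℝ≥0}
    {ι : Type*} {F : Filter ι} {ξ : ι → Set.Icc (0 : ℝ≥0) T → Distr d}
    (hξ : ∀ᶠ i in F, PathBound φ β γ K k (ξ i))
    (hlim : ∀ t (η : Test d), Tendsto (fun i => ξ i t η) F (𝓝 0))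
    (ρ : ℝ) {δ : ℝ} (hδ : 0 < δ) :
    ∀ᶠ i in F, ∀ t, GrowthBound φ β' ρ δ (ξ i t) := by
  obtain ⟨M, hM⟩ := exists_nat_gt ρ
  set R := K * ((M : ℝ) + 1) ^ k
  have hR : 0 ≤ R := by positivity
  have htend : Tendsto (fun n : ℕ => R * ((2 : ℝ) ^ (-(β - β'))) ^ n) atTop (𝓝 0) := by
    have h := (tendsto_pow_atTop_nhds_zero_of_lt_one (by positivity)
      (Real.rpow_lt_one_of_one_lt_of_neg one_lt_two (by linarith : -(β - β') < 0))).const_mul R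
    rwa [mul_zero] at h
  obtain ⟨N, hN⟩ := eventually_atTop.1 (htend.eventually_le_const hδ)
  have hfin : ∀ᶠ i in F, ∀ n ∈ Finset.range N, 1 ≤ n → ∀ t, ∀ y : Space d, ‖y‖ ≤ ρ →
      |ξ i t (dyadic φ n y)| ≤ δ * (2 : ℝ) ^ (-(n : ℝ) * β') := by
    rw [eventually_all_finset]
    intro n _
    by_cases hn : 1 ≤ n
    · filter_upwards [eventually_forall_abs_pairing_le hφ hφ1 hγ hK hξ hlim hn ρ
        (show 0 < δ * (2 : ℝ) ^ (-(n : ℝ) * β') by positivity)] with i hi _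
      exact hi
    · exact Eventually.of_forall fun i h => absurd h hn
  filter_upwards [hξ, hfin] with i h1 h2 t n hn y hy
  rcases lt_or_ge n N with h | h
  · exact h2 n (Finset.mem_range.2 h) hn t y hy
  · refine ((h1 M).1 t n hn y (hy.trans hM.le)).trans ?_
    have h3 : (2 : ℝ) ^ (-(n : ℝ) * β) =
        ((2 : ℝ) ^ (-(β - β'))) ^ n * (2 : ℝ) ^ (-(n : ℝ) * β') := by
      rw [← Real.rpow_mul_natCast (by norm_num), ← Real.rpow_add (by norm_num)]
      congr 1
      ring
    rw [h3, ← mul_assoc]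
    exact mul_le_mul_of_nonneg_right (hN n h) (by positivity)

/-- At the price of smaller exponents, the convergence of the increments is uniform as well. -/
theorem eventually_forall_growthBound_increment {φ : Test d} (hφ : ∀ w, 1 ≤ ‖w‖ → φ w = 0)
    (hφ1 : ∫ w, φ w = 1) {β β' γ γ' K : ℝ} (hβ : β' < β) (hγ : 0 < γ) (hγγ' : γ < γ')
    (hK : 0 ≤ K) {k : ℕ} {T : ℝ≥0}
    {ι : Type*} {F : Filter ι} {ξ : ι → Set.Icc (0 : ℝ≥0) T → Distr d}
    (hξ : ∀ᶠ i in F, PathBound φ β γ' K k (ξ i))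
    (hlim : ∀ t (η : Test d), Tendsto (fun i => ξ i t η) F (𝓝 0))
    (ρ : ℝ) {δ : ℝ} (hδ : 0 < δ) :
    ∀ᶠ i in F, ∀ s t, GrowthBound φ β' ρ (δ * dist s t ^ γ) (ξ i t - ξ i s) := by
  obtain ⟨M, hM⟩ := exists_nat_gt ρ
  set R := K * ((M : ℝ) + 1) ^ k
  have hR : 0 ≤ R := by positivity
  -- close times are handled by the gain `γ' - γ` in the exponent, distant ones by the convergence
  obtain ⟨τ, hτ, hτR⟩ : ∃ τ : ℝ, 0 < τ ∧ R * τ ^ (γ' - γ) ≤ δ := by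
    refine ⟨(δ / (R + 1)) ^ (γ' - γ)⁻¹, by positivity, ?_⟩
    rw [← Real.rpow_mul (by positivity), inv_mul_cancel₀ (by linarith), Real.rpow_one,
      ← mul_div_assoc, div_le_iff₀ (by positivity)]
    nlinarith
  filter_upwards [hξ, eventually_forall_growthBound hφ hφ1 hβ (hγ.trans hγγ') hK hξ hlim ρ
    (show 0 < δ * τ ^ γ / 2 by positivity)] with i h1 h2 s t
  rcases le_or_gt (dist s t) τ with h | h
  · refine ((h1 M).2 s t).mono hβ.le hM.le ?_ (by positivity)
    have h3 : dist s t ^ γ' = dist s t ^ (γ' - γ) * dist s t ^ γ := by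
      rw [← Real.rpow_add_of_nonneg dist_nonneg (by linarith) hγ.le, sub_add_cancel]
    rw [h3, ← mul_assoc]
    refine mul_le_mul_of_nonneg_right (le_trans ?_ hτR) (by positivity)
    exact mul_le_mul_of_nonneg_left
      (Real.rpow_le_rpow dist_nonneg h (by linarith)) hR
  · refine ((h2 t).sub (h2 s)).mono le_rfl le_rfl ?_ (by positivity)
    rw [add_halves]
    exact mul_le_mul_of_nonneg_left (Real.rpow_le_rpow hτ.le h.le hγ.le) hδ.le

/-- An Arzelà–Ascoli theorem: a common bound with exponents larger than those of the path space
defines a compact set of paths. -/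
theorem isCompact_setOf_pathBound {φ : Test d} (hφ : ∀ w, 1 ≤ ‖w‖ → φ w = 0)
    (hφ1 : ∫ w, φ w = 1) {α β : ℝ} (hαβ : α < β) (hβ0 : β ≤ 0) {γ T : ℝ≥0}
    (hγ0 : 0 < γ) {γ' K : ℝ} (hγ : (γ : ℝ) < γ') (hK : 0 ≤ K) (k : ℕ) :
    IsCompact {f : HolderPath d α γ T | PathBound φ β γ' K k fun t => (f.toFun t).toDistr} := by
  have hγ0' : 0 < (γ : ℝ) := hγ0
  have hα : α < 0 := hαβ.trans_le hβ0
  rw [isCompact_iff_ultrafilter_le_nhds]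
  intro 𝓤 h𝓤
  have hmem : ∀ᶠ f : HolderPath d α γ T in 𝓤,
      PathBound φ β γ' K k fun t => (f.toFun t).toDistr := le_principal_iff.1 h𝓤
  -- the pointwise limit along the ultrafilter
  have hlim : ∀ (t : Set.Icc (0 : ℝ≥0) T) (η : Test d), ∃ l : ℝ,
      Tendsto (fun f : HolderPath d α γ T => (f.toFun t).toDistr η) 𝓤 (𝓝 l) := fun t η => by
    obtain ⟨r, hr1, hrβ⟩ := exists_one_le_nat_add_pos β
    obtain ⟨ρ, hρ0, hρ⟩ := η.exists_support_bound
    obtain ⟨A, hA0, hA⟩ := η.exists_bound_of_le r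
    obtain ⟨C, hC0, hC⟩ := exists_pairing_le_of_growthBound hφ hφ1 hr1 hrβ hρ0
    obtain ⟨M, hM⟩ := exists_nat_gt (ρ + 1)
    set B := C * A * (K * ((M : ℝ) + 1) ^ k)
    have hb : ∀ᶠ f : HolderPath d α γ T in 𝓤, (f.toFun t).toDistr η ∈ Metric.closedBall 0 B := by
      filter_upwards [hmem] with f hf
      rw [mem_closedBall_zero_iff, Real.norm_eq_abs]
      exact hC _ η A _ (((hf M).1 t).mono le_rfl hM.le le_rfl (by positivity)) hρ
        (fun y => by simpa using hA 0 (Nat.zero_le _) y) (hA r le_rfl)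
    have hb' : ((𝓤.map fun f => (f.toFun t).toDistr η : Ultrafilter ℝ) : Filter ℝ) ≤
        𝓟 (Metric.closedBall 0 B) := le_principal_iff.2 hb
    obtain ⟨l, -, hl⟩ := (isCompact_closedBall (0 : ℝ) B).ultrafilter_le_nhds _ hb'
    exact ⟨l, hl⟩
  choose l hl using hlim
  have hdistr : ∀ t, ∃ ξ : Distr d, ∀ η, ξ η = l t η := fun t =>
    exists_distr_of_tendsto hφ hφ1 (F := (𝓤 : Filter (HolderPath d α γ T))) (β := β)
      (ζ := fun f => (f.toFun t).toDistr)
      (fun M => ⟨_, hmem.mono fun f hf => (hf M).1 t⟩) (hl t)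
  choose L hL using hdistr
  have hlimL : ∀ t (η : Test d), Tendsto (fun f : HolderPath d α γ T => (f.toFun t).toDistr η) 𝓤
      (𝓝 (L t η)) := fun t η => by
    rw [hL]
    exact hl t η
  have hLb : PathBound φ β γ' K k L := fun M =>
    ⟨fun t => GrowthBound.of_tendsto (hmem.mono fun f hf => (hf M).1 t) (hlimL t),
      fun s t => GrowthBound.of_tendsto (hmem.mono fun f hf => (hf M).2 s t)
        fun η => (hlimL t η).sub (hlimL s η)⟩
  obtain ⟨f₀, hf₀⟩ := exists_holderPath hφ hφ1 hα hαβ hβ0 hγ.le hK hLb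
  have hf₀' : (fun t => (f₀.toFun t).toDistr) = L := funext hf₀
  refine ⟨f₀, by change PathBound _ _ _ _ _ fun t => (f₀.toFun t).toDistr; rwa [hf₀'], ?_⟩
  -- the convergence holds in the path space
  have hξ : ∀ᶠ f : HolderPath d α γ T in 𝓤,
      PathBound φ β γ' (K + K) k fun t => (f.toFun t).toDistr - L t :=
    hmem.mono fun f hf => hf.sub hLb
  have hξlim : ∀ t (η : Test d),
      Tendsto (fun f : HolderPath d α γ T => ((f.toFun t).toDistr - L t) η) 𝓤 (𝓝 0) :=
    fun t η => by
      have h := (hlimL t η).sub_const (L t η)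
      rwa [sub_self] at h
  set β' := (α + β) / 2 with hβ'
  have hβ'β : β' < β := by linarith
  have hKK : 0 ≤ K + K := by positivity
  obtain ⟨D, hD0, hD⟩ := exists_holderGauge_le hφ hφ1 hα (by linarith : α < β') (by linarith)
  have htail := ENNReal.tendsto_sum_nat_add _ (tsum_weight_ne_top D (K + K) hD0 hKK k)
  suffices h : Tendsto id (𝓤 : Filter (HolderPath d α γ T)) (𝓝 f₀) from h
  rw [EMetric.tendsto_nhds]
  intro ε hε
  obtain ⟨e, he0, heε⟩ : ∃ e : ℝ, 0 < e ∧ ENNReal.ofReal e < ε := by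
    obtain ⟨e, he, he'⟩ := ENNReal.lt_iff_exists_nnreal_btwn.1 hε
    exact ⟨e, by exact_mod_cast he, by rwa [ENNReal.ofReal_coe_nnreal]⟩
  obtain ⟨m₀, hm₀⟩ := (htail.eventually_le_const
    (show 0 < ENNReal.ofReal (e / 4) by simpa using he0)).exists
  set δ := e / 4 / (D + 1)
  have hδ : 0 < δ := by positivity
  have hDδ : ENNReal.ofReal (D * δ) ≤ ENNReal.ofReal (e / 4) := by
    refine ENNReal.ofReal_le_ofReal ?_
    simp only [δ]
    rw [← mul_div_assoc, div_le_iff₀ (by positivity)]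
    nlinarith
  have hsum : ENNReal.ofReal (D * δ) + ∑' m : ℕ, (2⁻¹ : ℝ≥0∞) ^ (m + m₀ + 1) *
      ENNReal.ofReal (max 1 (D * ((K + K) * (((m + m₀ : ℕ) + 3 : ℕ) + 1 : ℝ) ^ k))) ≤
      ENNReal.ofReal (e / 2) := by
    refine (add_le_add hDδ hm₀).trans_eq ?_
    rw [← ENNReal.ofReal_add (by positivity) (by positivity)]
    congr 1
    ring
  filter_upwards [hξ, eventually_forall_growthBound hφ hφ1 hβ'β (hγ0'.trans hγ) hKK hξ hξlim
      (m₀ + 3 : ℕ) hδ,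
    eventually_forall_growthBound_increment hφ hφ1 hβ'β hγ0' hγ hKK hξ hξlim
      (m₀ + 3 : ℕ) hδ] with f h1 h2 h3
  refine lt_of_le_of_lt ?_ heε
  have hcast : ∀ m < m₀, ((m + 3 : ℕ) : ℝ) ≤ (m₀ + 3 : ℕ) := fun m hm => by
    exact_mod_cast Nat.add_le_add_right hm.le 3
  change (⨆ t, holderGauge α ((f.toFun t).toDistr - (f₀.toFun t).toDistr)) +
    (⨆ s, ⨆ t, ⨆ _ : s ≠ t, f.quot f₀ s t) ≤ _
  rw [← add_halves e, ENNReal.ofReal_add (by positivity) (by positivity)]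
  refine add_le_add (iSup_le fun t => ?_)
    (iSup_le fun s => iSup_le fun t => iSup_le fun hst => ?_)
  · rw [hf₀]
    have h4 := hD ((f.toFun t).toDistr - L t) (fun m => (K + K) * ((m + 3 : ℕ) + 1 : ℝ) ^ k) m₀ δ
      1 1 (fun m => by positivity) hδ.le zero_le_one (Or.inl le_rfl)
      (fun m hm => (h2 t).mono le_rfl (hcast m hm) (by rw [mul_one]) (by positivity))
      (fun m => ((h1 (m + 3)).1 t).mono hβ'β.le le_rfl (by rw [mul_one]) (by positivity))
    refine h4.trans ?_
    rw [ENNReal.ofReal_one, mul_one]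
    exact hsum
  · refine ENNReal.div_le_of_le_mul ?_
    have h5 : f.incr s t - f₀.incr s t =
        ((f.toFun t).toDistr - L t) - ((f.toFun s).toDistr - L s) := by
      simp only [HolderPath.incr, hf₀]
      abel
    rw [h5, edist_rpow_eq s t γ.coe_nonneg]
    have h4 := hD (((f.toFun t).toDistr - L t) - ((f.toFun s).toDistr - L s))
      (fun m => (K + K) * ((m + 3 : ℕ) + 1 : ℝ) ^ k) m₀ δ
      (dist s t ^ (γ : ℝ)) (dist s t ^ γ') (fun m => by positivity) hδ.le (by positivity)
      (rpow_le_rpow_or_one_le dist_nonneg γ.coe_nonneg hγ.le)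
      (fun m hm => (h3 s t).mono le_rfl (hcast m hm) le_rfl (by positivity))
      (fun m => ((h1 (m + 3)).2 s t).mono hβ'β.le le_rfl le_rfl (by positivity))
    exact h4.trans (mul_le_mul_left hsum _)

/-! ### Measurability in the path space -/

/-- Up to a factor, `φ` is one of the test functions which define the Hölder seminorms. -/
theorem exists_smul_mem_unitTests {φ : Test d} (hφ : tsupport φ ⊆ Metric.ball 0 1) (r : ℕ) :
    ∃ c : ℝ, 0 < c ∧ c • φ ∈ unitTests d r := by
  obtain ⟨A, hA0, hA⟩ := φ.exists_bound_of_le r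
  refine ⟨(A + 1)⁻¹, by positivity, fun y hy => hφ ?_, fun j hj y => ?_⟩
  · exact closure_mono (Function.support_const_smul_subset (A + 1)⁻¹ φ) hy
  · have h : iteratedFDeriv ℝ j (⇑((A + 1)⁻¹ • φ)) y = (A + 1)⁻¹ • iteratedFDeriv ℝ j φ y :=
      iteratedFDeriv_const_smul_apply
        (φ.contDiff_infty.of_le (by exact_mod_cast le_top)).contDiffAt
    rw [h, norm_smul, norm_inv, Real.norm_of_nonneg (by positivity),
      inv_mul_le_iff₀ (by positivity)]
    linarith [hA j hj y]

theorem continuous_toDistr_dyadic {φ : Test d} (hφ : tsupport φ ⊆ Metric.ball 0 1) (α : ℝ)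
    {n : ℕ} (hn : 1 ≤ n) (y : Space d) :
    Continuous fun ζ : HolderDistr d α => ζ.toDistr (dyadic φ n y) := by
  obtain ⟨c, hc, hcφ⟩ := exists_smul_mem_unitTests hφ ⌈-α⌉₊
  obtain ⟨m, hm⟩ := exists_nat_gt ‖y‖
  have hl0 : (0 : ℝ) < (2 ^ n)⁻¹ := by positivity
  have hl : ((2 : ℝ) ^ n)⁻¹ ∈ Set.Ioo (0 : ℝ) 1 :=
    ⟨hl0, inv_lt_one_of_one_lt₀ (one_lt_pow₀ one_lt_two (by omega))⟩
  set b : ℝ := ((2 ^ n)⁻¹ : ℝ) ^ (-α) * c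
  have hb : 0 < b := by positivity
  have hsemi : ∀ ξ : Distr d, ENNReal.ofReal (b * |ξ (dyadic φ n y)|) ≤
      holderSeminorm α (Metric.ball 0 ((m : ℝ) + 1)) ξ := fun ξ => by
    refine le_iSup₂_of_le (c • φ) hcφ (le_iSup_of_le ⟨_, hl⟩ (le_iSup₂_of_le y
      (mem_ball_zero_iff.2 (by linarith)) (le_of_eq ?_)))
    have h1 : rescale (c • φ) (2 ^ n)⁻¹ hl0 y = c • dyadic φ n y := by
      ext z
      change (((2 ^ n)⁻¹ : ℝ) ^ d)⁻¹ * (c * φ _) = c * ((((2 ^ n)⁻¹ : ℝ) ^ d)⁻¹ * φ _)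
      ring
    rw [h1, map_smul, smul_eq_mul, abs_mul, abs_of_pos hc, mul_assoc]
  rw [continuous_iff_continuousAt]
  intro ζ₀
  rw [ContinuousAt, Metric.tendsto_nhds]
  intro ε hε
  have hδ : 0 < (2⁻¹ : ℝ≥0∞) ^ (m + 1) * min 1 (ENNReal.ofReal (b * ε)) := by
    refine ENNReal.mul_pos (by simp) (ne_of_gt (lt_min one_pos ?_))
    exact ENNReal.ofReal_pos.2 (by positivity)
  filter_upwards [Metric.eball_mem_nhds ζ₀ hδ] with ζ hζ
  have h2 : (2⁻¹ : ℝ≥0∞) ^ (m + 1) *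
      min 1 (holderSeminorm α (Metric.ball 0 ((m : ℝ) + 1)) (ζ.toDistr - ζ₀.toDistr)) ≤
      edist ζ ζ₀ := ENNReal.le_tsum (f := fun m : ℕ => (2⁻¹ : ℝ≥0∞) ^ (m + 1) *
      min 1 (holderSeminorm α (Metric.ball 0 ((m : ℝ) + 1)) (ζ.toDistr - ζ₀.toDistr))) m
  have h3 := lt_of_mul_lt_mul_left' (h2.trans_lt hζ)
  have h4 : holderSeminorm α (Metric.ball 0 ((m : ℝ) + 1)) (ζ.toDistr - ζ₀.toDistr) <
      ENNReal.ofReal (b * ε) := by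
    rcases min_lt_iff.1 h3 with h | h
    · exact absurd (h.trans_le (min_le_left _ _)) (lt_irrefl _)
    · exact h.trans_le (min_le_right _ _)
  have h5 := (ENNReal.ofReal_lt_ofReal_iff (by positivity)).1 ((hsemi _).trans_lt h4)
  rw [Real.dist_eq]
  exact lt_of_mul_lt_mul_left h5 hb.le

theorem continuous_toFun {α : ℝ} {γ T : ℝ≥0} (t : Set.Icc (0 : ℝ≥0) T) :
    Continuous fun f : HolderPath d α γ T => f.toFun t := by
  refine LipschitzWith.continuous (K := 1) fun f g => ?_
  rw [ENNReal.coe_one, one_mul]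
  exact (le_iSup (fun t => edist (f.toFun t) (g.toFun t)) t).trans le_self_add

theorem HolderPath.continuous {α : ℝ} {γ T : ℝ≥0} (hγ : 0 < γ) (f : HolderPath d α γ T) :
    Continuous f.toFun := by
  obtain ⟨C, hC⟩ := f.memHolder'
  exact hC.continuous hγ

theorem HolderPath.ext_toDistr {α : ℝ} {γ T : ℝ≥0} {f g : HolderPath d α γ T}
    (h : ∀ t, (f.toFun t).toDistr = (g.toFun t).toDistr) : f = g := by
  obtain ⟨f, hf⟩ := f
  obtain ⟨g, hg⟩ := g
  have h' : f = g := funext fun t => by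
    have h1 := h t
    change (f t).toDistr = (g t).toDistr at h1
    revert h1
    generalize f t = u
    generalize g t = v
    cases u
    cases v
    intro h1
    cases h1
    rfl
  subst h'
  rfl

/-- The path space need not be separable. A random path which takes values in a countable union of
compact sets is nevertheless Borel measurable as soon as its pairings are: countably many of
them separate the points, and they embed each of the compact sets in a space of sequences. -/
theorem measurable_of_compact_cover {φ : Test d} (hφs : tsupport φ ⊆ Metric.ball 0 1)
    (hφ1 : ∫ w, φ w = 1) {α : ℝ} {γ T : ℝ≥0} (hγ : 0 < γ) {Ω : Type*} [MeasurableSpace Ω]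
    {Z : Ω → HolderPath d α γ T} (hZ : ∀ t, IsRandomDistr fun ω => ((Z ω).toFun t).toDistr)
    {K : ℕ → Set (HolderPath d α γ T)} (hK : ∀ j, IsCompact (K j)) (hZK : ∀ ω, ∃ j, Z ω ∈ K j) :
    Measurable Z := by
  have hφ := apply_eq_zero_of_tsupport_subset hφs
  obtain ⟨A, hAc, hA⟩ := TopologicalSpace.exists_countable_dense (Set.Icc (0 : ℝ≥0) T)
  obtain ⟨B, hBc, hB⟩ := TopologicalSpace.exists_countable_dense (Space d)
  have : Countable A := hAc.to_subtype
  have : Countable B := hBc.to_subtype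
  let Φ : HolderPath d α γ T → (ℕ × A × B → ℝ) := fun f i =>
    (f.toFun i.2.1).toDistr (dyadic φ (i.1 + 1) i.2.2)
  have hΦc : Continuous Φ := continuous_pi fun i =>
    (continuous_toDistr_dyadic hφs α (Nat.le_add_left 1 i.1) (i.2.2 : Space d)).comp
      (continuous_toFun (i.2.1 : Set.Icc (0 : ℝ≥0) T))
  have hΦi : ∀ f g, Φ f = Φ g → f = g := fun f g hfg => by
    refine HolderPath.ext_toDistr fun t => eq_of_pairing_dyadic_eq hφ hφ1 fun n hn => ?_
    have h1 : ∀ s : A, ∀ y : Space d, (f.toFun s).toDistr (dyadic φ n y) =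
        (g.toFun s).toDistr (dyadic φ n y) := fun s => by
      refine congrFun (Continuous.ext_on hB (continuous_pairing_dyadic φ _ n)
        (continuous_pairing_dyadic φ _ n) fun y hy => ?_)
      obtain ⟨m, rfl⟩ : ∃ m, n = m + 1 := ⟨n - 1, by omega⟩
      exact congrFun hfg (m, s, ⟨y, hy⟩)
    intro y
    have hc := continuous_toDistr_dyadic hφs α hn y
    exact congrFun (Continuous.ext_on hA (hc.comp (f.continuous hγ))
      (hc.comp (g.continuous hγ)) fun s hs => h1 ⟨s, hs⟩ y) t
  have hΦZ : Measurable (Φ ∘ Z) := measurable_pi_lambda _ fun i => hZ _ _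
  refine measurable_of_isClosed fun F hF => ?_
  have h : Z ⁻¹' F = ⋃ j, (Φ ∘ Z) ⁻¹' (Φ '' (F ∩ K j)) := by
    ext ω
    simp only [Set.mem_preimage, Set.mem_iUnion, Set.mem_image, Function.comp]
    constructor
    · intro hω
      obtain ⟨j, hj⟩ := hZK ω
      exact ⟨j, Z ω, ⟨hω, hj⟩, rfl⟩
    · rintro ⟨j, f, hf, hfZ⟩
      rw [← hΦi f _ hfZ]
      exact hf.1
  rw [h]
  exact MeasurableSet.iUnion fun j =>
    hΦZ (((hK j).inter_left hF).image hΦc).isClosed.measurableSet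

/-! ### Chaining over the dyadic times -/

/-- The `k`-th point of the subdivision of `[0, T]` into `2^j` intervals. -/
def gridPoint (T : ℝ≥0) (j k : ℕ) : ℝ≥0 := T * (k / 2 ^ j)

/-- The index of the largest point of the `j`-th subdivision of `[0, T]` which is at most `t`. -/
def gridIndex (T : ℝ≥0) (j : ℕ) (t : ℝ≥0) : ℕ := ⌊(2 : ℝ) ^ j * (t / T)⌋₊

/-- The largest point of the `j`-th subdivision of `[0, T]` which is at most `t`. -/
def gridFloor (T : ℝ≥0) (j : ℕ) (t : ℝ≥0) : ℝ≥0 := gridPoint T j (gridIndex T j t)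

theorem gridPoint_succ (T : ℝ≥0) (j k : ℕ) : gridPoint T (j + 1) (2 * k) = gridPoint T j k := by
  unfold gridPoint
  rw [pow_succ', Nat.cast_mul, Nat.cast_ofNat, mul_div_mul_left _ _ two_ne_zero]

theorem gridFloor_zero (T : ℝ≥0) (j : ℕ) : gridFloor T j 0 = 0 := by
  simp [gridFloor, gridPoint, gridIndex]

theorem gridIndex_div_two (T : ℝ≥0) (j : ℕ) (t : ℝ≥0) :
    gridIndex T j t = gridIndex T (j + 1) t / 2 := by
  unfold gridIndex
  have h := Nat.floor_div_natCast ((2 : ℝ) ^ (j + 1) * (t / T)) 2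
  rw [← h]
  congr 1
  push_cast
  ring

theorem gridIndex_le {T : ℝ≥0} (j : ℕ) {t : ℝ≥0} (ht : t ≤ T) : gridIndex T j t ≤ 2 ^ j := by
  have h : ((t : ℝ) / T) ≤ 1 := div_le_one_of_le₀ (by exact_mod_cast ht) T.coe_nonneg
  refine Nat.floor_le_of_le ?_
  push_cast
  nlinarith [pow_pos (zero_lt_two : (0 : ℝ) < 2) j]

theorem gridIndex_le_add_one {T : ℝ≥0} {j : ℕ} {s t : ℝ≥0} (hst : s ≤ t)
    (h : (t - s : ℝ) / T ≤ 2⁻¹ ^ j) :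
    gridIndex T j t = gridIndex T j s ∨ gridIndex T j t = gridIndex T j s + 1 := by
  have h1 : gridIndex T j s ≤ gridIndex T j t := by
    refine Nat.floor_mono ?_
    gcongr
  have h2 : gridIndex T j t ≤ gridIndex T j s + 1 := by
    unfold gridIndex
    rw [← Nat.floor_add_one (by positivity)]
    refine Nat.floor_mono ?_
    have h3 : (2 : ℝ) ^ j * ((t - s : ℝ) / T) ≤ 1 := by
      refine (mul_le_mul_of_nonneg_left h (by positivity)).trans_eq ?_
      rw [← mul_pow, mul_inv_cancel₀ two_ne_zero, one_pow]
    rw [sub_div, mul_sub] at h3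
    linarith
  omega

theorem dist_gridFloor_le {T : ℝ≥0} (hT : 0 < T) (j : ℕ) (t : ℝ≥0) :
    dist (gridFloor T j t) t ≤ T * 2⁻¹ ^ j := by
  have hT' : (0 : ℝ) < T := hT
  have h0 : 0 ≤ (2 : ℝ) ^ j * (t / T) := by positivity
  have h1 := Nat.floor_le h0
  have h2 := Nat.lt_floor_add_one ((2 : ℝ) ^ j * (t / T))
  have h3 : (t : ℝ) = T * 2⁻¹ ^ j * (2 ^ j * (t / T)) := by
    rw [inv_pow]
    field_simp
  have h4 : ((gridFloor T j t : ℝ≥0) : ℝ) = T * 2⁻¹ ^ j * (⌊(2 : ℝ) ^ j * (t / T)⌋₊ : ℝ) := by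
    simp only [gridFloor, gridPoint, gridIndex]
    push_cast
    rw [inv_pow]
    field_simp
  have h5 : (0 : ℝ) ≤ T * 2⁻¹ ^ j := by positivity
  rw [NNReal.dist_eq, h4, abs_le]
  constructor <;> nlinarith

theorem tendsto_gridFloor {T : ℝ≥0} (hT : 0 < T) (t : ℝ≥0) :
    Tendsto (fun j => gridFloor T j t) atTop (𝓝 t) := by
  rw [tendsto_iff_dist_tendsto_zero]
  refine squeeze_zero (fun _ => dist_nonneg) (fun j => dist_gridFloor_le hT j t) ?_
  have h := (tendsto_pow_atTop_nhds_zero_of_lt_one (by norm_num : (0 : ℝ) ≤ 2⁻¹)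
    (by norm_num)).const_mul (T : ℝ)
  rwa [mul_zero] at h

/-- Kolmogorov's chaining argument: Hölder bounds along the edges of the dyadic subdivisions extend
to all times. -/
theorem exists_chaining_bound {T : ℝ≥0} (hT : 0 < T) {γ : ℝ} (hγ : 0 < γ) :
    ∃ C : ℝ, 0 ≤ C ∧ ∀ (a : ℝ≥0 → ℝ) (R : ℝ), 0 ≤ R →
      (∀ j k, k < 2 ^ j → |a (gridPoint T j (k + 1)) - a (gridPoint T j k)| ≤
        R * (2 : ℝ) ^ (-(j : ℝ) * γ)) →
      ∃ b : Set.Icc (0 : ℝ≥0) T → ℝ,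
        (∀ t : Set.Icc (0 : ℝ≥0) T, Tendsto (fun j => a (gridFloor T j t)) atTop (𝓝 (b t))) ∧
        (∀ s t, |b t - b s| ≤ C * R * dist s t ^ γ) ∧
        (∀ t, |b t| ≤ |a 0| + C * R) ∧
        ∀ j (t : Set.Icc (0 : ℝ≥0) T), |a (gridFloor T j t)| ≤ |a 0| + C * R := by
  have hT' : (0 : ℝ) < T := hT
  set κ : ℝ := (2 : ℝ) ^ (-γ) with hκ
  have hκ0 : 0 < κ := by positivity
  have hκ1 : κ < 1 := Real.rpow_lt_one_of_one_lt_of_neg one_lt_two (by linarith)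
  have hκ' : 0 < 1 - κ := by linarith
  have hκj : ∀ j : ℕ, (2 : ℝ) ^ (-(j : ℝ) * γ) = κ ^ j := fun j => by
    rw [hκ, ← Real.rpow_mul_natCast (by norm_num)]
    congr 1
    ring
  set C₁ := κ⁻¹ * (1 + 2 * (1 / (1 - κ))) * ((T : ℝ) ^ γ)⁻¹
  have hC₁ : 0 ≤ C₁ := by positivity
  refine ⟨C₁ + (C₁ * (T : ℝ) ^ γ + 1 / (1 - κ)), by positivity, fun a R hR ha => ?_⟩
  -- the two points are equal or the ends of an edge of the finer subdivision
  have hstep : ∀ (t : Set.Icc (0 : ℝ≥0) T) j,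
      dist (a (gridFloor T j t)) (a (gridFloor T (j + 1) t)) ≤ R * κ ^ j := fun t j => by
    have h2 := gridIndex_div_two T j t
    have h3 := gridIndex_le (j + 1) t.2.2
    unfold gridFloor
    rw [← gridPoint_succ, dist_comm, Real.dist_eq]
    obtain h4 | h4 : gridIndex T (j + 1) t = 2 * gridIndex T j t ∨
        gridIndex T (j + 1) t = 2 * gridIndex T j t + 1 := by omega
    · rw [h4, sub_self, abs_zero]
      positivity
    · rw [h4]
      refine (ha (j + 1) (2 * gridIndex T j t) (by omega)).trans ?_
      rw [hκj, pow_succ, ← mul_assoc]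
      exact mul_le_of_le_one_right (by positivity) hκ1.le
  have hlim : ∀ t : Set.Icc (0 : ℝ≥0) T, ∃ l,
      Tendsto (fun j => a (gridFloor T j t)) atTop (𝓝 l) := fun t =>
    cauchySeq_tendsto_of_complete (cauchySeq_of_le_geometric κ R hκ1 (hstep t))
  choose b hb using hlim
  have hdist : ∀ j (t : Set.Icc (0 : ℝ≥0) T),
      |a (gridFloor T j t) - b t| ≤ 1 / (1 - κ) * R * κ ^ j := fun j t => by
    refine (dist_le_of_le_geometric_of_tendsto κ R hκ1 (hstep t) (hb t) j).trans_eq ?_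
    ring
  have hinc : ∀ s t : Set.Icc (0 : ℝ≥0) T, s < t → |b t - b s| ≤ C₁ * R * dist s t ^ γ :=
    fun s t hst => by
    have hst' : ((s : ℝ≥0) : ℝ) < (t : ℝ≥0) := by exact_mod_cast hst
    have htT : ((t : ℝ≥0) : ℝ) ≤ T := by exact_mod_cast t.2.2
    have hs0 : (0 : ℝ) ≤ (s : ℝ≥0) := NNReal.coe_nonneg _
    have hd : dist s t = (t : ℝ≥0) - (s : ℝ≥0) := by
      rw [Subtype.dist_eq, NNReal.dist_eq, abs_sub_comm, abs_of_pos (by linarith)]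
    obtain ⟨j, hj1, hj2⟩ := exists_nat_pow_near_of_lt_one
      (x := (((t : ℝ≥0) - (s : ℝ≥0) : ℝ)) / T) (y := (2⁻¹ : ℝ))
      (div_pos (by linarith) hT') (div_le_one_of_le₀ (by linarith) hT'.le) (by norm_num)
      (by norm_num)
    have h1 : |a (gridFloor T j t) - a (gridFloor T j s)| ≤ R * κ ^ j := by
      unfold gridFloor
      rcases gridIndex_le_add_one (T := T) hst.le hj2 with h | h
      · rw [h, sub_self, abs_zero]
        positivity
      · rw [h, ← hκj]
        refine ha j _ ?_
        have := gridIndex_le j t.2.2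
        omega
    have h2 := hdist j t
    have h3 := hdist j s
    have h4 : |b t - b s| ≤ (1 + 2 * (1 / (1 - κ))) * R * κ ^ j := by
      simp only [abs_le] at *
      constructor <;> linarith
    refine h4.trans ?_
    have h5 : κ ^ j ≤ κ⁻¹ * (((T : ℝ) ^ γ)⁻¹ * dist s t ^ γ) := by
      rw [le_inv_mul_iff₀ hκ0, ← pow_succ', hd, inv_mul_eq_div,
        ← Real.div_rpow (by linarith) hT'.le]
      refine le_trans (le_of_eq ?_) (Real.rpow_le_rpow (by positivity) hj1.le hγ.le)
      rw [hκ, ← Real.rpow_mul_natCast (by norm_num), ← Real.rpow_natCast,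
        ← Real.rpow_mul (by norm_num), Real.inv_rpow (by norm_num), ← Real.rpow_neg (by norm_num)]
      congr 1
      ring
    refine (mul_le_mul_of_nonneg_left h5 (by positivity)).trans_eq ?_
    simp only [C₁]
    ring
  have hinc' : ∀ s t : Set.Icc (0 : ℝ≥0) T, |b t - b s| ≤ C₁ * R * dist s t ^ γ := fun s t => by
    rcases lt_trichotomy s t with h | h | h
    · exact hinc s t h
    · rw [h, sub_self, abs_zero]
      positivity
    · rw [abs_sub_comm, dist_comm]
      exact hinc t s h
  have hb0 : b ⟨0, le_rfl, bot_le⟩ = a 0 := by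
    refine tendsto_nhds_unique (hb _) ?_
    simp only [gridFloor_zero]
    exact tendsto_const_nhds
  have hbound : ∀ t, |b t| ≤ |a 0| + C₁ * (T : ℝ) ^ γ * R := fun t => by
    have h1 := hinc' ⟨0, le_rfl, bot_le⟩ t
    rw [hb0] at h1
    have h2 : dist (⟨0, le_rfl, bot_le⟩ : Set.Icc (0 : ℝ≥0) T) t ≤ T := by
      rw [Subtype.dist_eq, NNReal.dist_eq, NNReal.coe_zero, zero_sub, abs_neg, NNReal.abs_eq]
      exact_mod_cast t.2.2
    have h3 := mul_le_mul_of_nonneg_left (Real.rpow_le_rpow dist_nonneg h2 hγ.le)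
      (mul_nonneg hC₁ hR)
    have h4 := abs_sub_abs_le_abs_sub (b t) (a 0)
    linarith
  have hp : 0 ≤ 1 / (1 - κ) * R := by positivity
  have hp1 : 0 ≤ C₁ * R := by positivity
  have hp2 : 0 ≤ C₁ * (T : ℝ) ^ γ * R := by positivity
  refine ⟨b, hb, fun s t => (hinc' s t).trans ?_, fun t => ?_, fun j t => ?_⟩
  · refine mul_le_mul_of_nonneg_right ?_ (by positivity)
    linarith
  · linarith [hbound t]
  · have h1 := hdist j t
    have h2 := abs_sub_abs_le_abs_sub (a (gridFloor T j t)) (b t)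
    have h3 : κ ^ j ≤ 1 := pow_le_one₀ hκ0.le hκ1.le
    have h4 : 1 / (1 - κ) * R * κ ^ j ≤ 1 / (1 - κ) * R := mul_le_of_le_one_right hp h3
    linarith [hbound t]

/-- The values of a path of distributions at the dyadic times extend to a path defined by limits,
which inherits the bounds along the edges of the subdivisions. -/
theorem exists_path_of_grid {φ : Test d} (hφ : ∀ w, 1 ≤ ‖w‖ → φ w = 0)
    (hφ1 : ∫ w, φ w = 1) (β : ℝ) {T : ℝ≥0} (hT : 0 < T) {γ : ℝ} (hγ : 0 < γ) :
    ∃ C : ℝ, 0 ≤ C ∧ ∀ (ζ : ℝ≥0 → Distr d) (K : ℝ) (k : ℕ), 0 ≤ K →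
      (∀ M : ℕ, GrowthBound φ β M (K * ((M : ℝ) + 1) ^ k) (ζ 0)) →
      (∀ j i : ℕ, i < 2 ^ j → ∀ M : ℕ, GrowthBound φ β M
        (K * ((M : ℝ) + 1) ^ k * (2 : ℝ) ^ (-(j : ℝ) * γ))
        (ζ (gridPoint T j (i + 1)) - ζ (gridPoint T j i))) →
      ∃ L : Set.Icc (0 : ℝ≥0) T → Distr d, PathBound φ β γ (C * K) k L ∧
        ∀ (t : Set.Icc (0 : ℝ≥0) T) (η : Test d),
          Tendsto (fun j => ζ (gridFloor T j t) η) atTop (𝓝 (L t η)) := by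
  obtain ⟨C, hC0, hC⟩ := exists_chaining_bound hT hγ
  refine ⟨1 + C, by positivity, fun ζ K k hK h0 h1 => ?_⟩
  have hdy : ∀ (M n : ℕ), 1 ≤ n → ∀ y : Space d, ‖y‖ ≤ M → ∀ j i : ℕ, i < 2 ^ j →
      |ζ (gridPoint T j (i + 1)) (dyadic φ n y) - ζ (gridPoint T j i) (dyadic φ n y)| ≤
      K * ((M : ℝ) + 1) ^ k * (2 : ℝ) ^ (-(n : ℝ) * β) * (2 : ℝ) ^ (-(j : ℝ) * γ) :=
    fun M n hn y hy j i hi => by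
      refine (h1 j i hi M n hn y hy).trans_eq ?_
      ring
  have hlim : ∀ η : Test d, ∃ b : Set.Icc (0 : ℝ≥0) T → ℝ,
      ∀ t : Set.Icc (0 : ℝ≥0) T,
        Tendsto (fun j => ζ (gridFloor T j t) η) atTop (𝓝 (b t)) := fun η => by
    obtain ⟨r, hr1, hrβ⟩ := exists_one_le_nat_add_pos β
    obtain ⟨ρ, hρ0, hρ⟩ := η.exists_support_bound
    obtain ⟨A, hA0, hA⟩ := η.exists_bound_of_le r
    obtain ⟨D, hD0, hD⟩ := exists_pairing_le_of_growthBound hφ hφ1 hr1 hrβ hρ0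
    obtain ⟨M, hM⟩ := exists_nat_gt (ρ + 1)
    obtain ⟨b, hb, -⟩ := hC (fun t => ζ t η) (D * A * (K * ((M : ℝ) + 1) ^ k)) (by positivity)
      fun j i hi => by
        have h2 := hD _ η A _ ((h1 j i hi M).mono le_rfl hM.le le_rfl (by positivity)) hρ
          (fun y => by simpa using hA 0 (Nat.zero_le _) y) (hA r le_rfl)
        exact h2.trans_eq (by ring)
    exact ⟨b, hb⟩
  choose b hb using hlim
  have hdistr : ∀ t, ∃ ξ : Distr d, ∀ η, ξ η = b η t := fun t =>
    exists_distr_of_tendsto hφ hφ1 (F := atTop) (β := β) (ζ := fun j => ζ (gridFloor T j t))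
      (fun M => ⟨(1 + C) * (K * ((M : ℝ) + 1) ^ k), Eventually.of_forall fun j n hn y hy => by
        obtain ⟨-, -, -, -, h⟩ := hC (fun t => ζ t (dyadic φ n y)) _ (by positivity)
          (hdy M n hn y hy)
        have h3 := h0 M n hn y hy
        have h4 := h j t
        linarith⟩) fun η => hb η t
  choose L hL using hdistr
  refine ⟨L, fun M => ⟨fun t n hn y hy => ?_, fun s t n hn y hy => ?_⟩, fun t η => ?_⟩
  · obtain ⟨b', hb', -, h, -⟩ := hC (fun t => ζ t (dyadic φ n y)) _ (by positivity)
      (hdy M n hn y hy)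
    rw [hL, tendsto_nhds_unique (hb (dyadic φ n y) t) (hb' t)]
    have h3 := h0 M n hn y hy
    have h4 := h t
    linarith
  · obtain ⟨b', hb', h, -⟩ := hC (fun t => ζ t (dyadic φ n y)) _ (by positivity)
      (hdy M n hn y hy)
    change |L t (dyadic φ n y) - L s (dyadic φ n y)| ≤ _
    rw [hL, hL, tendsto_nhds_unique (hb (dyadic φ n y) t) (hb' t),
      tendsto_nhds_unique (hb (dyadic φ n y) s) (hb' s)]
    refine (h s t).trans ?_
    have h5 : 0 ≤ K * ((M : ℝ) + 1) ^ k * (2 : ℝ) ^ (-(n : ℝ) * β) * dist s t ^ γ := by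
      positivity
    nlinarith
  · rw [hL]
    exact hb η t

/-! ### The energy of a distribution and its expectation -/

/-- A finite measure on `ℝ^d` with a polynomially decaying positive density. -/
def weight (d : ℕ) : Measure (Space d) :=
  volume.withDensity fun y => ENNReal.ofReal ((1 + ‖y‖) ^ (-((d + 1 : ℕ) : ℝ)))

theorem measurable_weight_density (d : ℕ) :
    Measurable fun y : Space d => ENNReal.ofReal ((1 + ‖y‖) ^ (-((d + 1 : ℕ) : ℝ))) := by
  fun_prop

instance : IsFiniteMeasure (weight d) := by
  refine isFiniteMeasure_withDensity_ofReal ?_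
  exact (integrable_one_add_norm (E := Space d) (μ := volume) (by simp)).2

theorem setLIntegral_closedBall_le (f : Space d → ℝ≥0∞) (hf : Measurable f) {ρ : ℝ} (hρ : 0 ≤ ρ) :
    ∫⁻ y in Metric.closedBall 0 ρ, f y ≤
      ENNReal.ofReal ((1 + ρ) ^ (d + 1)) * ∫⁻ y, f y ∂(weight d) := by
  rw [weight, lintegral_withDensity_eq_lintegral_mul _ (measurable_weight_density d) hf,
    ← lintegral_const_mul _ ((measurable_weight_density d).mul hf)]
  refine (setLIntegral_mono' Metric.isClosed_closedBall.measurableSet fun y hy => ?_).trans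
    (setLIntegral_le_lintegral _ _)
  rw [Pi.mul_apply, ← mul_assoc, ← ENNReal.ofReal_mul (by positivity)]
  refine le_mul_of_one_le_left (zero_le) ?_
  rw [ENNReal.one_le_ofReal, Real.rpow_neg (by positivity), Real.rpow_natCast,
    ← div_eq_mul_inv, one_le_div (by positivity)]
  gcongr
  exact mem_closedBall_zero_iff.1 hy

/-- The `p`-th power of a weighted Besov norm of order `a` of the distribution `ξ`. The weight makes
its expectation finite for random distributions with moments bounded uniformly in space. -/
def energy (φ : Test d) (p a : ℝ) (ξ : Distr d) : ℝ≥0∞ :=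
  ∑' n : ℕ, ENNReal.ofReal ((2 : ℝ) ^ (((n + 1 : ℕ) : ℝ) * a * p)) *
    ∫⁻ y, ‖ξ (dyadic φ (n + 1) y)‖ₑ ^ p ∂(weight d)

/-- The energy controls the pairings on every ball, with a constant which grows polynomially in the
radius because the density of the weight decays polynomially. -/
theorem exists_growthBound_of_energy_le {φ : Test d} (hφ : ∀ w, 1 ≤ ‖w‖ → φ w = 0)
    (hφ1 : ∫ w, φ w = 1) (a : ℝ) {p : ℝ} (hp : 1 ≤ p) :
    ∃ C : ℝ, 0 ≤ C ∧ ∀ (ξ : Distr d) (e : ℝ), 0 ≤ e → energy φ p a ξ ≤ ENNReal.ofReal (e ^ p) →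
      ∀ M : ℕ, GrowthBound φ (a - d / p) M (C * e * ((M : ℝ) + 1) ^ (d + 1)) ξ := by
  obtain ⟨r, hr1, hra⟩ := exists_one_le_nat_add_pos a
  obtain ⟨C, hC0, hC⟩ := exists_pairing_dyadic_le hφ hφ1 hr1 hra hp
  refine ⟨C * 2 ^ (d + 1), by positivity, fun ξ e he hen M N hN x hx => ?_⟩
  set e' : ℝ≥0 := ⟨(2 * ((M : ℝ) + 1)) ^ (d + 1) * e, by positivity⟩
  have he' : (e' : ℝ) = (2 * ((M : ℝ) + 1)) ^ (d + 1) * e := rfl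
  have h := hC ξ N x e' fun n hn => ?_
  · refine h.trans_eq ?_
    rw [he', mul_pow]
    ring
  have hball : Metric.closedBall x (2 * ((2 : ℝ) ^ N)⁻¹) ⊆
      Metric.closedBall 0 ((M : ℝ) + 1) := by
    refine Metric.closedBall_subset_closedBall' ?_
    rw [dist_zero_right]
    have h1 : (2 : ℝ) * (2 ^ N)⁻¹ ≤ 1 := by
      rw [← div_eq_mul_inv, div_le_one (by positivity)]
      exact le_self_pow₀ (by norm_num) (by omega)
    linarith
  have hmeas : Measurable fun y => ‖ξ (dyadic φ n y)‖ₑ ^ p :=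
    ((continuous_pairing_dyadic φ ξ n).measurable.enorm).pow_const p
  obtain ⟨m, rfl⟩ : ∃ m, n = m + 1 := ⟨n - 1, by omega⟩
  have hterm : ∫⁻ y, ‖ξ (dyadic φ (m + 1) y)‖ₑ ^ p ∂(weight d) ≤
      ENNReal.ofReal ((2 : ℝ) ^ (-((m + 1 : ℕ) : ℝ) * a * p)) * ENNReal.ofReal (e ^ p) := by
    have h2 := (ENNReal.le_tsum (f := fun n : ℕ =>
      ENNReal.ofReal ((2 : ℝ) ^ (((n + 1 : ℕ) : ℝ) * a * p)) *
        ∫⁻ y, ‖ξ (dyadic φ (n + 1) y)‖ₑ ^ p ∂(weight d)) m).trans hen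
    have h3 := mul_le_mul_right h2 (ENNReal.ofReal ((2 : ℝ) ^ (-((m + 1 : ℕ) : ℝ) * a * p)))
    rw [← mul_assoc, ← ENNReal.ofReal_mul (by positivity), ← Real.rpow_add (by norm_num)] at h3
    have h4 : -((m + 1 : ℕ) : ℝ) * a * p + ((m + 1 : ℕ) : ℝ) * a * p = 0 := by ring
    rwa [h4, Real.rpow_zero, ENNReal.ofReal_one, one_mul] at h3
  refine (lintegral_mono_set hball).trans ((setLIntegral_closedBall_le _ hmeas
    (by positivity)).trans ((mul_le_mul_right hterm _).trans ?_))
  rw [← ENNReal.ofReal_mul (by positivity), ← ENNReal.ofReal_mul (by positivity)]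
  refine ENNReal.ofReal_le_ofReal ?_
  rw [he', Real.mul_rpow (by positivity) he]
  have h5 : (1 + ((M : ℝ) + 1)) ^ (d + 1) ≤ ((2 * ((M : ℝ) + 1)) ^ (d + 1)) ^ p := by
    have h6 : (1 : ℝ) ≤ (2 * ((M : ℝ) + 1)) ^ (d + 1) :=
      one_le_pow₀ (by linarith [(Nat.cast_nonneg M : (0 : ℝ) ≤ M)])
    refine le_trans ?_ (Real.self_le_rpow_of_one_le h6 hp)
    gcongr
    linarith [(Nat.cast_nonneg M : (0 : ℝ) ≤ M)]
  have h7 := mul_le_mul_of_nonneg_right h5 (show 0 ≤ (2 : ℝ) ^ (-((m + 1 : ℕ) : ℝ) * a * p) *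
    e ^ p by positivity)
  linarith

section Random

variable {Ω : Type*} [MeasurableSpace Ω]

theorem IsRandomDistr.sub {ζ ζ' : Ω → Distr d} (h : IsRandomDistr ζ) (h' : IsRandomDistr ζ') :
    IsRandomDistr fun ω => ζ ω - ζ' ω := fun η => (h η).sub (h' η)

theorem IsRandomDistr.measurable_uncurry {ζ : Ω → Distr d} (h : IsRandomDistr ζ) (φ : Test d)
    (n : ℕ) : Measurable (Function.uncurry fun (y : Space d) ω => ζ ω (dyadic φ n y)) :=
  (stronglyMeasurable_uncurry_of_continuous_of_stronglyMeasurable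
    (fun ω => continuous_pairing_dyadic φ (ζ ω) n) fun _ => (h _).stronglyMeasurable).measurable

theorem IsRandomDistr.measurable_energy {ζ : Ω → Distr d} (h : IsRandomDistr ζ) (φ : Test d)
    (p a : ℝ) : Measurable fun ω => energy φ p a (ζ ω) := by
  unfold energy
  refine Measurable.tsum fun n => Measurable.const_mul ?_ _
  exact ((h.measurable_uncurry φ (n + 1)).enorm.pow_const p).lintegral_prod_left'

theorem eLpNorm_pairing_le (P : Measure Ω) (φ : Test d) (p α₀ : ℝ) (ζ : Ω → Distr d) {n : ℕ}
    (hn : 1 ≤ n) (x : Space d) : eLpNorm (fun ω => ζ ω (dyadic φ n x)) (ENNReal.ofReal p) P ≤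
      momentNorm P φ p α₀ ζ * ENNReal.ofReal ((2 : ℝ) ^ (-(n : ℝ) * α₀)) := by
  have h0 : ENNReal.ofReal ((2 : ℝ) ^ (-(n : ℝ) * α₀)) ≠ 0 :=
    (ENNReal.ofReal_pos.2 (by positivity)).ne'
  rw [← ENNReal.div_le_iff h0 ENNReal.ofReal_ne_top]
  refine le_sInf fun C hC => ?_
  rw [ENNReal.div_le_iff h0 ENNReal.ofReal_ne_top]
  exact (hC n hn).1 x

/-- A gain in the exponent of the scale makes the expected energy finite. -/
theorem exists_lintegral_energy_le (d : ℕ) {p a α₀ : ℝ} (hp : 0 < p) (ha : a < α₀) :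
    ∃ C : ℝ≥0∞, C ≠ ⊤ ∧ ∀ {Ω : Type*} [MeasurableSpace Ω] (P : Measure Ω) [SFinite P]
      (φ : Test d) (ζ : Ω → Distr d), IsRandomDistr ζ →
      ∫⁻ ω, energy φ p a (ζ ω) ∂P ≤ C * momentNorm P φ p α₀ ζ ^ p := by
  set q : ℝ := (2 : ℝ) ^ ((a - α₀) * p)
  have hq0 : 0 < q := by positivity
  have hq1 : q < 1 := Real.rpow_lt_one_of_one_lt_of_neg one_lt_two
    (mul_neg_of_neg_of_pos (by linarith) hp)
  refine ⟨(∑' n : ℕ, ENNReal.ofReal (q ^ (n + 1))) * weight d Set.univ,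
    ENNReal.mul_ne_top ?_ (measure_ne_top _ _), ?_⟩
  · exact ((summable_nat_add_iff (f := fun n => q ^ n) 1).2
      (summable_geometric_of_lt_one hq0.le hq1)).tsum_ofReal_ne_top
  intro Ω _ P _ φ ζ hζ
  have hm : ∀ n : ℕ, Measurable fun ω => ∫⁻ y, ‖ζ ω (dyadic φ (n + 1) y)‖ₑ ^ p ∂(weight d) :=
    fun n => ((hζ.measurable_uncurry φ (n + 1)).enorm.pow_const p).lintegral_prod_left'
  unfold energy
  rw [lintegral_tsum fun n => ((hm n).const_mul _).aemeasurable, mul_assoc,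
    ← ENNReal.tsum_mul_right]
  refine ENNReal.tsum_le_tsum fun n => ?_
  have hswap : ∫⁻ ω, ∫⁻ y, ‖ζ ω (dyadic φ (n + 1) y)‖ₑ ^ p ∂(weight d) ∂P =
      ∫⁻ y, ∫⁻ ω, ‖ζ ω (dyadic φ (n + 1) y)‖ₑ ^ p ∂P ∂(weight d) :=
    lintegral_lintegral_swap
      (((hζ.measurable_uncurry φ (n + 1)).enorm.pow_const p).comp measurable_swap).aemeasurable
  rw [lintegral_const_mul _ (hm n), hswap]
  have hpt : ∀ y, ∫⁻ ω, ‖ζ ω (dyadic φ (n + 1) y)‖ₑ ^ p ∂P ≤ momentNorm P φ p α₀ ζ ^ p *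
      ENNReal.ofReal ((2 : ℝ) ^ (-((n + 1 : ℕ) : ℝ) * α₀ * p)) := fun y => by
    have h1 := ENNReal.rpow_le_rpow
      (eLpNorm_pairing_le P φ p α₀ ζ (Nat.le_add_left 1 n) y) hp.le
    rw [eLpNorm_eq_lintegral_rpow_enorm_toReal (by simpa using hp) ENNReal.ofReal_ne_top,
      ENNReal.toReal_ofReal hp.le, ← ENNReal.rpow_mul, one_div, inv_mul_cancel₀ hp.ne',
      ENNReal.rpow_one, ENNReal.mul_rpow_of_nonneg _ _ hp.le,
      ENNReal.ofReal_rpow_of_nonneg (by positivity) hp.le, ← Real.rpow_mul (by norm_num)] at h1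
    exact h1
  refine (mul_le_mul_right (lintegral_mono hpt) _).trans_eq ?_
  have h2 : (2 : ℝ) ^ (((n + 1 : ℕ) : ℝ) * a * p + -((n + 1 : ℕ) : ℝ) * α₀ * p) = q ^ (n + 1) := by
    rw [← Real.rpow_mul_natCast (by norm_num)]
    congr 1
    ring
  rw [lintegral_const, ← h2, Real.rpow_add (by norm_num), ENNReal.ofReal_mul (by positivity)]
  ring

end Random

/-! ### Energies of processes -/

/-- The energy of a path along the dyadic times: the `p`-th power of a Besov norm in time
with values in a Besov space. -/
def processEnergy (φ : Test d) (p a γ : ℝ) (T : ℝ≥0) (ζ : ℝ≥0 → Distr d) : ℝ≥0∞ :=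
  energy φ p a (ζ 0) + ∑' j : ℕ, ENNReal.ofReal ((2 : ℝ) ^ ((j : ℝ) * γ * p)) *
    ∑ i ∈ Finset.range (2 ^ j), energy φ p a (ζ (gridPoint T j (i + 1)) - ζ (gridPoint T j i))

/-- Paths of finite energy satisfy, in the limit along the dyadic times, a bound of the order of
the `p`-th root of the energy. -/
theorem exists_path_of_processEnergy_le {φ : Test d} (hφ : ∀ w, 1 ≤ ‖w‖ → φ w = 0)
    (hφ1 : ∫ w, φ w = 1) (a : ℝ) {p : ℝ} (hp : 1 ≤ p) {T : ℝ≥0} (hT : 0 < T) {γ : ℝ}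
    (hγ : 0 < γ) :
    ∃ C : ℝ, 0 ≤ C ∧ ∀ (ζ : ℝ≥0 → Distr d) (e : ℝ), 0 ≤ e →
      processEnergy φ p a γ T ζ ≤ ENNReal.ofReal (e ^ p) →
      ∃ L : Set.Icc (0 : ℝ≥0) T → Distr d, PathBound φ (a - d / p) γ (C * e) (d + 1) L ∧
        ∀ (t : Set.Icc (0 : ℝ≥0) T) (η : Test d),
          Tendsto (fun j => ζ (gridFloor T j t) η) atTop (𝓝 (L t η)) := by
  have hp0 : 0 < p := by linarith
  obtain ⟨C, hC0, hC⟩ := exists_growthBound_of_energy_le hφ hφ1 a hp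
  obtain ⟨D, hD0, hD⟩ := exists_path_of_grid hφ hφ1 (a - d / p) hT hγ
  refine ⟨D * C, by positivity, fun ζ e he hen => ?_⟩
  rw [mul_assoc]
  refine hD ζ (C * e) (d + 1) (by positivity)
    (hC (ζ 0) e he (le_self_add.trans hen)) fun j i hi M => ?_
  have h1 : ENNReal.ofReal ((2 : ℝ) ^ ((j : ℝ) * γ * p)) *
      energy φ p a (ζ (gridPoint T j (i + 1)) - ζ (gridPoint T j i)) ≤ ENNReal.ofReal (e ^ p) := by
    refine le_trans ?_ (le_add_self.trans hen)
    refine le_trans ?_ (ENNReal.le_tsum j)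
    exact mul_le_mul_right (Finset.single_le_sum
      (f := fun i => energy φ p a (ζ (gridPoint T j (i + 1)) - ζ (gridPoint T j i)))
      (fun _ _ => zero_le) (Finset.mem_range.2 hi)) _
  have h2 := mul_le_mul_right h1 (ENNReal.ofReal ((2 : ℝ) ^ (-(j : ℝ) * γ * p)))
  rw [← mul_assoc, ← ENNReal.ofReal_mul (by positivity), ← Real.rpow_add (by norm_num),
    show -(j : ℝ) * γ * p + (j : ℝ) * γ * p = 0 by ring, Real.rpow_zero, ENNReal.ofReal_one,
    one_mul, ← ENNReal.ofReal_mul (by positivity), Real.rpow_mul (by norm_num),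
    ← Real.mul_rpow (by positivity) he] at h2
  refine (hC _ _ (by positivity) h2 M).mono le_rfl le_rfl (le_of_eq ?_) (by positivity)
  ring

/-- Every path of finite energy along the dyadic times extends to a Hölder path. The paths of
infinite energy are sent to the origin. -/
theorem exists_holderPath_of_processEnergy {φ : Test d} (hφ : ∀ w, 1 ≤ ‖w‖ → φ w = 0)
    (hφ1 : ∫ w, φ w = 1) {a p α : ℝ} (hp : 1 ≤ p) (hα : α < a - d / p) (ha : a - d / p ≤ 0)
    {γ T : ℝ≥0} (hT : 0 < T) {γ' : ℝ} (hγ' : 0 < γ') (hγ : γ ≤ γ') :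
    ∃ C : ℝ, 0 ≤ C ∧ ∀ ζ : ℝ≥0 → Distr d, ∃ f : HolderPath d α γ T,
      (∀ e : ℝ, 0 ≤ e → processEnergy φ p a γ' T ζ ≤ ENNReal.ofReal (e ^ p) →
        PathBound φ (a - d / p) γ' (C * e) (d + 1) fun t => (f.toFun t).toDistr) ∧
      (processEnergy φ p a γ' T ζ < ⊤ → ∀ (t : Set.Icc (0 : ℝ≥0) T) (η : Test d),
        Tendsto (fun j => ζ (gridFloor T j t) η) atTop (𝓝 ((f.toFun t).toDistr η))) ∧
      (processEnergy φ p a γ' T ζ = ⊤ → ∀ t, (f.toFun t).toDistr = 0) := by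
  have hp0 : 0 < p := by linarith
  obtain ⟨C, hC0, hC⟩ := exists_path_of_processEnergy_le hφ hφ1 a hp hT hγ'
  refine ⟨C, hC0, fun ζ => ?_⟩
  rcases eq_top_or_lt_top (processEnergy φ p a γ' T ζ) with h | h
  · obtain ⟨f, hf⟩ := exists_holderPath (γ := γ) (γ' := γ') (T := T) hφ hφ1 (hα.trans_le ha) hα ha
      hγ (le_refl (0 : ℝ)) (k := 0) (ζ := fun _ => 0) fun M =>
        ⟨fun t => growthBound_zero φ _ _ (by simp),
          fun s t => by rw [sub_self]; exact growthBound_zero φ _ _ (by simp)⟩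
    refine ⟨f, fun e _ he => ?_, fun h' => absurd h h'.ne, fun _ => hf⟩
    rw [h, top_le_iff] at he
    exact absurd he ENNReal.ofReal_ne_top
  · have hroot : processEnergy φ p a γ' T ζ ≤
        ENNReal.ofReal (((processEnergy φ p a γ' T ζ).toReal ^ p⁻¹) ^ p) := by
      rw [← Real.rpow_mul ENNReal.toReal_nonneg, inv_mul_cancel₀ hp0.ne', Real.rpow_one,
        ENNReal.ofReal_toReal h.ne]
    obtain ⟨L, hL, hL'⟩ := hC ζ _ (by positivity) hroot
    obtain ⟨f, hf⟩ := exists_holderPath hφ hφ1 (hα.trans_le ha) hα ha hγ (by positivity) hL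
    have hfL : (fun t => (f.toFun t).toDistr) = L := funext hf
    refine ⟨f, fun e he hen => ?_, fun _ t η => ?_, fun h' => absurd h' h.ne⟩
    · obtain ⟨L₁, hL₁, hL₁'⟩ := hC ζ e he hen
      have hLL : L = L₁ := funext fun t => by
        ext η
        exact tendsto_nhds_unique (hL' t η) (hL₁' t η)
      rw [hfL, hLL]
      exact hL₁
    · rw [hf]
      exact hL' t η

section Random

variable {Ω : Type*} [MeasurableSpace Ω]

theorem measurable_processEnergy {ζ : ℝ≥0 → Ω → Distr d} (h : ∀ t, IsRandomDistr (ζ t))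
    (φ : Test d) (p a γ : ℝ) (T : ℝ≥0) :
    Measurable fun ω => processEnergy φ p a γ T fun t => ζ t ω := by
  unfold processEnergy
  refine ((h 0).measurable_energy φ p a).add (Measurable.tsum fun j =>
    Measurable.const_mul (Finset.measurable_sum _ fun i _ => ?_) _)
  exact ((h _).sub (h _)).measurable_energy φ p a

theorem momentNorm_le_processNorm (P : Measure Ω) (φ : Test d) (p γ₀ α₀ : ℝ)
    (ζ : ℝ≥0 → Ω → Distr d) (t : ℝ≥0) :
    momentNorm P φ p α₀ (ζ t) ≤ processNorm P φ p γ₀ α₀ ζ :=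
  (le_iSup (fun t => momentNorm P φ p α₀ (ζ t)) t).trans le_self_add

theorem momentNorm_sub_le (P : Measure Ω) (φ : Test d) (p : ℝ) {γ₀ : ℝ} (hγ₀ : 0 ≤ γ₀) (α₀ : ℝ)
    (ζ : ℝ≥0 → Ω → Distr d) {s t : ℝ≥0} (hst : s ≠ t) :
    momentNorm P φ p α₀ (fun ω => ζ t ω - ζ s ω) ≤
      processNorm P φ p γ₀ α₀ ζ * ENNReal.ofReal (dist s t ^ γ₀) := by
  have h1 : momentNorm P φ p α₀ (fun ω => ζ t ω - ζ s ω) / edist s t ^ γ₀ ≤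
      processNorm P φ p γ₀ α₀ ζ :=
    (le_iSup_of_le s (le_iSup_of_le t (le_iSup
      (fun _ : s ≠ t => momentNorm P φ p α₀ (fun ω => ζ t ω - ζ s ω) / edist s t ^ γ₀) hst))).trans
      le_add_self
  have h2 : edist s t ^ γ₀ = ENNReal.ofReal (dist s t ^ γ₀) := by
    rw [edist_dist, ENNReal.ofReal_rpow_of_nonneg dist_nonneg hγ₀]
  rw [h2, ENNReal.div_le_iff
    (ENNReal.ofReal_pos.2 (Real.rpow_pos_of_pos (dist_pos.2 hst) _)).ne'
    ENNReal.ofReal_ne_top] at h1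
  exact h1

theorem dist_gridPoint_succ (T : ℝ≥0) (j i : ℕ) :
    dist (gridPoint T j i) (gridPoint T j (i + 1)) = T * 2⁻¹ ^ j := by
  rw [NNReal.dist_eq, abs_sub_comm]
  simp only [gridPoint]
  push_cast
  rw [abs_of_nonneg]
  · rw [inv_pow]
    ring
  · rw [← mul_sub, ← sub_div, add_sub_cancel_left]
    positivity

/-- The gain `γ < γ₀ - 1/p` compensates for the number `2^j` of edges of each subdivision. -/
theorem exists_lintegral_processEnergy_le (d : ℕ) {p a α₀ γ γ₀ : ℝ} (hp : 0 < p) (ha : a < α₀)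
    (hγ₀ : 0 ≤ γ₀) (hγ : γ < γ₀ - 1 / p) {T : ℝ≥0} (hT : 0 < T) :
    ∃ C : ℝ≥0∞, C ≠ ⊤ ∧ ∀ {Ω : Type*} [MeasurableSpace Ω] (P : Measure Ω) [SFinite P]
      (φ : Test d) (ζ : ℝ≥0 → Ω → Distr d), (∀ t, IsRandomDistr (ζ t)) →
      ∫⁻ ω, processEnergy φ p a γ T (fun t => ζ t ω) ∂P ≤ C * processNorm P φ p γ₀ α₀ ζ ^ p := by
  obtain ⟨C, hC, hCE⟩ := exists_lintegral_energy_le d hp ha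
  set q : ℝ := (2 : ℝ) ^ (γ * p + 1 - γ₀ * p)
  have hq0 : 0 < q := by positivity
  have hq1 : q < 1 := by
    refine Real.rpow_lt_one_of_one_lt_of_neg one_lt_two ?_
    have h := mul_lt_mul_of_pos_right hγ hp
    rw [sub_mul, one_div, inv_mul_cancel₀ hp.ne'] at h
    linarith
  refine ⟨C + (∑' j : ℕ, ENNReal.ofReal (q ^ j)) * (C * ENNReal.ofReal ((T : ℝ) ^ (γ₀ * p))),
    ENNReal.add_ne_top.2 ⟨hC, ENNReal.mul_ne_top
      (summable_geometric_of_lt_one hq0.le hq1).tsum_ofReal_ne_top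
      (ENNReal.mul_ne_top hC ENNReal.ofReal_ne_top)⟩, ?_⟩
  intro Ω _ P _ φ ζ hζ
  have hm : ∀ j i, Measurable fun ω =>
      energy φ p a (ζ (gridPoint T j (i + 1)) ω - ζ (gridPoint T j i) ω) := fun j i =>
    ((hζ _).sub (hζ _)).measurable_energy φ p a
  have hms : ∀ j : ℕ, Measurable fun ω => ∑ i ∈ Finset.range (2 ^ j),
      energy φ p a (ζ (gridPoint T j (i + 1)) ω - ζ (gridPoint T j i) ω) := fun j =>
    Finset.measurable_sum _ fun i _ => hm j i
  unfold processEnergy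
  rw [lintegral_add_left ((hζ 0).measurable_energy φ p a), add_mul]
  refine add_le_add ?_ ?_
  · refine (hCE P φ (ζ 0) (hζ 0)).trans (mul_le_mul_right ?_ C)
    exact ENNReal.rpow_le_rpow (momentNorm_le_processNorm P φ p γ₀ α₀ ζ 0) hp.le
  rw [lintegral_tsum fun j => ((hms j).const_mul _).aemeasurable, mul_assoc,
    ← ENNReal.tsum_mul_right]
  refine ENNReal.tsum_le_tsum fun j => ?_
  rw [lintegral_const_mul _ (hms j), lintegral_finsetSum _ fun i _ => hm j i]
  have hterm : ∀ i ∈ Finset.range (2 ^ j),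
      ∫⁻ ω, energy φ p a (ζ (gridPoint T j (i + 1)) ω - ζ (gridPoint T j i) ω) ∂P ≤
      C * (processNorm P φ p γ₀ α₀ ζ ^ p *
        ENNReal.ofReal ((T : ℝ) ^ (γ₀ * p) * (2 : ℝ) ^ (-(j : ℝ) * γ₀ * p))) := fun i _ => by
    have hne : gridPoint T j i ≠ gridPoint T j (i + 1) := by
      rw [← dist_pos, dist_gridPoint_succ]
      have hT' : (0 : ℝ) < T := hT
      positivity
    refine (hCE P φ _ ((hζ _).sub (hζ _))).trans (mul_le_mul_right ?_ C)
    refine (ENNReal.rpow_le_rpow (momentNorm_sub_le P φ p hγ₀ α₀ ζ hne) hp.le).trans_eq ?_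
    rw [ENNReal.mul_rpow_of_nonneg _ _ hp.le, ENNReal.ofReal_rpow_of_nonneg (by positivity) hp.le,
      dist_gridPoint_succ, Real.mul_rpow T.coe_nonneg (by positivity),
      Real.mul_rpow (by positivity) (by positivity), ← Real.rpow_mul T.coe_nonneg,
      ← Real.rpow_natCast, ← Real.rpow_mul (by norm_num), ← Real.rpow_mul (by norm_num),
      Real.inv_rpow (by norm_num), ← Real.rpow_neg (by norm_num)]
    congr 4
    ring
  refine (mul_le_mul_right (Finset.sum_le_sum hterm) _).trans_eq ?_
  rw [Finset.sum_const, Finset.card_range, nsmul_eq_mul, Nat.cast_pow, Nat.cast_ofNat]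
  have h2 : (2 : ℝ≥0∞) ^ j = ENNReal.ofReal ((2 : ℝ) ^ (j : ℝ)) := by
    rw [Real.rpow_natCast, ENNReal.ofReal_pow (by norm_num), ENNReal.ofReal_ofNat]
  have h3 : q ^ j = (2 : ℝ) ^ ((j : ℝ) * γ * p) * (2 : ℝ) ^ (j : ℝ) *
      (2 : ℝ) ^ (-(j : ℝ) * γ₀ * p) := by
    rw [← Real.rpow_mul_natCast (by norm_num), ← Real.rpow_add (by norm_num),
      ← Real.rpow_add (by norm_num)]
    congr 1
    ring
  rw [h2, h3, ENNReal.ofReal_mul (by positivity), ENNReal.ofReal_mul (by positivity),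
    ENNReal.ofReal_mul (by positivity)]
  ring

/-- The process is continuous in probability, so it agrees almost surely with the limit along the
dyadic times. -/
theorem ae_eq_of_tendsto_gridFloor (P : Measure Ω) {φ : Test d}
    (hφ : ∀ w, 1 ≤ ‖w‖ → φ w = 0) (hφ1 : ∫ w, φ w = 1) {p γ₀ α₀ : ℝ} (hp : 0 < p) (hγ₀ : 0 < γ₀)
    {ζ : ℝ≥0 → Ω → Distr d} (hζ : ∀ t, IsRandomDistr (ζ t))
    (hfin : processNorm P φ p γ₀ α₀ ζ ≠ ⊤) {T : ℝ≥0} (hT : 0 < T) (t : ℝ≥0) {L : Ω → Distr d}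
    (hL : ∀ᵐ ω ∂P, ∀ η : Test d, Tendsto (fun j => ζ (gridFloor T j t) ω η) atTop (𝓝 (L ω η))) :
    ∀ᵐ ω ∂P, L ω = ζ t ω := by
  obtain ⟨B, hBc, hB⟩ := TopologicalSpace.exists_countable_dense (Space d)
  have : Countable B := hBc.to_subtype
  have hae : ∀ᵐ ω ∂P, ∀ (n : ℕ) (y : B),
      L ω (dyadic φ (n + 1) y) = ζ t ω (dyadic φ (n + 1) y) := by
    rw [ae_all_iff]
    intro n
    rw [ae_all_iff]
    intro y
    set η := dyadic φ (n + 1) (y : Space d)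
    have hbound : ∀ j, eLpNorm ((fun ω => ζ (gridFloor T j t) ω η) - fun ω => ζ t ω η)
        (ENNReal.ofReal p) P ≤ processNorm P φ p γ₀ α₀ ζ *
          ENNReal.ofReal (dist (gridFloor T j t) t ^ γ₀) *
          ENNReal.ofReal ((2 : ℝ) ^ (-((n + 1 : ℕ) : ℝ) * α₀)) := fun j => by
      by_cases hjt : gridFloor T j t = t
      · rw [hjt, sub_self, eLpNorm_zero]
        exact zero_le
      · refine (eLpNorm_pairing_le P φ p α₀ (fun ω => ζ (gridFloor T j t) ω - ζ t ω)
          (Nat.le_add_left 1 n) y).trans (mul_le_mul_left ?_ _)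
        rw [dist_comm]
        exact momentNorm_sub_le P φ p hγ₀.le α₀ ζ (Ne.symm hjt)
    have hlim : Tendsto (fun j => eLpNorm ((fun ω => ζ (gridFloor T j t) ω η) - fun ω => ζ t ω η)
        (ENNReal.ofReal p) P) atTop (𝓝 0) := by
      refine tendsto_of_tendsto_of_tendsto_of_le_of_le tendsto_const_nhds ?_ (fun _ => zero_le)
        hbound
      have h1 : Tendsto (fun j => dist (gridFloor T j t) t ^ γ₀) atTop (𝓝 0) := by
        have h := (tendsto_iff_dist_tendsto_zero.1 (tendsto_gridFloor hT t)).rpow_const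
          (p := γ₀) (Or.inr hγ₀.le)
        rwa [Real.zero_rpow hγ₀.ne'] at h
      have h2 := ENNReal.tendsto_ofReal h1
      rw [ENNReal.ofReal_zero] at h2
      have h3 := ENNReal.Tendsto.mul_const (ENNReal.Tendsto.const_mul h2 (Or.inr hfin))
        (Or.inr (ENNReal.ofReal_ne_top (r := (2 : ℝ) ^ (-((n + 1 : ℕ) : ℝ) * α₀))))
      rwa [mul_zero, zero_mul] at h3
    obtain ⟨ns, hns, hns'⟩ := (tendstoInMeasure_of_tendsto_eLpNorm
      (by simpa using hp) (fun j => (hζ (gridFloor T j t) η).aestronglyMeasurable)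
      (hζ t η).aestronglyMeasurable hlim).exists_seq_tendsto_ae
    filter_upwards [hL, hns'] with ω h1 h2
    exact tendsto_nhds_unique ((h1 η).comp hns.tendsto_atTop) h2
  filter_upwards [hae] with ω hω
  refine eq_of_pairing_dyadic_eq hφ hφ1 fun n hn => ?_
  obtain ⟨m, rfl⟩ : ∃ m, n = m + 1 := ⟨n - 1, by omega⟩
  exact congrFun (Continuous.ext_on hB (continuous_pairing_dyadic φ _ _)
    (continuous_pairing_dyadic φ _ _) fun y hy => hω m ⟨y, hy⟩)

end Random

/-! ### Tightness -/

/-- Compact sets and bounds in expectation give tightness, through Markov's inequality. -/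
theorem isTightMeasureSet_range_map {ι : Type*} {Ω : ι → Type*} [∀ k, MeasurableSpace (Ω k)]
    {P : ∀ k, Measure (Ω k)} {X : Type*} [TopologicalSpace X] [R1Space X] [MeasurableSpace X]
    [BorelSpace X] {Z : ∀ k, Ω k → X} (hZ : ∀ k, Measurable (Z k))
    {V : ∀ k, Ω k → ℝ≥0∞} (hV : ∀ k, Measurable (V k)) {C : ℝ≥0∞} (hC : C ≠ ⊤)
    (hVC : ∀ k, ∫⁻ ω, V k ω ∂(P k) ≤ C) {p : ℝ} (hp : 0 < p) {K : ℕ → Set X}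
    (hK : ∀ j, IsCompact (K j))
    (hVK : ∀ k ω (j : ℕ), V k ω ≤ ENNReal.ofReal ((j : ℝ) ^ p) → Z k ω ∈ K j) :
    IsTightMeasureSet (Set.range fun k => (P k).map (Z k)) := by
  rw [isTightMeasureSet_iff_exists_isCompact_measure_compl_le]
  intro ε hε
  have hlim : Tendsto (fun j : ℕ => C / ENNReal.ofReal ((j : ℝ) ^ p)) atTop (𝓝 0) := by
    have h := ENNReal.tendsto_ofReal_atTop.comp
      ((tendsto_rpow_atTop hp).comp tendsto_natCast_atTop_atTop)
    have h1 := ENNReal.Tendsto.const_div h (a := C) (Or.inr hC)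
    rwa [ENNReal.div_top] at h1
  obtain ⟨j, hj, hj1⟩ := ((hlim.eventually_le_const hε).and (eventually_ge_atTop 1)).exists
  refine ⟨closure (K j), (hK j).closure, ?_⟩
  rintro _ ⟨k, rfl⟩
  rw [Measure.map_apply (hZ k) isClosed_closure.measurableSet.compl]
  have hj0 : 0 < ENNReal.ofReal ((j : ℝ) ^ p) := by
    rw [ENNReal.ofReal_pos]
    exact Real.rpow_pos_of_pos (by exact_mod_cast hj1) _
  calc P k (Z k ⁻¹' (closure (K j))ᶜ)
      ≤ P k {ω | ENNReal.ofReal ((j : ℝ) ^ p) ≤ V k ω} := by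
        refine measure_mono fun ω hω => ?_
        by_contra h
        exact hω (subset_closure (hVK k ω j (not_le.1 h).le))
    _ ≤ (∫⁻ ω, V k ω ∂(P k)) / ENNReal.ofReal ((j : ℝ) ^ p) :=
        meas_ge_le_lintegral_div (hV k).aemeasurable hj0.ne' ENNReal.ofReal_ne_top
    _ ≤ C / ENNReal.ofReal ((j : ℝ) ^ p) := ENNReal.div_le_div_right (hVC k) _
    _ ≤ ε := hj

end

end RandomDistribution

open RandomDistribution Filter Topology

theorem proposition4p7 {d : ℕ} (hd : 1 ≤ d)
    (φ : RandomDistribution.Test d) (hφ_supp : tsupport φ ⊆ Metric.ball 0 1)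
    (hφ_int : ∫ y, φ y = 1)
    {ι : Type*} {Ω : ι → Type*} [∀ k, MeasurableSpace (Ω k)]
    (P : ∀ k, Measure (Ω k)) [∀ k, IsProbabilityMeasure (P k)]
    (ζ : ∀ k, ℝ≥0 → Ω k → RandomDistribution.Distr d)
    (hζ : ∀ k t, RandomDistribution.IsRandomDistr (ζ k t))
    (p α₀ γ₀ : ℝ) (hα₀ : α₀ < 0) (hp : (d : ℝ) < p) (hγ₀ : 1 / p < γ₀)
    (hbdd : (⨆ k, RandomDistribution.processNorm (P k) φ p γ₀ α₀ (ζ k)) < ⊤)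
    (T : ℝ≥0) (hT : 0 < T) (α : ℝ) (hα : α < α₀ - d / p)
    (γ : ℝ≥0) (hγ_pos : 0 < γ) (hγ : (γ : ℝ) < γ₀ - 1 / p) :
    ∃ Z : ∀ k, Ω k → RandomDistribution.HolderPath d α γ T,
      (∀ k, Measurable (Z k)) ∧
      (∀ k, ∀ t : Set.Icc (0 : ℝ≥0) T,
        ∀ᵐ ω ∂(P k), ((Z k ω).toFun t).toDistr = ζ k t ω) ∧
      IsTightMeasureSet (Set.range fun k => (P k).map (Z k)) := by
  have hφ := apply_eq_zero_of_tsupport_subset hφ_supp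
  have hp1 : 1 ≤ p := by
    have h : (1 : ℝ) ≤ d := by exact_mod_cast hd
    linarith
  have hp0 : 0 < p := by linarith
  have hγ₀0 : 0 < γ₀ := (one_div_pos.2 hp0).trans hγ₀
  have hdp : 0 ≤ (d : ℝ) / p := by positivity
  -- intermediate exponents: half of the gaps serves the expectation, half the compactness
  obtain ⟨a, ha, ha₀⟩ := exists_between (show α + d / p < α₀ by linarith)
  have hαa : α < a - d / p := by linarith
  have ha0 : a - d / p ≤ 0 := by linarith
  obtain ⟨γ', hγγ', hγ'₀⟩ := exists_between hγ
  have hγ' : 0 < γ' := γ.coe_nonneg.trans_lt hγγ'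
  obtain ⟨D, hD0, hD⟩ := exists_holderPath_of_processEnergy (α := α) (γ := γ) hφ hφ_int hp1 hαa ha0
    hT hγ' hγγ'.le
  obtain ⟨C, hC, hCE⟩ := exists_lintegral_processEnergy_le d hp0 ha₀ hγ₀0.le hγ'₀ hT
  choose f hf_bound hf_lim hf_top using hD
  set V : ∀ k, Ω k → ℝ≥0∞ := fun k ω => processEnergy φ p a γ' T fun t => ζ k t ω
  have hV : ∀ k, Measurable (V k) := fun k => measurable_processEnergy (hζ k) φ p a γ' T
  have hle : ∀ k, processNorm (P k) φ p γ₀ α₀ (ζ k) ≤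
      ⨆ k, processNorm (P k) φ p γ₀ α₀ (ζ k) := le_iSup _
  have hVC : ∀ k, ∫⁻ ω, V k ω ∂(P k) ≤ C * (⨆ k, processNorm (P k) φ p γ₀ α₀ (ζ k)) ^ p :=
    fun k => (hCE (P k) φ (ζ k) (hζ k)).trans
      (mul_le_mul_right (ENNReal.rpow_le_rpow (hle k) hp0.le) C)
  have hfin : C * (⨆ k, processNorm (P k) φ p γ₀ α₀ (ζ k)) ^ p ≠ ⊤ :=
    ENNReal.mul_ne_top hC (ENNReal.rpow_ne_top_of_nonneg hp0.le hbdd.ne)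
  set K : ℕ → Set (HolderPath d α γ T) := fun j =>
    {f | PathBound φ (a - d / p) γ' (D * j) (d + 1) fun t => (f.toFun t).toDistr}
  have hK : ∀ j, IsCompact (K j) := fun j =>
    isCompact_setOf_pathBound hφ hφ_int hαa ha0 hγ_pos hγγ' (by positivity) (d + 1)
  set Z : ∀ k, Ω k → HolderPath d α γ T := fun k ω => f fun t => ζ k t ω
  have hVK : ∀ k ω (j : ℕ), V k ω ≤ ENNReal.ofReal ((j : ℝ) ^ p) → Z k ω ∈ K j :=
    fun k ω j h => hf_bound _ j (Nat.cast_nonneg j) h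
  have hcover : ∀ k ω, ∃ j, Z k ω ∈ K j := fun k ω => by
    rcases eq_top_or_lt_top (V k ω) with h | h
    · have h0 : (fun t => ((Z k ω).toFun t).toDistr) = fun _ => 0 := funext (hf_top _ h)
      refine ⟨0, ?_⟩
      change PathBound φ _ _ _ _ fun t => ((Z k ω).toFun t).toDistr
      rw [h0]
      refine fun M => ⟨fun t => growthBound_zero φ _ _ (by positivity), fun s t => ?_⟩
      rw [sub_self]
      exact growthBound_zero φ _ _ (by positivity)
    · obtain ⟨j, hj⟩ := exists_nat_gt (V k ω).toReal
      obtain ⟨i, hi⟩ := exists_nat_gt ((j : ℝ) ^ p⁻¹)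
      refine ⟨i, hVK k ω i ?_⟩
      rw [← ENNReal.ofReal_toReal h.ne]
      refine ENNReal.ofReal_le_ofReal (hj.le.trans ?_)
      have h1 := Real.rpow_le_rpow (by positivity) hi.le hp0.le
      rwa [← Real.rpow_mul (by positivity), inv_mul_cancel₀ hp0.ne', Real.rpow_one] at h1
  have hZr : ∀ k t, IsRandomDistr fun ω => ((Z k ω).toFun t).toDistr := fun k t η => by
    have hG : MeasurableSet {ω | V k ω < ⊤} := measurableSet_lt (hV k) measurable_const
    refine measurable_of_tendsto_metrizable
      (f := fun j => {ω | V k ω < ⊤}.indicator fun ω => ζ k (gridFloor T j t) ω η)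
      (fun j => (hζ k _ η).indicator hG) (tendsto_pi_nhds.2 fun ω => ?_)
    by_cases h : V k ω < ⊤
    · simp only [Set.indicator, Set.mem_ofPred_eq, if_pos h]
      exact hf_lim _ h t η
    · simp only [Set.indicator, Set.mem_ofPred_eq, if_neg h]
      have h0 : ((Z k ω).toFun t).toDistr η = 0 := by
        rw [hf_top _ (not_lt_top_iff.1 h)]
        rfl
      rw [h0]
      exact tendsto_const_nhds
  have hZ : ∀ k, Measurable (Z k) := fun k =>
    measurable_of_compact_cover hφ_supp hφ_int hγ_pos (hZr k) hK (hcover k)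
  refine ⟨Z, hZ, fun k t => ?_, isTightMeasureSet_range_map hZ hV hfin hVC hp0 hK hVK⟩
  refine ae_eq_of_tendsto_gridFloor (P k) hφ hφ_int hp0 hγ₀0 (hζ k)
    ((hle k).trans_lt hbdd).ne hT t ?_
  filter_upwards [ae_lt_top (hV k) ((hVC k).trans_lt hfin.lt_top).ne] with ω hω η
  exact hf_lim _ hω t η
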